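/- Setting. Base stations (BSs) form a homogeneous Poisson point process $\Phi=\{x_k\}$ in the plane with intensity $\lambda>0$; the user is at the origin. For an integer $M\ge 1$ the plane is divided into the $M$ sectors $S_M(i)=\{x:\angle x\in[2\pi\frac{i-1}{M},2\pi\frac{i}{M})\}$, $1\le i\le M$. The path loss at distance $r$ is $l(r)=Cr^{\alpha}$ with $C>0$ and $\alpha>2$. In cycle $n=1,2,\dots$ the link from $x_k$ has fading $F_k(n)$; the fading variables are exponential with mean $1$, i.i.d. over BSs and cycles, and independent of $\Phi$, while $\Phi$ is the same in all cycles. Noise is absent (interference-limited network). Let $x_0^i$ be the BS of smallest path loss in $S_M(i)$ and let $\Gamma>0$. Sector $i$ is detected in cycle $n$ if $$\frac{F_{x_0^i}(n)/l(\|x_0^i\|)}{\sum_{x_k\in\Phi\cap S_M(i)\setminus\{x_0^i\}}F_{k}(n)/l(\|x_k\|)}>\Gamma ,$$ and cell search succeeds in cycle $n$ if at least one of the $M$ sectors is detected. Let $L_{cs}=\inf\{n\ge 1:\text{cell search succeeds in cycle }n\}\in\{1,2,\dots\}\cup\{\infty\}$, let $R_0=\min_k\|x_k\|$, and let $L_{cs}(R_0,M,\lambda)=\mathbb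 E[L_{cs}\mid R_0]$. Statement. For every integer $k\ge 0$ the integral $H(k,\alpha,\Gamma)=\int_1^\infty\bigl(1-(1+\Gamma/r^\alpha)^{-k}\bigr)\,r\,dr$ converges, and almost surely $L_{cs}(R_0,M,\lambda)$ is finite and equals the sum of the convergent series $$L_{cs}(R_0,M,\lambda)=\sum_{j=0}^{\infty}\Bigl\{\sum_{k=0}^{j}(-1)^k\binom jk e^{-2\pi\lambda R_0^2H(k,\alpha,\Gamma)/M}\Bigr\}\Bigl\{\sum_{k=0}^{j}\frac{(-1)^k\binom jk e^{-2\pi\lambda R_0^2H(k,\alpha,\Gamma)/M}}{1+2H(k,\alpha,\Gamma)}\Bigr\}^{M-1}.$$ -/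

import Mathlib

open MeasureTheory ProbabilityTheory
open scoped ENNReal NNReal

namespace CellSearch

/-- The number of points (counted with multiplicity) of the configuration `x` in the set `B`. The
plane `ℝ²` is identified with `ℂ`, whose `volume` is planar Lebesgue measure. -/
noncomputable def count (x : ℕ → ℂ) (B : Set ℂ) : ℕ∞ :=
  {k : ℕ | x k ∈ B}.encard

/-- The random points `x 0, x 1, …` (in some measurable enumeration) form a homogeneous Poisson
point process in the plane with intensity `lam`. -/
structure IsPoissonProcess {Ω : Type*} [MeasurableSpace Ω] (μ : Measure Ω)
    (x : ℕ → Ω → ℂ) (lam : ℝ) : Prop where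
  measurable : ∀ k, Measurable (x k)
  poisson : ∀ B : Set ℂ, MeasurableSet B → volume B < ∞ → ∀ n : ℕ,
    μ {ω | count (fun k => x k ω) B = n} =
      poissonMeasure (lam * (volume B).toReal).toNNReal {n}
  indep : ∀ (n : ℕ) (B : Fin n → Set ℂ), (∀ a, MeasurableSet (B a)) →
    (∀ a, volume (B a) < ∞) → (∀ a b, a ≠ b → Disjoint (B a) (B b)) →
    iIndepFun (fun a ω => count (fun k => x k ω) (B a)) μ

/-- Rayleigh fading: `F n k` is the power fading of the link from base station `x k` to the user at
the origin in cycle `n`. The family is i.i.d. over base stations and cycles, exponential with unit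
mean, and independent of the base station locations. -/
structure IsRayleighFading {Ω : Type*} [MeasurableSpace Ω] (μ : Measure Ω)
    (x : ℕ → Ω → ℂ) (F : ℕ → ℕ → Ω → ℝ) : Prop where
  measurable : ∀ n k, Measurable (F n k)
  law : ∀ n k, μ.map (F n k) = expMeasure 1
  indep : iIndepFun (fun (p : ℕ × ℕ) => F p.1 p.2) μ
  indep_locations : IndepFun (fun ω k => x k ω) (fun ω (p : ℕ × ℕ) => F p.1 p.2 ω) μ

/-- The `i`-th of the `M` sectors of the plane, with `i` counted from `0`: the points whose angle,
taken in `[0, 2π)`, lies in `[2π i / M, 2π (i + 1) / M)`. -/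
noncomputable def sector (M : ℕ) (i : Fin M) : Set ℂ :=
  {z | toIcoMod Real.two_pi_pos 0 z.arg ∈
    Set.Ico (2 * Real.pi * (i : ℝ) / M) (2 * Real.pi * ((i : ℝ) + 1) / M)}

/-- Received power `F_k / l(‖x_k‖)` from base station `k`, up to the common factor `P M`. -/
noncomputable def receivedPower (l : ℝ → ℝ) (x : ℕ → ℂ) (F : ℕ → ℝ) (k : ℕ) : ℝ≥0∞ :=
  ENNReal.ofReal (F k) / ENNReal.ofReal (l ‖x k‖)

open scoped Classical in
/-- The SINR of base station `j` at the origin when the base stations of sector `i` transmit with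
power `P` and antenna gain `M`, and the noise power is `W`. -/
noncomputable def sinr (M : ℕ) (l : ℝ → ℝ) (W P : ℝ) (x : ℕ → ℂ) (F : ℕ → ℝ)
    (i : Fin M) (j : ℕ) : ℝ≥0∞ :=
  receivedPower l x F j /
    ((∑' k : ℕ, if x k ∈ sector M i ∧ k ≠ j then receivedPower l x F k else 0)
      + ENNReal.ofReal (W / (P * M)))

/-- Base station `j` lies in sector `i` and has the smallest path loss in that sector. -/
def IsBest (M : ℕ) (l : ℝ → ℝ) (x : ℕ → ℂ) (i : Fin M) (j : ℕ) : Prop :=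
  x j ∈ sector M i ∧ ∀ k, x k ∈ sector M i → l ‖x j‖ ≤ l ‖x k‖

/-- Sector `i` is detected: the SINR of its base station of smallest path loss exceeds `Γ`. -/
def SectorDetected (M : ℕ) (Γ : ℝ) (l : ℝ → ℝ) (W P : ℝ) (x : ℕ → ℂ) (F : ℕ → ℝ)
    (i : Fin M) : Prop :=
  ∃ j, IsBest M l x i j ∧ ENNReal.ofReal Γ < sinr M l W P x F i j

/-- Cell search succeeds in a cycle iff at least one sector is detected. -/
def Success (M : ℕ) (Γ : ℝ) (l : ℝ → ℝ) (W P : ℝ) (x : ℕ → ℂ) (F : ℕ → ℝ) : Prop :=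
  ∃ i : Fin M, SectorDetected M Γ l W P x F i

/-- `L_cs = inf {n ≥ 1 : cycle n succeeds}`, equal to `∞` if no cycle succeeds. -/
noncomputable def numCycles (M : ℕ) (Γ : ℝ) (l : ℝ → ℝ) (W P : ℝ) (x : ℕ → ℂ)
    (F : ℕ → ℕ → ℝ) : ℝ≥0∞ :=
  ⨅ (n : ℕ) (_ : 1 ≤ n ∧ Success M Γ l W P x (F n)), (n : ℝ≥0∞)

/-- `R_0`: the distance from the origin to the nearest base station. -/
noncomputable def nearestDist (x : ℕ → ℂ) : ℝ := ⨅ k, ‖x k‖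

/-- `L_cs(R_0, M, λ) = E[L_cs | R_0]`: the conditional expectation of the `[0, ∞]`-valued number of
cycles given the σ-algebra generated by `R_0`. -/
noncomputable def condMeanCycles {Ω : Type*} [MeasurableSpace Ω] (μ : Measure Ω)
    (M : ℕ) (Γ : ℝ) (l : ℝ → ℝ) (W P : ℝ) (x : ℕ → Ω → ℂ) (F : ℕ → ℕ → Ω → ℝ) : Ω → ℝ≥0∞ :=
  condLExp (MeasurableSpace.comap (fun ω => nearestDist (fun k => x k ω)) inferInstance) μ
    (fun ω => numCycles M Γ l W P (fun k => x k ω) (fun n k => F n k ω))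

/-- The integrand of `H`. -/
noncomputable def hIntegrand (k : ℕ) (α Γ : ℝ) (r : ℝ) : ℝ :=
  (1 - 1 / (1 + Γ / r ^ α) ^ k) * r

/-- `H(k, α, Γ) = ∫_1^∞ (1 - (1 + Γ / r ^ α) ^ (-k)) r dr`. -/
noncomputable def H (k : ℕ) (α Γ : ℝ) : ℝ :=
  ∫ r in Set.Ioi (1 : ℝ), hIntegrand k α Γ r

end CellSearch

namespace CellSearch

open Filter Topology

/-! Fix the locations. A unit exponential exceeds an independent T with probability E exp(-T), so
sector i is detected in a cycle with probability p_i = ∏ (1 + Γ (r_j / r_k)^α)⁻¹, the product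
running over its interferers (`measure_tsum_lt`, `detProb_eq`). Different sectors and cycles use
disjoint sets of fading variables, so the first j cycles all fail with conditional probability ∏_i
(1 - p_i)^j (`measure_forall_not_success`). As L_cs = Σ_j 1{L_cs > j}, the j-th term of the series
has to be the conditional mean of this product given R_0.

Measure distance by the level v = πλr²/M. The levels in the M sectors form independent unit-rate
Poisson processes on the half-line. Given a first point at u, the mean of p_i^κ is exp(-2 H(κ) u),
so on the event that all levels exceed a each sector contributes ∫_a^∞ e^{-u} e^{-2H(κ)u} du =
e^{-(1+2H(κ))a} / (1+2H(κ)). This is `IsPoissonProcess.lintegral_regularAbove`. The process is known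
only through its counts, so the identity is proved by discretisation: levels are cut into cells of
width h with independent Poisson(h) counts, and the moment is squeezed between means of
`lowerFunctional` and `upperFunctional`, which round level ratios up and down. Those means are
controlled by geometric series with a common limit as h → 0 along c h = a.

Let V be the level of the nearest station. Binomial expansion gives E[∏ (1 - p_i)^j ; V ≥ a] =
(`missTail` at a)^M. Minus the derivative is M e^{-Mv} times `missTerm`; the case j = 0 identifies M
e^{-Mv} as the density of V, so `missTerm` at V is the conditional mean
(`IsPoissonProcess.setLIntegral_missTerm`). The exponent M - 1 comes from differentiating an M-th
power: the sector of the nearest station is differentiated, the others keep their tails.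

For finiteness, Σ_j ∏ (1 - p_i)^j = 1 / (1 - ∏ (1 - p_i)) ≤ 1 / p_i. On V < b, taking a sector with
a station below level b bounds this by a product over unit cells of (1 + gain)^count, whose mean is
finite because the gains are summable for α > 2
(`IsPoissonProcess.lintegral_iSup_cycleBound_lt_top`). -/

/-- The Laplace transform of a unit exponential at `Γ * t ^ β`: the factor by which an interferer
whose path gain is `t ^ β` times that of the serving station reduces the detection probability. -/
noncomputable def lossFactor (Γ β t : ℝ) : ℝ := (1 + Γ * t ^ β)⁻¹

/-! ### The loss factor, the integral `H` and its Riemann sums -/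

section lossFactor

variable {Γ β : ℝ}

lemma lossFactor_pos (hΓ : 0 < Γ) {t : ℝ} (ht : 0 ≤ t) : 0 < lossFactor Γ β t := by
  unfold lossFactor; positivity

lemma lossFactor_le_one (hΓ : 0 < Γ) {t : ℝ} (ht : 0 ≤ t) : lossFactor Γ β t ≤ 1 := by
  unfold lossFactor
  exact inv_le_one_of_one_le₀ (by have : 0 ≤ Γ * t ^ β := by positivity
                                  linarith)

lemma lossFactor_anti (hΓ : 0 < Γ) (hβ : 0 ≤ β) {s t : ℝ} (hs : 0 ≤ s) (hst : s ≤ t) :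
    lossFactor Γ β t ≤ lossFactor Γ β s := by
  unfold lossFactor
  gcongr

lemma one_sub_lossFactor_pow_nonneg (hΓ : 0 < Γ) {t : ℝ} (ht : 0 ≤ t) (k : ℕ) :
    0 ≤ 1 - lossFactor Γ β t ^ k :=
  sub_nonneg.2 (pow_le_one₀ (lossFactor_pos hΓ ht).le (lossFactor_le_one hΓ ht))

lemma one_sub_lossFactor_pow_le_one (hΓ : 0 < Γ) {t : ℝ} (ht : 0 ≤ t) (k : ℕ) :
    1 - lossFactor Γ β t ^ k ≤ 1 :=
  sub_le_self _ (pow_nonneg (lossFactor_pos hΓ ht).le k)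

lemma one_sub_lossFactor_pow_mono (hΓ : 0 < Γ) (hβ : 0 ≤ β) {s t : ℝ} (hs : 0 ≤ s) (hst : s ≤ t)
    (k : ℕ) : 1 - lossFactor Γ β s ^ k ≤ 1 - lossFactor Γ β t ^ k :=
  sub_le_sub_left (pow_le_pow_left₀ (lossFactor_pos hΓ (hs.trans hst)).le
    (lossFactor_anti hΓ hβ hs hst) k) 1

/-- Bernoulli's inequality. The linear bound gives integrability at infinity, where the ratio t is
small. -/
lemma one_sub_lossFactor_pow_le (hΓ : 0 < Γ) {t : ℝ} (ht : 0 ≤ t) (k : ℕ) :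
    1 - lossFactor Γ β t ^ k ≤ k * Γ * t ^ β := by
  have h0 : 0 ≤ Γ * t ^ β := by positivity
  have h1 : 1 - Γ * t ^ β ≤ lossFactor Γ β t := by
    rw [lossFactor, ← one_div, le_div_iff₀ (by positivity)]
    nlinarith
  have h2 := one_add_mul_le_pow (a := lossFactor Γ β t - 1)
    (by linarith [lossFactor_pos (β := β) hΓ ht]) k
  rw [add_sub_cancel] at h2
  have h3 : (k : ℝ) * -(Γ * t ^ β) ≤ k * (lossFactor Γ β t - 1) := by
    gcongr; linarith
  nlinarith

lemma measurable_lossFactor : Measurable (lossFactor Γ β) := by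
  unfold lossFactor; fun_prop

lemma hIntegrand_eq (k : ℕ) (α : ℝ) {r : ℝ} (hr : 0 < r) :
    hIntegrand k α Γ r = (1 - lossFactor Γ (α / 2) (r ^ 2)⁻¹ ^ k) * r := by
  have : ((r ^ 2)⁻¹) ^ (α / 2) = (r ^ α)⁻¹ := by
    rw [Real.inv_rpow (by positivity), ← Real.rpow_natCast, ← Real.rpow_mul hr.le]
    norm_num
    ring_nf
  rw [hIntegrand, lossFactor, this, inv_pow, one_div, div_eq_mul_inv]

lemma integrableOn_one_sub_lossFactor_pow (hΓ : 0 < Γ) (hβ : 1 < β) (k : ℕ) :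
    IntegrableOn (fun s => 1 - lossFactor Γ β s⁻¹ ^ k) (Set.Ioi 1) := by
  have h : IntegrableOn (fun s : ℝ => k * Γ * s ^ (-β)) (Set.Ioi 1) :=
    (integrableOn_Ioi_rpow_of_lt (by linarith) one_pos).const_mul _
  refine h.mono' ?_ ?_
  · exact ((measurable_const.sub ((measurable_lossFactor.comp measurable_inv).pow_const k))).aestronglyMeasurable
  · refine (ae_restrict_mem measurableSet_Ioi).mono fun s hs => ?_
    have hs0 : (0 : ℝ) < s := one_pos.trans hs
    rw [Real.norm_of_nonneg (one_sub_lossFactor_pow_nonneg hΓ (by positivity) k)]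
    refine (one_sub_lossFactor_pow_le hΓ (by positivity) k).trans_eq ?_
    rw [Real.inv_rpow hs0.le, Real.rpow_neg hs0.le]

lemma integrableOn_hIntegrand (hΓ : 0 < Γ) {α : ℝ} (hα : 2 < α) (k : ℕ) :
    IntegrableOn (hIntegrand k α Γ) (Set.Ioi 1) := by
  have h : IntegrableOn (fun s : ℝ => k * Γ * s ^ (1 - α)) (Set.Ioi 1) :=
    (integrableOn_Ioi_rpow_of_lt (by linarith) one_pos).const_mul _
  refine h.mono' ?_ ?_
  · unfold hIntegrand
    exact (by fun_prop : Measurable _).aestronglyMeasurable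
  · refine (ae_restrict_mem measurableSet_Ioi).mono fun s hs => ?_
    have hs0 : (0 : ℝ) < s := one_pos.trans hs
    have h1 := one_sub_lossFactor_pow_nonneg (β := α / 2) hΓ (by positivity : 0 ≤ (s ^ 2)⁻¹) k
    rw [hIntegrand_eq k α hs0, Real.norm_of_nonneg (by positivity)]
    refine (mul_le_mul_of_nonneg_right (one_sub_lossFactor_pow_le hΓ (by positivity) k)
      hs0.le).trans_eq ?_
    rw [Real.inv_rpow (by positivity), ← Real.rpow_natCast, ← Real.rpow_mul hs0.le,
      sub_eq_add_neg, Real.rpow_add hs0, Real.rpow_one, Real.rpow_neg hs0.le]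
    norm_num
    rw [mul_div_cancel₀ _ (two_ne_zero)]
    ring

/-- Substitute s = r²; the factor 2 comes from ds = 2 r dr. -/
lemma integral_one_sub_lossFactor_pow (hΓ : 0 < Γ) {α : ℝ} (hα : 2 < α) (k : ℕ) :
    ∫ s in Set.Ioi 1, (1 - lossFactor Γ (α / 2) s⁻¹ ^ k) = 2 * H k α Γ := by
  have hcont : ContinuousOn (fun s : ℝ => 1 - lossFactor Γ (α / 2) s⁻¹ ^ k) (Set.Ici 1) := by
    unfold lossFactor
    intro s hs
    have hs0 : (0 : ℝ) < s := one_pos.trans_le hs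
    refine ContinuousAt.continuousWithinAt ?_
    refine continuousAt_const.sub (ContinuousAt.pow (ContinuousAt.inv₀ ?_ (by positivity)) k)
    exact continuousAt_const.add (continuousAt_const.mul
      ((continuousAt_inv₀ hs0.ne').rpow_const (Or.inr (by linarith))))
  have himg : (fun r : ℝ => r ^ 2) '' Set.Ici 1 ⊆ Set.Ici 1 := by
    rintro _ ⟨r, hr, rfl⟩
    exact one_le_pow₀ (Set.mem_Ici.1 hr)
  have himg' : (fun r : ℝ => r ^ 2) '' Set.Ioi 1 ⊆ Set.Ioi 1 := by
    rintro _ ⟨r, hr, rfl⟩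
    exact one_lt_pow₀ (Set.mem_Ioi.1 hr) two_ne_zero
  have key := integral_comp_mul_deriv_Ioi (a := 1) (f := fun r : ℝ => r ^ 2)
    (f' := fun r => 2 * r) (g := fun s : ℝ => 1 - lossFactor Γ (α / 2) s⁻¹ ^ k)
    (by fun_prop) (tendsto_pow_atTop two_ne_zero)
    (fun r _ => by simpa using (hasDerivAt_pow 2 r).hasDerivWithinAt)
    (hcont.mono (himg'.trans Set.Ioi_subset_Ici_self))
    (((integrableOn_Ici_iff_integrableOn_Ioi (by simp)).2
      (integrableOn_one_sub_lossFactor_pow hΓ (by linarith) k)).mono_set himg) ?_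
  · simp only [one_pow] at key
    rw [← key, H, ← integral_const_mul]
    refine setIntegral_congr_fun measurableSet_Ioi fun r hr => ?_
    simp only [Function.comp]
    rw [hIntegrand_eq k α (one_pos.trans hr)]
    ring
  · refine ((integrableOn_Ici_iff_integrableOn_Ioi (by simp [ENNReal.mul_eq_top])).2
      ((integrableOn_hIntegrand hΓ hα k).const_mul 2)).congr_fun (fun r hr => ?_) measurableSet_Ici
    simp only [Function.comp]
    rw [hIntegrand_eq k α (one_pos.trans_le hr)]
    ring

lemma H_nonneg (hΓ : 0 < Γ) {α : ℝ} (k : ℕ) : 0 ≤ H k α Γ := by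
  refine setIntegral_nonneg measurableSet_Ioi fun r hr => ?_
  have hr0 : (0 : ℝ) < r := one_pos.trans hr
  rw [hIntegrand_eq k α hr0]
  exact mul_nonneg (one_sub_lossFactor_pow_nonneg hΓ (by positivity) k) hr0.le

lemma H_zero {α : ℝ} : H 0 α Γ = 0 := by
  simp [H, hIntegrand]

lemma integrableOn_one_sub_lossFactor_div_pow (hΓ : 0 < Γ) (hβ : 1 < β) (k : ℕ) {a : ℝ}
    (ha : 0 < a) : IntegrableOn (fun s => 1 - lossFactor Γ β (a / s) ^ k) (Set.Ioi a) := by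
  have := (integrableOn_Ioi_comp_mul_left_iff (fun s => 1 - lossFactor Γ β s⁻¹ ^ k) a
    (inv_pos.2 ha)).2 (by
      rw [inv_mul_cancel₀ ha.ne']
      exact integrableOn_one_sub_lossFactor_pow hΓ hβ k)
  simpa [div_eq_inv_mul, mul_comm] using this

lemma integral_one_sub_lossFactor_div_pow (hΓ : 0 < Γ) {α : ℝ} (hα : 2 < α) (k : ℕ) {a : ℝ}
    (ha : 0 < a) :
    ∫ s in Set.Ioi a, (1 - lossFactor Γ (α / 2) (a / s) ^ k) = 2 * H k α Γ * a := by
  have := integral_comp_mul_left_Ioi (fun s => 1 - lossFactor Γ (α / 2) s⁻¹ ^ k) a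
    (inv_pos.2 ha)
  rw [inv_mul_cancel₀ ha.ne', integral_one_sub_lossFactor_pow hΓ hα, inv_inv, smul_eq_mul] at this
  rw [mul_comm, ← this]
  simp [div_eq_inv_mul, mul_comm]

lemma antitoneOn_one_sub_lossFactor_div_pow (hΓ : 0 < Γ) (hβ : 0 ≤ β) (k : ℕ) {a : ℝ}
    (ha : 0 < a) : AntitoneOn (fun s => 1 - lossFactor Γ β (a / s) ^ k) (Set.Ioi 0) := by
  intro s hs t ht hst
  have hs : 0 < s := hs
  have ht : 0 < t := ht
  exact one_sub_lossFactor_pow_mono hΓ hβ (by positivity) (by gcongr) k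

/-- The first summand has ratio 1 and is at most 1; monotonicity bounds the others by the integral
over (Q + 1, ∞), which by scaling is 2 H (Q + 1). -/
lemma sum_one_sub_lossFactor_le (hΓ : 0 < Γ) {α : ℝ} (hα : 2 < α) (k Q n : ℕ) :
    ∑ q ∈ Finset.Ico (Q + 1) n, (1 - lossFactor Γ (α / 2) ((Q + 1 : ℝ) / q) ^ k) ≤
      1 + 2 * H k α Γ * (Q + 1) := by
  have hQ : (0 : ℝ) < Q + 1 := by positivity
  have hH := H_nonneg (α := α) hΓ k
  rcases le_or_gt n (Q + 1) with hn | hn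
  · rw [Finset.Ico_eq_empty_of_le hn, Finset.sum_empty]
    positivity
  obtain ⟨m, rfl⟩ : ∃ m, n = m + 1 := ⟨n - 1, by omega⟩
  have hm : Q + 1 ≤ m := by omega
  rw [Finset.sum_eq_sum_Ico_succ_bot hn, ← Finset.sum_Ico_add' _ (Q + 1) m 1]
  refine add_le_add (one_sub_lossFactor_pow_le_one hΓ (by positivity) k) ?_
  have h := AntitoneOn.sum_le_integral_Ico hm
    ((antitoneOn_one_sub_lossFactor_div_pow (β := α / 2) hΓ (by linarith) k hQ).mono
      (fun s hs => by
        have := hs.1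
        push_cast at this
        exact hQ.trans_le this))
  refine h.trans ?_
  push_cast
  rw [intervalIntegral.integral_of_le (by exact_mod_cast hm),
    ← integral_one_sub_lossFactor_div_pow hΓ hα k hQ]
  refine setIntegral_mono_set (integrableOn_one_sub_lossFactor_div_pow hΓ (by linarith) k hQ) ?_
    (Set.Ioc_subset_Ioi_self).eventuallyLE
  refine (ae_restrict_mem measurableSet_Ioi).mono fun s hs => ?_
  have : 0 < s := hQ.trans hs
  exact one_sub_lossFactor_pow_nonneg hΓ (by positivity) k

/-- Shifting q to q + 1 and dropping q = Q loses at most two terms, each at most 1. The loss is thus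
independent of Q and n. -/
lemma le_sum_one_sub_lossFactor (hΓ : 0 < Γ) {α : ℝ} (hα : 2 < α) (k : ℕ) {Q n : ℕ} (hQ : 0 < Q)
    (hn : Q < n) :
    (∫ s in (Q : ℝ)..n, (1 - lossFactor Γ (α / 2) (Q / s) ^ k)) - 2 ≤
      ∑ q ∈ Finset.Ico (Q + 1) n, (1 - lossFactor Γ (α / 2) ((Q : ℝ) / (q + 1)) ^ k) := by
  have hQ' : (0 : ℝ) < Q := by exact_mod_cast hQ
  set g : ℝ → ℝ := fun s => 1 - lossFactor Γ (α / 2) (Q / s) ^ k with hg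
  have hg0 : ∀ s : ℝ, 0 ≤ s → 0 ≤ g s := fun s hs =>
    one_sub_lossFactor_pow_nonneg hΓ (by positivity) k
  have hg1 : ∀ s : ℝ, 0 ≤ s → g s ≤ 1 := fun s hs =>
    one_sub_lossFactor_pow_le_one hΓ (by positivity) k
  have h := AntitoneOn.integral_le_sum_Ico hn.le
    ((antitoneOn_one_sub_lossFactor_div_pow (β := α / 2) hΓ (by linarith) k hQ').mono
      (fun s hs => hQ'.trans_le hs.1))
  have e1 : ∑ q ∈ Finset.Ico (Q + 1) n, (1 - lossFactor Γ (α / 2) ((Q : ℝ) / (q + 1)) ^ k) =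
      ∑ q ∈ Finset.Ico (Q + 1) n, g ((q + 1 : ℕ) : ℝ) := by
    simp [hg]
  have e2 : ∑ q ∈ Finset.Ico Q n, g q = g Q + ∑ q ∈ Finset.Ico (Q + 1) n, g q :=
    Finset.sum_eq_sum_Ico_succ_bot hn _
  have e3 : ∑ q ∈ Finset.Ico (Q + 1) n, g ((q + 1 : ℕ) : ℝ) + g ((Q + 1 : ℕ) : ℝ) =
      ∑ q ∈ Finset.Ico (Q + 1) n, g q + g n := by
    rw [Finset.sum_Ico_add' (fun q : ℕ => g q) (Q + 1) n 1, add_comm _ (g _),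
      ← Finset.sum_eq_sum_Ico_succ_bot (by omega) (fun q : ℕ => g q),
      Finset.sum_Ico_succ_top (by omega)]
  have h1 := hg1 Q (by positivity)
  have h2 := hg1 ((Q + 1 : ℕ) : ℝ) (by positivity)
  have h3 := hg0 n (by positivity)
  have h' : ∫ s in (Q : ℝ)..n, g s ≤ ∑ q ∈ Finset.Ico Q n, g q := h
  rw [e1]
  linarith

lemma tendsto_intervalIntegral_one_sub_lossFactor (hΓ : 0 < Γ) {α : ℝ} (hα : 2 < α) (k : ℕ)
    {Q : ℕ} (hQ : 0 < Q) :
    Tendsto (fun n : ℕ => ∫ s in (Q : ℝ)..n, (1 - lossFactor Γ (α / 2) (Q / s) ^ k)) atTop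
      (𝓝 (2 * H k α Γ * Q)) := by
  have hQ' : (0 : ℝ) < Q := by exact_mod_cast hQ
  rw [← integral_one_sub_lossFactor_div_pow hΓ hα k hQ']
  exact intervalIntegral_tendsto_integral_Ioi _
    (integrableOn_one_sub_lossFactor_div_pow hΓ (by linarith) k hQ') tendsto_natCast_atTop_atTop

end lossFactor

/-! ### Exponential variables and independence of blocks -/

section Exponential

lemma measurable_tsum_ennreal {X : Type*} {m : MeasurableSpace X} {f : ℕ → X → ℝ≥0∞}
    (h : ∀ k, Measurable (f k)) : Measurable fun x => ∑' k, f k x := by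
  simp_rw [ENNReal.tsum_eq_iSup_sum]
  exact .iSup fun s => s.measurable_fun_sum fun i _ => h i

/-- `EReal.exp` keeps the formula valid at T = ∞, where both sides are 0. -/
lemma expMeasure_ofReal_gt (T : ℝ≥0∞) :
    expMeasure 1 {z | T < ENNReal.ofReal z} = EReal.exp (-(T : EReal)) := by
  have := isProbabilityMeasure_expMeasure one_pos
  induction T with
  | top => simp
  | coe r =>
    have h : {z : ℝ | (r : ℝ≥0∞) < ENNReal.ofReal z} = (Set.Iic (r : ℝ))ᶜ := by
      ext z
      simp only [Set.mem_ofPred_eq, Set.compl_Iic, Set.mem_Ioi]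
      rw [← ENNReal.ofReal_coe_nnreal, ENNReal.ofReal_lt_ofReal_iff']
      exact ⟨fun h => h.1, fun h => ⟨h, r.2.trans_lt h⟩⟩
    have h2 : (expMeasure 1).real (Set.Iic (r : ℝ)) = 1 - Real.exp (-r) := by
      rw [← cdf_eq_real, cdf_expMeasure_eq one_pos, if_pos (NNReal.coe_nonneg r), one_mul]
    rw [h, ← ofReal_measureReal, probReal_compl_eq_one_sub measurableSet_Iic, h2, sub_sub_cancel]
    have : (-((r : ℝ≥0∞) : EReal)) = ((-(r : ℝ) : ℝ) : EReal) := rfl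
    rw [this, EReal.exp_coe]

lemma lintegral_exp_neg_mul_expMeasure {t : ℝ} (ht : 0 ≤ t) :
    ∫⁻ z, ENNReal.ofReal (Real.exp (-(t * max z 0))) ∂(expMeasure 1) =
      ENNReal.ofReal (1 + t)⁻¹ := by
  have h1 : 0 < 1 + t := by positivity
  have hm : Measurable (exponentialPDF 1) := by
    unfold exponentialPDF
    exact (measurable_exponentialPDFReal 1).ennreal_ofReal
  have hm' : Measurable (exponentialPDF (1 + t)) := by
    unfold exponentialPDF
    exact (measurable_exponentialPDFReal _).ennreal_ofReal
  have : expMeasure 1 = volume.withDensity (exponentialPDF 1) := rfl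
  rw [this, lintegral_withDensity_eq_lintegral_mul _ hm (by fun_prop)]
  have key : ∀ z, (exponentialPDF 1 * fun z => ENNReal.ofReal (Real.exp (-(t * max z 0)))) z =
      ENNReal.ofReal (1 + t)⁻¹ * exponentialPDF (1 + t) z := by
    intro z
    rw [Pi.mul_apply]
    rcases lt_or_ge z 0 with hz | hz
    · simp [exponentialPDF_of_neg hz]
    · rw [exponentialPDF_of_nonneg hz, exponentialPDF_of_nonneg hz, ← ENNReal.ofReal_mul (by positivity),
        ← ENNReal.ofReal_mul (by positivity), inv_mul_cancel_left₀ h1.ne', one_mul, ← Real.exp_add,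
        max_eq_left hz]
      ring_nf
  rw [lintegral_congr key, lintegral_const_mul _ hm', lintegral_exponentialPDF_eq_one h1, mul_one]

/-- Since t j = 0, the weighted sum is independent of Z j; conditioning on it leaves E exp(-sum),
and the Laplace transforms multiply. An infimum of decreasing partial products is used, so no
convergence of the weights is required. -/
lemma measure_tsum_lt {Ω' : Type*} [MeasurableSpace Ω'] {ρ : Measure Ω'} {Z : ℕ → Ω' → ℝ}
    (hZ : ∀ k, Measurable (Z k)) (hlaw : ∀ k, ρ.map (Z k) = expMeasure 1) (hind : iIndepFun Z ρ)
    {t : ℕ → ℝ} (ht : ∀ k, 0 ≤ t k) {j : ℕ} (hj : t j = 0) :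
    ρ {ω | ∑' k, ENNReal.ofReal (t k) * ENNReal.ofReal (Z k ω) < ENNReal.ofReal (Z j ω)} =
      ⨅ m, ∏ k ∈ Finset.range m, ENNReal.ofReal (1 + t k)⁻¹ := by
  have := hind.isProbabilityMeasure
  set T : Ω' → ℝ≥0∞ := fun ω => ∑' k, ENNReal.ofReal (t k) * ENNReal.ofReal (Z k ω) with hT
  have hTm : Measurable T := measurable_tsum_ennreal fun k =>
    ((hZ k).ennreal_ofReal.const_mul _)
  have hTj : IndepFun T (Z j) ρ := by
    have h := indep_iSup_of_disjoint (fun k => (hZ k).comap_le) hind.iIndep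
      (S := {j}ᶜ) (T := {j}) (by simp [disjoint_compl_left])
    rw [IndepFun_iff_Indep]
    refine indep_of_indep_of_le h ?_ (by simp)
    rw [← measurable_iff_comap_le]
    refine measurable_tsum_ennreal fun k => ?_
    by_cases hk : k = j
    · subst hk
      simp [hj]
    · have hZk : Measurable[⨆ i ∈ ({j}ᶜ : Set ℕ), MeasurableSpace.comap (Z i) inferInstance] (Z k) := by
        rw [measurable_iff_comap_le]
        exact le_iSup₂_of_le k hk le_rfl
      exact hZk.ennreal_ofReal.const_mul _
  have hset : MeasurableSet {p : ℝ≥0∞ × ℝ | p.1 < ENNReal.ofReal p.2} :=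
    measurableSet_lt measurable_fst (measurable_snd.ennreal_ofReal)
  have h1 : ρ {ω | T ω < ENNReal.ofReal (Z j ω)} = ∫⁻ ω, EReal.exp (-(T ω : EReal)) ∂ρ := by
    have := isProbabilityMeasure_expMeasure one_pos
    have e : {ω | T ω < ENNReal.ofReal (Z j ω)} =
      (fun ω => (T ω, Z j ω)) ⁻¹' {p : ℝ≥0∞ × ℝ | p.1 < ENNReal.ofReal p.2} := rfl
    rw [e, ← Measure.map_apply (hTm.prodMk (hZ j)) hset,
      (indepFun_iff_map_prod_eq_prod_map_map hTm.aemeasurable (hZ j).aemeasurable).1 hTj, hlaw,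
      Measure.prod_apply hset, lintegral_map (measurable_measure_prodMk_left hset) hTm]
    refine lintegral_congr fun ω => ?_
    rw [← expMeasure_ofReal_gt]
    rfl
  have hcont : Continuous fun T : ℝ≥0∞ => EReal.exp (-(T : EReal)) :=
    ENNReal.continuous_exp.comp (continuous_neg.comp continuous_coe_ennreal_ereal)
  have hpart : ∀ m ω, EReal.exp (-((∑ k ∈ Finset.range m,
      ENNReal.ofReal (t k) * ENNReal.ofReal (Z k ω) : ℝ≥0∞) : EReal)) =
      ∏ k ∈ Finset.range m, ENNReal.ofReal (Real.exp (-(t k * max (Z k ω) 0))) := by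
    intro m ω
    have e : ∑ k ∈ Finset.range m, ENNReal.ofReal (t k) * ENNReal.ofReal (Z k ω) =
        ENNReal.ofReal (∑ k ∈ Finset.range m, t k * max (Z k ω) 0) := by
      rw [ENNReal.ofReal_sum_of_nonneg fun k _ => mul_nonneg (ht k) (le_max_right _ _)]
      refine Finset.sum_congr rfl fun k _ => ?_
      rw [ENNReal.ofReal_mul (ht k), ENNReal.ofReal_max, ENNReal.ofReal_zero, max_eq_left zero_le]
    have hn : 0 ≤ ∑ k ∈ Finset.range m, t k * max (Z k ω) 0 :=
      Finset.sum_nonneg fun k _ => mul_nonneg (ht k) (le_max_right _ _)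
    rw [e, EReal.coe_ennreal_ofReal, max_eq_left hn, ← EReal.coe_neg, EReal.exp_coe,
      ← Finset.sum_neg_distrib, Real.exp_sum, ENNReal.ofReal_prod_of_nonneg fun k _ => (Real.exp_pos _).le]
  have h2 : Tendsto (fun m => ∏ k ∈ Finset.range m, ENNReal.ofReal (1 + t k)⁻¹) atTop
      (𝓝 (∫⁻ ω, EReal.exp (-(T ω : EReal)) ∂ρ)) := by
    have e : ∀ m, ∏ k ∈ Finset.range m, ENNReal.ofReal (1 + t k)⁻¹ =
        ∫⁻ ω, ∏ k ∈ Finset.range m, ENNReal.ofReal (Real.exp (-(t k * max (Z k ω) 0))) ∂ρ := by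
      intro m
      have hg : ∀ k, Measurable fun z : ℝ => ENNReal.ofReal (Real.exp (-(t k * max z 0))) := by
        intro k; fun_prop
      rw [lintegral_prod_eq_prod_lintegral_of_indepFun _
        (fun k ω => ENNReal.ofReal (Real.exp (-(t k * max (Z k ω) 0))))
        (hind.comp _ hg) (fun k => (hg k).comp (hZ k))]
      refine Finset.prod_congr rfl fun k _ => ?_
      rw [← lintegral_exp_neg_mul_expMeasure (ht k), ← hlaw k, lintegral_map (hg k) (hZ k)]
    simp_rw [e]
    -- All partial exponentials are at most 1, and exp(-·) is continuous on [0, ∞], so a divergent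
    -- sum needs no separate treatment.
    refine tendsto_lintegral_of_dominated_convergence (fun _ => 1) ?_ ?_ (by simp) ?_
    · intro m
      fun_prop
    · intro m
      refine Eventually.of_forall fun ω => Finset.prod_le_one' fun k _ => ?_
      rw [ENNReal.ofReal_le_one, Real.exp_le_one_iff]
      have := mul_nonneg (ht k) (le_max_right (Z k ω) 0)
      linarith
    · refine Eventually.of_forall fun ω => ?_
      simp_rw [← hpart]
      exact (hcont.tendsto _).comp (ENNReal.tendsto_nat_tsum _)
  rw [h1]
  refine tendsto_nhds_unique h2 (tendsto_atTop_iInf ?_)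
  refine antitone_nat_of_succ_le fun m => ?_
  rw [Finset.prod_range_succ]
  refine mul_le_of_le_one_right' ?_
  rw [ENNReal.ofReal_le_one]
  exact inv_le_one_of_one_le₀ (by linarith [ht m])

/-- Induction: the inserted block of indices is disjoint from the union of the remaining ones. -/
lemma measure_biInter_of_iIndep_blocks {Ω' ι κ : Type*} {m : ι → MeasurableSpace Ω'}
    [m0 : MeasurableSpace Ω'] {ρ : Measure Ω'} (hle : ∀ b, m b ≤ m0) (hm : iIndep m ρ)
    {S : κ → Set ι} (hS : Pairwise (Function.onFun Disjoint S)) {E : κ → Set Ω'}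
    (hE : ∀ a, MeasurableSet[⨆ b ∈ S a, m b] (E a)) (s : Finset κ) :
    ρ (⋂ a ∈ s, E a) = ∏ a ∈ s, ρ (E a) := by
  classical
  have := hm.isProbabilityMeasure
  induction s using Finset.induction_on with
  | empty => simp
  | insert a s ha ih =>
    rw [Finset.prod_insert ha, Finset.set_biInter_insert, ← ih]
    have hd : Disjoint (S a) (⋃ c ∈ s, S c) := by
      rw [Set.disjoint_iUnion₂_right]
      intro c hc
      exact hS (by rintro rfl; exact ha hc)
    refine (Indep_iff _ _ _).1 (indep_iSup_of_disjoint hle hm hd) _ _ (hE a) ?_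
    refine s.measurableSet_biInter fun c hc => ?_
    refine (iSup₂_le fun b hb => ?_ : (⨆ b ∈ S c, m b) ≤ ⨆ b ∈ ⋃ c ∈ s, S c, m b) _ (hE c)
    exact le_iSup₂_of_le b (Set.mem_biUnion hc hb) le_rfl

end Exponential

/-! ### Detection and failure probabilities for fixed locations -/

section Fading

instance : IsProbabilityMeasure (expMeasure 1) := isProbabilityMeasure_expMeasure one_pos

variable {M : ℕ} {Γ α C P : ℝ}

open scoped Classical in
/-- `Γ` times the path gain of base station `k` relative to that of the serving base station `j` of
sector `i`; it vanishes unless `k` is an interferer in that sector. -/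
noncomputable def interference (M : ℕ) (Γ α : ℝ) (x : ℕ → ℂ) (i : Fin M) (j k : ℕ) : ℝ :=
  if x k ∈ sector M i ∧ k ≠ j then Γ * (‖x j‖ / ‖x k‖) ^ α else 0

lemma interference_nonneg (hΓ : 0 < Γ) (x : ℕ → ℂ) (i : Fin M) (j k : ℕ) :
    0 ≤ interference M Γ α x i j k := by
  unfold interference
  split_ifs <;> positivity

lemma interference_self (x : ℕ → ℂ) (i : Fin M) (j : ℕ) : interference M Γ α x i j j = 0 := by
  simp [interference]

/-- Every sector has exactly one base station of smallest path loss, and no base station is at the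
origin. -/
def IsRegular (M : ℕ) (l : ℝ → ℝ) (x : ℕ → ℂ) : Prop :=
  (∀ k, x k ≠ 0) ∧ ∀ i : Fin M, ∃! j, IsBest M l x i j

lemma sectorDetected_iff (hΓ : 0 < Γ) (hC : 0 < C) {x : ℕ → ℂ} (hx : ∀ k, x k ≠ 0) {i : Fin M}
    {j : ℕ} (hj : IsBest M (fun r => C * r ^ α) x i j)
    (hu : ∀ j', IsBest M (fun r => C * r ^ α) x i j' → j' = j) (f : ℕ → ℝ) :
    SectorDetected M Γ (fun r => C * r ^ α) 0 P x f i ↔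
      ∑' k, ENNReal.ofReal (interference M Γ α x i j k) * ENNReal.ofReal (f k) <
        ENNReal.ofReal (f j) := by
  have hl : ∀ k, 0 < C * ‖x k‖ ^ α := fun k => by
    have := norm_pos_iff.2 (hx k)
    positivity
  have h1 : SectorDetected M Γ (fun r => C * r ^ α) 0 P x f i ↔
      ENNReal.ofReal Γ < sinr M (fun r => C * r ^ α) 0 P x f i j :=
    ⟨fun ⟨j', hb, h⟩ => hu j' hb ▸ h, fun h => ⟨j, hj, h⟩⟩
  -- Γ is neither 0 nor ∞, so the denominator may be cleared even when the interference is 0 or ∞.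
  rw [h1, sinr, zero_div, ENNReal.ofReal_zero, add_zero, ENNReal.lt_div_iff_mul_lt
    (Or.inr ENNReal.ofReal_ne_top) (Or.inr (by simpa using hΓ)), receivedPower,
    ENNReal.lt_div_iff_mul_lt (Or.inl (by simpa using hl j)) (Or.inl ENNReal.ofReal_ne_top),
    mul_right_comm, ← ENNReal.tsum_mul_left]
  refine iff_of_eq (congrArg (· < _) (tsum_congr fun k => ?_))
  by_cases hk : x k ∈ sector M i ∧ k ≠ j
  · have hk0 := norm_pos_iff.2 (hx k)
    rw [if_pos hk, interference, if_pos hk, receivedPower, ← ENNReal.ofReal_mul hΓ.le,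
      div_eq_mul_inv, ← ENNReal.ofReal_inv_of_pos (hl k), mul_comm (ENNReal.ofReal (f k)), ← mul_assoc,
      ← ENNReal.ofReal_mul (mul_nonneg hΓ.le (hl j).le)]
    congr 2
    rw [Real.div_rpow (norm_nonneg _) (norm_nonneg _)]
    field_simp
  · rw [if_neg hk, interference, if_neg hk]
    simp

/-- The conditional probability, given the locations `x`, that sector `i` is detected in a cycle. -/
noncomputable def detProb (M : ℕ) (Γ α C P : ℝ) (x : ℕ → ℂ) (i : Fin M) : ℝ≥0∞ :=
  Measure.infinitePi (fun _ : ℕ => expMeasure 1)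
    {f | SectorDetected M Γ (fun r => C * r ^ α) 0 P x f i}

/-- An arbitrary i.i.d. family is allowed, so that this serves both the single cycle behind
`detProb` and each row of the two-index fading array. -/
lemma measure_sectorDetected {Ω' : Type*} [MeasurableSpace Ω'] {ρ : Measure Ω'} {Z : ℕ → Ω' → ℝ}
    (hZ : ∀ k, Measurable (Z k)) (hlaw : ∀ k, ρ.map (Z k) = expMeasure 1) (hind : iIndepFun Z ρ)
    (hΓ : 0 < Γ) (hC : 0 < C) {x : ℕ → ℂ} (hx : ∀ k, x k ≠ 0) {i : Fin M}
    {j : ℕ} (hj : IsBest M (fun r => C * r ^ α) x i j)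
    (hu : ∀ j', IsBest M (fun r => C * r ^ α) x i j' → j' = j) :
    ρ {ω | SectorDetected M Γ (fun r => C * r ^ α) 0 P x (fun k => Z k ω) i} =
      ⨅ m, ∏ k ∈ Finset.range m, ENNReal.ofReal (1 + interference M Γ α x i j k)⁻¹ := by
  simp_rw [sectorDetected_iff hΓ hC hx hj hu]
  exact measure_tsum_lt hZ hlaw hind (interference_nonneg hΓ x i j) (interference_self x i j)

lemma detProb_eq (hΓ : 0 < Γ) (hC : 0 < C) {x : ℕ → ℂ} (hx : ∀ k, x k ≠ 0) {i : Fin M}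
    {j : ℕ} (hj : IsBest M (fun r => C * r ^ α) x i j)
    (hu : ∀ j', IsBest M (fun r => C * r ^ α) x i j' → j' = j) :
    detProb M Γ α C P x i =
      ⨅ m, ∏ k ∈ Finset.range m, ENNReal.ofReal (1 + interference M Γ α x i j k)⁻¹ :=
  measure_sectorDetected (Z := fun k (f : ℕ → ℝ) => f k) (fun k => measurable_pi_apply k)
    (fun k => Measure.infinitePi_map_eval _ k)
    (iIndepFun_infinitePi (X := fun _ z => z) (fun _ => measurable_id)) hΓ hC hx hj hu

lemma detProb_le_one (x : ℕ → ℂ) (i : Fin M) : detProb M Γ α C P x i ≤ 1 := prob_le_one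

lemma toIcoMod_arg (z : ℂ) :
    toIcoMod Real.two_pi_pos 0 z.arg = if 0 ≤ z.arg then z.arg else z.arg + 2 * Real.pi := by
  have h1 := Complex.neg_pi_lt_arg z
  have h2 := Complex.arg_le_pi z
  have h3 := Real.pi_pos
  split_ifs with h
  · rw [toIcoMod_eq_self]
    exact ⟨h, by linarith⟩
  · rw [← toIcoMod_add_right, toIcoMod_eq_self]
    exact ⟨by linarith, by linarith⟩

/-- Reading the sector index as a floor yields both disjointness and covering. -/
lemma mem_sector_iff {z : ℂ} {i : Fin M} :
    z ∈ sector M i ↔ ⌊toIcoMod Real.two_pi_pos 0 z.arg * M / (2 * Real.pi)⌋₊ = i := by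
  have hM : (0 : ℝ) < M := by exact_mod_cast i.pos
  have h0 : 0 ≤ toIcoMod Real.two_pi_pos 0 z.arg := (toIcoMod_mem_Ico' Real.two_pi_pos _).1
  have hpi := Real.two_pi_pos
  rw [Nat.floor_eq_iff (by positivity), le_div_iff₀ hpi, div_lt_iff₀ hpi]
  change _ ∈ Set.Ico _ _ ↔ _
  rw [Set.mem_Ico, div_le_iff₀ hM, lt_div_iff₀ hM, mul_comm (2 * Real.pi), mul_comm (2 * Real.pi)]

lemma exists_mem_sector (hM : 1 ≤ M) (z : ℂ) : ∃ i : Fin M, z ∈ sector M i := by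
  have hM' : (0 : ℝ) < M := by exact_mod_cast hM
  have h0 := toIcoMod_mem_Ico' Real.two_pi_pos z.arg
  have hpi := Real.two_pi_pos
  have hlt : ⌊toIcoMod Real.two_pi_pos 0 z.arg * M / (2 * Real.pi)⌋₊ < M := by
    have := h0.1
    rw [Nat.floor_lt (by positivity), div_lt_iff₀ hpi, mul_comm]
    exact mul_lt_mul_of_pos_left h0.2 hM'
  exact ⟨⟨_, hlt⟩, mem_sector_iff.2 rfl⟩

lemma sector_unique {z : ℂ} {i i' : Fin M} (h : z ∈ sector M i) (h' : z ∈ sector M i') : i = i' :=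
  Fin.ext ((mem_sector_iff.1 h).symm.trans (mem_sector_iff.1 h'))

lemma measurableSet_sector (i : Fin M) : MeasurableSet (sector M i) := by
  have h : Measurable fun z : ℂ => toIcoMod Real.two_pi_pos 0 z.arg := by
    simp_rw [toIcoMod_arg]
    exact Measurable.ite (measurableSet_le measurable_const Complex.measurable_arg)
      Complex.measurable_arg (Complex.measurable_arg.add_const _)
  exact h measurableSet_Ico

lemma measurableSet_isBest {X : Type*} [MeasurableSpace X] {x : ℕ → X → ℂ}
    (hx : ∀ k, Measurable (x k)) (i : Fin M) (j : ℕ) :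
    MeasurableSet {ω | IsBest M (fun r => C * r ^ α) (fun k => x k ω) i j} := by
  unfold IsBest
  have h1 : ∀ k, MeasurableSet {ω | x k ω ∈ sector M i} := fun k => hx k (measurableSet_sector i)
  have h2 : ∀ k, MeasurableSet {ω | C * ‖x j ω‖ ^ α ≤ C * ‖x k ω‖ ^ α} := fun k =>
    measurableSet_le (by fun_prop) (by fun_prop)
  have : {ω | x j ω ∈ sector M i ∧ ∀ k, x k ω ∈ sector M i → C * ‖x j ω‖ ^ α ≤ C * ‖x k ω‖ ^ α} =
      {ω | x j ω ∈ sector M i} ∩ ⋂ k, ({ω | x k ω ∈ sector M i}ᶜ ∪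
        {ω | C * ‖x j ω‖ ^ α ≤ C * ‖x k ω‖ ^ α}) := by
    ext ω
    simp [imp_iff_not_or]
  rw [this]
  exact (h1 j).inter (MeasurableSet.iInter fun k => (h1 k).compl.union (h2 k))

lemma measurableSet_sectorDetected {X : Type*} [MeasurableSpace X] {x : ℕ → X → ℂ} {F : ℕ → X → ℝ}
    (hx : ∀ k, Measurable (x k)) (hF : ∀ k, Measurable (F k)) (i : Fin M) :
    MeasurableSet {ω | SectorDetected M Γ (fun r => C * r ^ α) 0 P (fun k => x k ω)
      (fun k => F k ω) i} := by
  have hp : ∀ k, Measurable fun ω =>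
      receivedPower (fun r => C * r ^ α) (fun k => x k ω) (fun k => F k ω) k := by
    intro k
    unfold receivedPower
    fun_prop
  have hs : ∀ j, Measurable fun ω =>
      sinr M (fun r => C * r ^ α) 0 P (fun k => x k ω) (fun k => F k ω) i j := by
    intro j
    unfold sinr
    refine (hp j).div (Measurable.add ?_ measurable_const)
    refine measurable_tsum_ennreal fun k => Measurable.ite ?_ (hp k) measurable_const
    by_cases hk : k = j
    · simp [hk]
    · simp only [ne_eq, hk, not_false_eq_true, and_true]
      exact hx k (measurableSet_sector i)
  have : {ω | SectorDetected M Γ (fun r => C * r ^ α) 0 P (fun k => x k ω) (fun k => F k ω) i} =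
      ⋃ j, ({ω | IsBest M (fun r => C * r ^ α) (fun k => x k ω) i j} ∩
        {ω | ENNReal.ofReal Γ <
          sinr M (fun r => C * r ^ α) 0 P (fun k => x k ω) (fun k => F k ω) i j}) := by
    ext ω
    simp [SectorDetected]
  rw [this]
  exact MeasurableSet.iUnion fun j =>
    (measurableSet_isBest hx i j).inter (measurableSet_lt measurable_const (hs j))

lemma measurableSet_success {X : Type*} [MeasurableSpace X] {x : ℕ → X → ℂ} {F : ℕ → X → ℝ}
    (hx : ∀ k, Measurable (x k)) (hF : ∀ k, Measurable (F k)) :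
    MeasurableSet {ω | Success M Γ (fun r => C * r ^ α) 0 P (fun k => x k ω) (fun k => F k ω)} := by
  have : {ω | Success M Γ (fun r => C * r ^ α) 0 P (fun k => x k ω) (fun k => F k ω)} =
      ⋃ i, {ω | SectorDetected M Γ (fun r => C * r ^ α) 0 P (fun k => x k ω)
        (fun k => F k ω) i} := by
    ext ω
    simp [Success]
  rw [this]
  exact MeasurableSet.iUnion fun i => measurableSet_sectorDetected hx hF i

lemma measurable_detProb (i : Fin M) : Measurable fun x => detProb M Γ α C P x i := by
  have := measurable_measure_prodMk_left (ν := Measure.infinitePi (fun _ : ℕ => expMeasure 1))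
    (measurableSet_sectorDetected (M := M) (Γ := Γ) (α := α) (C := C) (P := P)
      (x := fun k (p : (ℕ → ℂ) × (ℕ → ℝ)) => p.1 k) (F := fun k p => p.2 k)
      (fun k => by fun_prop) (fun k => by fun_prop) i)
  exact this

/-- The fading-averaged probability that the first `N` cycles all fail, for fixed locations. -/
lemma measure_forall_not_success (hΓ : 0 < Γ) (hC : 0 < C) {x : ℕ → ℂ}
    (hx : IsRegular M (fun r => C * r ^ α) x) (N : ℕ) :
    Measure.infinitePi (fun _ : ℕ × ℕ => expMeasure 1)
      {f | ∀ n ∈ Finset.Icc 1 N,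
        ¬ Success M Γ (fun r => C * r ^ α) 0 P x (fun k => f (n, k))} =
      ∏ i, (1 - detProb M Γ α C P x i) ^ N := by
  set ρ := Measure.infinitePi (fun _ : ℕ × ℕ => expMeasure 1) with hρ
  have hind : iIndepFun (fun (p : ℕ × ℕ) (f : ℕ × ℕ → ℝ) => f p) ρ :=
    iIndepFun_infinitePi (X := fun _ z => z) (fun _ => measurable_id)
  have hlaw : ∀ p : ℕ × ℕ, ρ.map (fun f => f p) = expMeasure 1 :=
    fun p => Measure.infinitePi_map_eval _ p
  choose b hb hu using hx.2
  set D : ℕ × Fin M → Set (ℕ × ℕ → ℝ) := fun a =>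
    {f | SectorDetected M Γ (fun r => C * r ^ α) 0 P x (fun k => f (a.1, k)) a.2} with hD
  have hDm : ∀ a, MeasurableSet (D a) := fun a =>
    measurableSet_sectorDetected (x := fun k _ => x k) (F := fun k (f : ℕ × ℕ → ℝ) => f (a.1, k))
      (fun _ => measurable_const) (fun k => measurable_pi_apply _) a.2
  have hDp : ∀ a, ρ (D a) = detProb M Γ α C P x a.2 := fun a => by
    rw [detProb_eq hΓ hC hx.1 (hb a.2) (hu a.2)]
    exact measure_sectorDetected (Z := fun k (f : ℕ × ℕ → ℝ) => f (a.1, k)) (fun k => measurable_pi_apply _)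
      (fun k => hlaw _) (hind.precomp (g := fun k => (a.1, k)) (Prod.mk_right_injective _))
      hΓ hC hx.1 (hb a.2) (hu a.2)
  have hset : {f : ℕ × ℕ → ℝ | ∀ n ∈ Finset.Icc 1 N,
      ¬ Success M Γ (fun r => C * r ^ α) 0 P x (fun k => f (n, k))} =
      ⋂ a ∈ Finset.Icc 1 N ×ˢ (Finset.univ : Finset (Fin M)), (D a)ᶜ := by
    ext f
    simp only [Success, Set.mem_ofPred_eq, not_exists, Set.mem_iInter, Finset.mem_product,
      Finset.mem_univ, and_true, Prod.forall, hD, Set.mem_compl_iff]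
    exact ⟨fun h n i hn => h n hn i, fun h n hn i => h n i hn⟩
  -- The event for cycle n and sector i involves only the fading variables (n, k) with x k in sector
  -- i, and these blocks are disjoint.
  rw [hset, measure_biInter_of_iIndep_blocks
    (m := fun p : ℕ × ℕ => MeasurableSpace.comap (fun f : ℕ × ℕ → ℝ => f p) inferInstance)
    (fun p => (measurable_pi_apply p).comap_le) hind.iIndep
    (S := fun a : ℕ × Fin M => {p | p.1 = a.1 ∧ x p.2 ∈ sector M a.2})]
  · rw [Finset.prod_product_right]
    refine Finset.prod_congr rfl fun i _ => ?_
    have : ∀ n, ρ (D (n, i))ᶜ = 1 - detProb M Γ α C P x i := fun n => by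
      rw [prob_compl_eq_one_sub (hDm _), hDp]
    simp [this]
  · rintro ⟨n, i⟩ ⟨n', i'⟩ hne
    rw [Function.onFun, Set.disjoint_left]
    rintro ⟨m, k⟩ ⟨h1, h2⟩ ⟨h3, h4⟩
    exact hne (Prod.ext (h1.symm.trans h3) (sector_unique h2 h4))
  · intro a
    refine MeasurableSet.compl ?_
    have : D a = {f | ∑' k, ENNReal.ofReal (interference M Γ α x a.2 (b a.2) k) *
        ENNReal.ofReal (f (a.1, k)) < ENNReal.ofReal (f (a.1, b a.2))} := by
      ext f
      exact sectorDetected_iff hΓ hC hx.1 (hb a.2) (hu a.2) _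
    rw [this]
    have hm : ∀ k, x k ∈ sector M a.2 →
        Measurable[⨆ p ∈ {p : ℕ × ℕ | p.1 = a.1 ∧ x p.2 ∈ sector M a.2},
          MeasurableSpace.comap (fun f : ℕ × ℕ → ℝ => f p) inferInstance]
          (fun f : ℕ × ℕ → ℝ => f (a.1, k)) := by
      intro k hk
      rw [measurable_iff_comap_le]
      exact le_iSup₂_of_le (a.1, k) ⟨rfl, hk⟩ le_rfl
    refine measurableSet_lt (measurable_tsum_ennreal fun k => ?_)
      (hm _ (hb a.2).1).ennreal_ofReal
    -- Outside the sector the weight is zero, so no variable from another block enters.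
    by_cases hk : x k ∈ sector M a.2
    · exact (hm k hk).ennreal_ofReal.const_mul _
    · simp [interference, hk]

/-- Locations and fading have a product law, so the fading is integrated out first with the
locations frozen. -/
lemma measure_locations_inter_forall_not_success {Ω : Type*} [MeasurableSpace Ω] {μ : Measure Ω}
    [IsProbabilityMeasure μ] (hΓ : 0 < Γ) (hC : 0 < C) {x : ℕ → Ω → ℂ}
    (hx : ∀ k, Measurable (x k)) {F : ℕ → ℕ → Ω → ℝ} (hF : IsRayleighFading μ x F)
    (hreg : ∀ᵐ ω ∂μ, IsRegular M (fun r => C * r ^ α) (fun k => x k ω))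
    {B : Set (ℕ → ℂ)} (hB : MeasurableSet B) (N : ℕ) :
    μ {ω | (fun k => x k ω) ∈ B ∧ ∀ n ∈ Finset.Icc 1 N,
        ¬ Success M Γ (fun r => C * r ^ α) 0 P (fun k => x k ω) (fun k => F n k ω)} =
      ∫⁻ ω in {ω | (fun k => x k ω) ∈ B}, ∏ i, (1 - detProb M Γ α C P (fun k => x k ω) i) ^ N ∂μ := by
  have hX : Measurable fun ω k => x k ω := measurable_pi_lambda _ hx
  have hY : Measurable fun ω (p : ℕ × ℕ) => F p.1 p.2 ω :=
    measurable_pi_lambda _ fun p => hF.measurable _ _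
  have hlaw : μ.map (fun ω (p : ℕ × ℕ) => F p.1 p.2 ω) =
      Measure.infinitePi (fun _ : ℕ × ℕ => expMeasure 1) := by
    rw [hF.indep.map_fun_eq_infinitePi_map fun p => hF.measurable _ _]
    simp_rw [hF.law]
  set T : Set ((ℕ → ℂ) × (ℕ × ℕ → ℝ)) := {q | q.1 ∈ B ∧ ∀ n ∈ Finset.Icc 1 N,
    ¬ Success M Γ (fun r => C * r ^ α) 0 P q.1 (fun k => q.2 (n, k))} with hT
  have hTm : MeasurableSet T := by
    have : T = (Prod.fst ⁻¹' B) ∩ ⋂ n ∈ Finset.Icc 1 N,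
        {q : (ℕ → ℂ) × (ℕ × ℕ → ℝ) |
          Success M Γ (fun r => C * r ^ α) 0 P q.1 (fun k => q.2 (n, k))}ᶜ := by
      ext q
      simp [hT]
    rw [this]
    refine (measurable_fst hB).inter (Finset.measurableSet_biInter _ fun n _ => ?_)
    exact (measurableSet_success (x := fun k (q : (ℕ → ℂ) × (ℕ × ℕ → ℝ)) => q.1 k)
      (F := fun k (q : (ℕ → ℂ) × (ℕ × ℕ → ℝ)) => q.2 (n, k)) (fun k => by fun_prop) (fun k => by fun_prop)).compl
  have h1 : {ω | (fun k => x k ω) ∈ B ∧ ∀ n ∈ Finset.Icc 1 N,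
        ¬ Success M Γ (fun r => C * r ^ α) 0 P (fun k => x k ω) (fun k => F n k ω)} =
      (fun ω => ((fun k => x k ω), (fun p : ℕ × ℕ => F p.1 p.2 ω))) ⁻¹' T := rfl
  rw [h1, ← Measure.map_apply (hX.prodMk hY) hTm,
    (indepFun_iff_map_prod_eq_prod_map_map hX.aemeasurable hY.aemeasurable).1 hF.indep_locations,
    hlaw, Measure.prod_apply hTm, lintegral_map (measurable_measure_prodMk_left hTm) hX,
    ← lintegral_indicator (show MeasurableSet {ω | (fun k => x k ω) ∈ B} from hX hB)]
  refine lintegral_congr_ae (hreg.mono fun ω hω => ?_)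
  by_cases hωB : (fun k => x k ω) ∈ B
  · rw [Set.indicator_of_mem (show ω ∈ _ from hωB), ← measure_forall_not_success hΓ hC hω N]
    refine congrArg _ (Set.ext fun f => ?_)
    simp [hT, hωB]
  · rw [Set.indicator_of_notMem (show ω ∉ _ from hωB)]
    simp [hT, hωB]

end Fading

/-! ### Cells of equal area inside the sectors -/

section Cells

/-- The squared distance to the origin, scaled so that the levels of the points of one sector form a
Poisson process of unit intensity on the half-line. -/
noncomputable def level (lam : ℝ) (M : ℕ) (z : ℂ) : ℝ := Real.pi * lam * ‖z‖ ^ 2 / M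

/-- The `q`-th cell of sector `i`: the points whose level lies in `[q h, (q + 1) h)`. -/
def cell (lam h : ℝ) (M : ℕ) (i : Fin M) (q : ℕ) : Set ℂ :=
  {z | z ∈ sector M i ∧ ⌊level lam M z / h⌋₊ = q}

variable {lam h : ℝ} {M : ℕ}

lemma measurable_level : Measurable (level lam M) := by
  unfold level; fun_prop

lemma level_nonneg (hlam : 0 < lam) (z : ℂ) : 0 ≤ level lam M z := by
  have := Real.pi_pos
  unfold level; positivity

lemma measurableSet_cell (i : Fin M) (q : ℕ) : MeasurableSet (cell lam h M i q) :=
  (measurableSet_sector i).inter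
    ((Nat.measurable_floor.comp (measurable_level.div_const h)) (measurableSet_singleton q))

lemma cell_disjoint {a b : Fin M × ℕ} (hab : a ≠ b) :
    Disjoint (cell lam h M a.1 a.2) (cell lam h M b.1 b.2) := by
  rw [Set.disjoint_left]
  rintro z ⟨h1, h2⟩ ⟨h3, h4⟩
  exact hab (Prod.ext (sector_unique h1 h3) (h2.symm.trans h4))

/-- The arc may cross the branch cut of the argument: its part beyond π is translated by -2π, and
the endpoint π is null. -/
lemma volume_setOf_angle {a b : ℝ} (ha : 0 ≤ a) (hb : b ≤ 2 * Real.pi) :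
    volume {θ : ℝ | θ ∈ Set.Ioo (-Real.pi) Real.pi ∧
      (if 0 ≤ θ then θ else θ + 2 * Real.pi) ∈ Set.Ico a b} = ENNReal.ofReal (b - a) := by
  have hpi := Real.pi_pos
  set A := {θ : ℝ | θ ∈ Set.Ioo (-Real.pi) Real.pi ∧
      (if 0 ≤ θ then θ else θ + 2 * Real.pi) ∈ Set.Ico a b} with hA
  have e1 : A ∩ Set.Ici 0 = Set.Ico a b ∩ Set.Iio Real.pi := by
    ext θ
    simp only [hA, Set.mem_inter_iff, Set.mem_ofPred_eq, Set.mem_Ioo, Set.mem_Ico, Set.mem_Ici,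
      Set.mem_Iio]
    constructor
    · rintro ⟨⟨h1, h2⟩, h3⟩
      rw [if_pos h3] at h2
      exact ⟨h2, h1.2⟩
    · rintro ⟨h1, h2⟩
      have h3 : 0 ≤ θ := ha.trans h1.1
      rw [if_pos h3]
      exact ⟨⟨⟨by linarith, h2⟩, h1⟩, h3⟩
  have e2 : A \ Set.Ici 0 = (fun θ => θ + 2 * Real.pi) ⁻¹' (Set.Ico a b ∩ Set.Ioi Real.pi) := by
    ext θ
    simp only [hA, Set.mem_sdiff, Set.mem_ofPred_eq, Set.mem_Ioo, Set.mem_Ico, Set.mem_Ici,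
      Set.mem_preimage, Set.mem_inter_iff, Set.mem_Ioi]
    constructor
    · rintro ⟨⟨h1, h2⟩, h3⟩
      rw [if_neg h3] at h2
      exact ⟨h2, by linarith⟩
    · rintro ⟨h1, h2⟩
      have h3 : ¬ 0 ≤ θ := by linarith
      rw [if_neg h3]
      exact ⟨⟨⟨by linarith, by linarith⟩, h1⟩, h3⟩
  rw [← measure_inter_add_sdiff A (measurableSet_Ici (a := (0 : ℝ))), e1, e2,
    measure_preimage_add_right]
  have h3 : volume (Set.Ico a b ∩ Set.Ioi Real.pi) = volume (Set.Ico a b \ Set.Iio Real.pi) := by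
    refine measure_congr ?_
    have : Set.Ico a b \ Set.Iio Real.pi = Set.Ico a b ∩ Set.Ici Real.pi := by
      ext; simp
    rw [this]
    exact (ae_eq_refl _).inter Ioi_ae_eq_Ici
  rw [h3, measure_inter_add_sdiff _ measurableSet_Iio, Real.volume_Ico]

/-- In polar coordinates: an arc of width 2π/M times half the increment hM/(πλ) of r² is h/λ. Hence
the mean count of a cell is h. -/
lemma volume_cell (hlam : 0 < lam) (hh : 0 < h) (i : Fin M) (q : ℕ) :
    volume (cell lam h M i q) = ENNReal.ofReal (h / lam) := by
  have hpi := Real.pi_pos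
  have hM : (0 : ℝ) < M := by exact_mod_cast i.pos
  have hiM : (i : ℝ) + 1 ≤ M := by exact_mod_cast i.2
  set c := Real.pi * lam / M with hc
  have hc0 : 0 < c := by positivity
  set A := {θ : ℝ | θ ∈ Set.Ioo (-Real.pi) Real.pi ∧
      (if 0 ≤ θ then θ else θ + 2 * Real.pi) ∈
      Set.Ico (2 * Real.pi * (i : ℝ) / M) (2 * Real.pi * ((i : ℝ) + 1) / M)} with hA
  set r₁ := √(q * h / c)
  set r₂ := √((q + 1) * h / c)
  have hr : r₁ ≤ r₂ := Real.sqrt_le_sqrt (by gcongr; linarith)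
  have hvA : volume A = ENNReal.ofReal (2 * Real.pi / M) := by
    rw [volume_setOf_angle (by positivity)]
    · congr 1; field_simp; ring
    · rw [div_le_iff₀ hM]; gcongr
  have hAm : MeasurableSet A := by
    refine measurableSet_Ioo.inter ?_
    exact (Measurable.ite measurableSet_Ici measurable_id (measurable_id.add_const _))
      measurableSet_Ico
  have key : ∀ p ∈ polarCoord.target, (ENNReal.ofReal p.1 *
      (cell lam h M i q).indicator 1 (Complex.polarCoord.symm p) : ℝ≥0∞) =
      (Set.Ico r₁ r₂).indicator (fun r => ENNReal.ofReal r) p.1 * A.indicator 1 p.2 := by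
    rintro ⟨r, θ⟩ hp
    simp only [polarCoord_target, Set.mem_prod, Set.mem_Ioi] at hp
    obtain ⟨hr0, hθ⟩ := hp
    have hθ' : θ ∈ Set.Ioc (-Real.pi) Real.pi := ⟨hθ.1, hθ.2.le⟩
    set z := Complex.polarCoord.symm (r, θ) with hz
    have hzn : ‖z‖ = r := by
      rw [hz, Complex.norm_polarCoord_symm, abs_of_pos hr0]
    have hza : z.arg = θ := by
      rw [hz, Complex.polarCoord_symm_apply]
      push_cast
      exact Complex.arg_mul_cos_add_sin_mul_I hr0 hθ'
    have hmem : z ∈ cell lam h M i q ↔ r ∈ Set.Ico r₁ r₂ ∧ θ ∈ A := by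
      have h1 : z ∈ sector M i ↔ θ ∈ A := by
        rw [hA]
        change _ ∈ Set.Ico _ _ ↔ _ ∧ _
        rw [toIcoMod_arg, hza]
        exact ⟨fun h => ⟨hθ, h⟩, fun h => h.2⟩
      have h2 : ⌊level lam M z / h⌋₊ = q ↔ r ∈ Set.Ico r₁ r₂ := by
        have : level lam M z = c * r ^ 2 := by rw [level, hzn, hc]; ring
        rw [this, Nat.floor_eq_iff (by positivity), le_div_iff₀ hh, div_lt_iff₀ hh, Set.mem_Ico,
          Real.sqrt_le_left hr0.le, Real.lt_sqrt hr0.le, div_le_iff₀' hc0, lt_div_iff₀' hc0]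
      rw [← h1, ← h2, and_comm]
      rfl
    by_cases h1 : r ∈ Set.Ico r₁ r₂ <;> by_cases h2 : θ ∈ A <;> simp [Set.indicator, hmem, h1, h2]
  rw [← lintegral_indicator_one (measurableSet_cell i q), ← Complex.lintegral_comp_polarCoord_symm]
  simp only [smul_eq_mul]
  rw [setLIntegral_congr_fun polarCoord.open_target.measurableSet key, polarCoord_target,
    Measure.volume_eq_prod, ← Measure.prod_restrict,
    lintegral_prod_mul (by fun_prop (disch := measurability))
      ((measurable_one.indicator hAm).aemeasurable), lintegral_indicator_one hAm,
    lintegral_indicator measurableSet_Ico, Measure.restrict_restrict measurableSet_Ico,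
    Measure.restrict_apply hAm]
  have hA' : A ∩ Set.Ioo (-Real.pi) Real.pi = A := Set.inter_eq_left.2 fun θ hθ => hθ.1
  have hI : (Set.Ico r₁ r₂ ∩ Set.Ioi 0 : Set ℝ) =ᵐ[volume] Set.Ioc r₁ r₂ := by
    have : (Set.Ico r₁ r₂ ∩ Set.Ici 0 : Set ℝ) = Set.Ico r₁ r₂ :=
      Set.inter_eq_left.2 fun r hr => (Real.sqrt_nonneg _).trans hr.1
    have h1 := (ae_eq_refl (μ := volume) (Set.Ico r₁ r₂)).inter (Ioi_ae_eq_Ici (a := (0 : ℝ)))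
    rw [this] at h1
    exact h1.trans Ico_ae_eq_Ioc
  rw [hA', hvA, Measure.restrict_congr_set hI, ← ofReal_integral_eq_lintegral_ofReal,
    ← intervalIntegral.integral_of_le hr, integral_id, Real.sq_sqrt (by positivity),
    Real.sq_sqrt (by positivity), ← ENNReal.ofReal_mul]
  · congr 1
    rw [hc]
    field_simp
    ring
  · have : q * h / c ≤ (q + 1) * h / c := by gcongr; linarith
    linarith
  · exact (intervalIntegral.intervalIntegrable_id).1
  · refine (ae_restrict_mem measurableSet_Ioc).mono fun r hr => ?_
    exact (Real.sqrt_nonneg _).trans hr.1.le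

/-- Having at least n points is a countable union over index sets of size n. -/
lemma measurable_count {Ω : Type*} [MeasurableSpace Ω] {x : ℕ → Ω → ℂ}
    (hx : ∀ k, Measurable (x k)) {B : Set ℂ} (hB : MeasurableSet B) :
    Measurable fun ω => count (fun k => x k ω) B := by
  have hle : ∀ n : ℕ, MeasurableSet {ω | (n : ℕ∞) ≤ count (fun k => x k ω) B} := by
    intro n
    have : {ω | (n : ℕ∞) ≤ count (fun k => x k ω) B} =
        ⋃ s : {s : Finset ℕ // s.card = n}, ⋂ k ∈ s.1, x k ⁻¹' B := by
      ext ω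
      simp only [count, Set.mem_ofPred_eq, Set.mem_iUnion, Set.mem_iInter, Set.mem_preimage,
        Subtype.exists, exists_prop]
      constructor
      · intro h
        obtain ⟨t, ht, htn⟩ := Set.exists_subset_encard_eq h
        have hf : t.Finite := Set.finite_of_encard_eq_coe htn
        refine ⟨hf.toFinset, ?_, fun k hk => ht (hf.mem_toFinset.1 hk)⟩
        rw [hf.encard_eq_coe_toFinset_card] at htn
        exact_mod_cast htn
      · rintro ⟨s, hs, h⟩
        rw [← hs, ← Set.encard_coe_eq_coe_finsetCard]
        exact Set.encard_le_encard fun k hk => h k hk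
    rw [this]
    exact MeasurableSet.iUnion fun s => Finset.measurableSet_biInter _ fun k _ => hx k hB
  refine measurable_to_countable' fun n => ?_
  induction n with
  | top =>
    have : (fun ω => count (fun k => x k ω) B) ⁻¹' {⊤} =
        ⋂ n : ℕ, {ω | (n : ℕ∞) ≤ count (fun k => x k ω) B} := by
      ext ω
      simp only [Set.mem_preimage, Set.mem_singleton_iff, Set.mem_iInter, Set.mem_ofPred_eq]
      exact ⟨fun h n => h ▸ le_top, fun h => ENat.eq_top_iff_forall_ge.2 h⟩
    rw [this]
    exact MeasurableSet.iInter hle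
  | coe n =>
    have : (fun ω => count (fun k => x k ω) B) ⁻¹' {(n : ℕ∞)} =
        {ω | (n : ℕ∞) ≤ count (fun k => x k ω) B} \
          {ω | ((n + 1 : ℕ) : ℕ∞) ≤ count (fun k => x k ω) B} := by
      ext ω
      simp only [Set.mem_preimage, Set.mem_singleton_iff, Set.mem_sdiff, Set.mem_ofPred_eq, not_le]
      push_cast
      rw [ENat.lt_natCast_add_one_iff, le_antisymm_iff, and_comm]
    rw [this]
    exact (hle n).diff (hle _)

/-! ### Cell counts as independent Poisson variables -/

section Poisson

variable {Ω : Type*} [MeasurableSpace Ω] {μ : Measure Ω} [IsProbabilityMeasure μ]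
  {x : ℕ → Ω → ℂ}

/-- The Poisson masses of the finite values already add up to 1. -/
lemma IsPoissonProcess.ae_count_ne_top (hx : IsPoissonProcess μ x lam) {B : Set ℂ}
    (hB : MeasurableSet B) (hv : volume B < ∞) :
    ∀ᵐ ω ∂μ, count (fun k => x k ω) B ≠ ⊤ := by
  have hm := measurable_count hx.measurable hB
  have h1 : {ω | count (fun k => x k ω) B ≠ ⊤} =
      ⋃ n : ℕ, (fun ω => count (fun k => x k ω) B) ⁻¹' {(n : ℕ∞)} := by
    ext ω
    simp only [Set.mem_ofPred_eq, Set.mem_iUnion, Set.mem_preimage, Set.mem_singleton_iff]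
    rw [ENat.ne_top_iff_exists]
    simp only [eq_comm]
  have h2 : μ {ω | count (fun k => x k ω) B ≠ ⊤} = 1 := by
    rw [h1, measure_iUnion]
    · have : ∀ n : ℕ, μ ((fun ω => count (fun k => x k ω) B) ⁻¹' {(n : ℕ∞)}) =
          poissonMeasure (lam * (volume B).toReal).toNNReal {n} := hx.poisson B hB hv
      simp_rw [this]
      have h := Measure.tsum_indicator_apply_singleton
        (poissonMeasure (lam * (volume B).toReal).toNNReal) Set.univ MeasurableSet.univ
      simpa using h
    · intro a b hab
      refine Disjoint.preimage _ ?_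
      simpa using hab
    · exact fun n => hm (measurableSet_singleton _)
  exact (prob_compl_eq_zero_iff (hm (measurableSet_singleton ⊤).compl)).2 h2

/-- The number of points of the configuration in a set, as a natural number. -/
noncomputable def natCount (x : ℕ → ℂ) (B : Set ℂ) : ℕ := (count x B).toNat

lemma measurable_natCount {x : ℕ → Ω → ℂ} (hx : ∀ k, Measurable (x k)) {B : Set ℂ}
    (hB : MeasurableSet B) : Measurable fun ω => natCount (fun k => x k ω) B :=
  (measurable_of_countable _).comp (measurable_count hx hB)

/-- The convention that `toNat` sends ⊤ to 0 matters only on a null set. -/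
lemma IsPoissonProcess.map_natCount (hx : IsPoissonProcess μ x lam) {B : Set ℂ}
    (hB : MeasurableSet B) (hv : volume B < ∞) :
    μ.map (fun ω => natCount (fun k => x k ω) B) =
      poissonMeasure (lam * (volume B).toReal).toNNReal := by
  refine Measure.ext_of_singleton fun n => ?_
  rw [Measure.map_apply (measurable_natCount hx.measurable hB) (measurableSet_singleton n),
    ← hx.poisson B hB hv n]
  refine measure_congr ((hx.ae_count_ne_top hB hv).mono fun ω hω => ?_)
  refine propext ?_
  change (count (fun k => x k ω) B).toNat = n ↔ count (fun k => x k ω) B = n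
  rw [← ENat.natCast_inj, ENat.natCast_toNat hω]

/-- A single point has zero area, so the count at the origin has mean 0. -/
lemma IsPoissonProcess.ae_ne_zero (hx : IsPoissonProcess μ x lam) :
    ∀ᵐ ω ∂μ, ∀ k, x k ω ≠ 0 := by
  have h := hx.poisson {0} (measurableSet_singleton _) (by simp) 0
  have h1 : μ {ω | count (fun k => x k ω) {0} = (0 : ℕ)} = 1 := by
    rw [h]
    simp [poissonMeasure_singleton]
  have h2 : ∀ᵐ ω ∂μ, count (fun k => x k ω) {0} = (0 : ℕ) :=
    (prob_compl_eq_zero_iff (measurable_count hx.measurable (measurableSet_singleton _)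
      (measurableSet_singleton _))).2 h1
  refine h2.mono fun ω hω k hk => ?_
  have : k ∈ {k : ℕ | x k ω ∈ ({0} : Set ℂ)} := hk
  rw [count, Nat.cast_zero, Set.encard_eq_zero] at hω
  rw [hω] at this
  exact this

lemma IsPoissonProcess.map_natCount_cell (hx : IsPoissonProcess μ x lam) (hlam : 0 < lam) (hh : 0 < h)
    (i : Fin M) (q : ℕ) :
    μ.map (fun ω => natCount (fun k => x k ω) (cell lam h M i q)) = poissonMeasure h.toNNReal := by
  have hv := volume_cell hlam hh i q
  rw [hx.map_natCount (measurableSet_cell i q) (by simp [hv]), hv,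
    ENNReal.toReal_ofReal (by positivity), mul_div_cancel₀ _ hlam.ne']

lemma IsPoissonProcess.ae_count_cell_ne_top (hx : IsPoissonProcess μ x lam) (hlam : 0 < lam) (hh : 0 < h) :
    ∀ᵐ ω ∂μ, ∀ (i : Fin M) q, count (fun k => x k ω) (cell lam h M i q) ≠ ⊤ := by
  rw [ae_all_iff]
  intro i
  rw [ae_all_iff]
  intro q
  exact hx.ae_count_ne_top (measurableSet_cell i q) (by simp [volume_cell hlam hh i q])

lemma IsPoissonProcess.iIndepFun_natCount_cell (hx : IsPoissonProcess μ x lam) (hlam : 0 < lam) (hh : 0 < h)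
    (n : ℕ) :
    iIndepFun (fun (p : Fin M × Fin n) ω =>
      natCount (fun k => x k ω) (cell lam h M p.1 p.2)) μ := by
  -- Independence is given for families indexed by `Fin`, so the pairs (sector, cell) are flattened.
  have h1 := hx.indep (M * n)
    (fun a => cell lam h M (finProdFinEquiv.symm a).1 (finProdFinEquiv.symm a).2)
    (fun a => measurableSet_cell _ _) (fun a => by simp [volume_cell hlam hh])
    (fun a b hab => cell_disjoint (a := ((finProdFinEquiv.symm a).1, ((finProdFinEquiv.symm a).2 : ℕ)))
      (b := ((finProdFinEquiv.symm b).1, ((finProdFinEquiv.symm b).2 : ℕ))) fun hEq => hab (by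
        apply finProdFinEquiv.symm.injective
        exact Prod.ext (Prod.ext_iff.1 hEq).1 (Fin.ext (Prod.ext_iff.1 hEq).2)))
  have h2 := (h1.comp (fun _ => ENat.toNat) (fun _ => measurable_of_countable _)).precomp
    (g := finProdFinEquiv (m := M) (n := n)) finProdFinEquiv.injective
  convert h2 using 2 with p
  ext ω
  simp [natCount]

end Poisson

end Cells

/-! ### Bounding the interference product by cell counts -/

section Pointwise

/-- The index of the cell containing `z` within its sector. -/
noncomputable def cellIndex (lam h : ℝ) (M : ℕ) (z : ℂ) : ℕ := ⌊level lam M z / h⌋₊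

variable {M : ℕ} {lam h Γ α C P : ℝ} {x : ℕ → ℂ} {i : Fin M} {j : ℕ}

lemma mem_cell_iff {z : ℂ} {q : ℕ} :
    z ∈ cell lam h M i q ↔ z ∈ sector M i ∧ cellIndex lam h M z = q := Iff.rfl

lemma finite_of_count_ne_top {B : Set ℂ} (hB : count x B ≠ ⊤) : {k | x k ∈ B}.Finite :=
  Set.encard_ne_top_iff.1 hB

lemma natCount_eq_card {B : Set ℂ} (hB : count x B ≠ ⊤) :
    natCount x B = (finite_of_count_ne_top hB).toFinset.card := by
  rw [natCount, count, (finite_of_count_ne_top hB).encard_eq_coe_toFinset_card]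
  rfl

lemma card_le_natCount {B : Set ℂ} (hB : count x B ≠ ⊤) {s : Finset ℕ} (hs : ∀ k ∈ s, x k ∈ B) :
    s.card ≤ natCount x B := by
  rw [natCount_eq_card hB]
  exact Finset.card_le_card fun k hk => (finite_of_count_ne_top hB).mem_toFinset.2 (hs k hk)

lemma natCount_ne_zero_iff {B : Set ℂ} (hB : count x B ≠ ⊤) :
    natCount x B ≠ 0 ↔ ∃ k, x k ∈ B := by
  rw [natCount_eq_card hB, Finset.card_ne_zero]
  exact ⟨fun ⟨k, hk⟩ => ⟨k, (finite_of_count_ne_top hB).mem_toFinset.1 hk⟩,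
    fun ⟨k, hk⟩ => ⟨k, (finite_of_count_ne_top hB).mem_toFinset.2 hk⟩⟩

lemma eq_of_natCount_eq_one {B : Set ℂ} (hB : count x B ≠ ⊤) (h1 : natCount x B = 1) {k k' : ℕ}
    (hk : x k ∈ B) (hk' : x k' ∈ B) : k = k' := by
  rw [natCount_eq_card hB] at h1
  exact Finset.card_le_one.1 h1.le k ((finite_of_count_ne_top hB).mem_toFinset.2 hk) k'
    ((finite_of_count_ne_top hB).mem_toFinset.2 hk')

lemma prod_comp_eq_prod_pow (s T : Finset ℕ) (d : ℕ → ℕ) (hd : ∀ k ∈ s, d k ∈ T)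
    (w : ℕ → ℝ≥0∞) : ∏ k ∈ s, w (d k) = ∏ q ∈ T, w q ^ (s.filter fun k => d k = q).card := by
  rw [← Finset.prod_fiberwise_of_maps_to hd]
  refine Finset.prod_congr rfl fun q _ => ?_
  rw [Finset.prod_congr rfl fun k hk => by rw [(Finset.mem_filter.1 hk).2], Finset.prod_const]

lemma level_pos (hlam : 0 < lam) (i : Fin M) {z : ℂ} (hz : z ≠ 0) : 0 < level lam M z := by
  have hM : (0 : ℝ) < M := by exact_mod_cast i.pos
  have := Real.pi_pos
  have := norm_pos_iff.2 hz
  unfold level; positivity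

lemma cellIndex_mono (hh : 0 < h) {z w : ℂ} (hzw : level lam M z ≤ level lam M w) :
    cellIndex lam h M z ≤ cellIndex lam h M w :=
  Nat.floor_le_floor (by gcongr)

lemma isBest_iff (hlam : 0 < lam) (hC : 0 < C) (hα : 0 < α) :
    IsBest M (fun r => C * r ^ α) x i j ↔
      x j ∈ sector M i ∧ ∀ k, x k ∈ sector M i → level lam M (x j) ≤ level lam M (x k) := by
  have hM : (0 : ℝ) < M := by exact_mod_cast i.pos
  have hpi := Real.pi_pos
  have : ∀ k, C * ‖x j‖ ^ α ≤ C * ‖x k‖ ^ α ↔ level lam M (x j) ≤ level lam M (x k) := fun k => by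
    unfold level
    rw [mul_le_mul_iff_right₀ hC, Real.rpow_le_rpow_iff (norm_nonneg _) (norm_nonneg _) hα,
      div_le_div_iff_of_pos_right hM, mul_le_mul_iff_right₀ (by positivity),
      pow_le_pow_iff_left₀ (norm_nonneg _) (norm_nonneg _) two_ne_zero]
  simp only [IsBest, this]

/-- A ratio of levels is a squared ratio of distances, which is why the exponent becomes α / 2. -/
lemma inv_one_add_interference (hlam : 0 < lam) (hx : ∀ k, x k ≠ 0) {k : ℕ}
    (hk : x k ∈ sector M i) (hkj : k ≠ j) :
    (1 + interference M Γ α x i j k)⁻¹ =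
      lossFactor Γ (α / 2) (level lam M (x j) / level lam M (x k)) := by
  have hM : (0 : ℝ) < M := by exact_mod_cast i.pos
  have hpi := Real.pi_pos
  have hk0 := norm_pos_iff.2 (hx k)
  have : level lam M (x j) / level lam M (x k) = (‖x j‖ / ‖x k‖) ^ (2 : ℝ) := by
    unfold level
    rw [Real.rpow_two]
    field_simp
  rw [interference, if_pos ⟨hk, hkj⟩, lossFactor, this, ← Real.rpow_mul (by positivity),
    mul_div_cancel₀ _ two_ne_zero]

lemma ofReal_inv_one_add_interference_le_one (hΓ : 0 < Γ) (k : ℕ) :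
    ENNReal.ofReal (1 + interference M Γ α x i j k)⁻¹ ≤ 1 := by
  rw [ENNReal.ofReal_le_one]
  exact inv_le_one_of_one_le₀ (by linarith [interference_nonneg (α := α) hΓ x i j k])

/-- Counting every point of a cell, not just those among the first m interferers, only adds factors
at most 1. -/
lemma prod_pow_natCount_le_prod {w : ℕ → ℝ≥0∞} {T : Finset ℕ} {m : ℕ}
    (hfin : ∀ q, count x (cell lam h M i q) ≠ ⊤) (hw : ∀ q ∈ T, w q ≤ 1)
    (hk : ∀ k < m, x k ∈ sector M i → k ≠ j → cellIndex lam h M (x k) ∈ T ∧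
      w (cellIndex lam h M (x k)) ≤ ENNReal.ofReal (1 + interference M Γ α x i j k)⁻¹) :
    ∏ q ∈ T, w q ^ natCount x (cell lam h M i q) ≤
      ∏ k ∈ Finset.range m, ENNReal.ofReal (1 + interference M Γ α x i j k)⁻¹ := by
  classical
  set K := (Finset.range m).filter fun k => x k ∈ sector M i ∧ k ≠ j with hK
  have hK' : ∀ k ∈ K, k < m ∧ x k ∈ sector M i ∧ k ≠ j := fun k hk => by
    simpa [hK] using hk
  calc ∏ q ∈ T, w q ^ natCount x (cell lam h M i q)
      ≤ ∏ q ∈ T, w q ^ (K.filter fun k => cellIndex lam h M (x k) = q).card := by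
        refine Finset.prod_le_prod' fun q hq => ?_
        refine pow_le_pow_right_of_le_one' (hw q hq) (card_le_natCount (hfin q) fun k hk => ?_)
        obtain ⟨h1, h2⟩ := Finset.mem_filter.1 hk
        exact ⟨(hK' k h1).2.1, h2⟩
    _ = ∏ k ∈ K, w (cellIndex lam h M (x k)) :=
        (prod_comp_eq_prod_pow K T _ (fun k hkK => (hk k (hK' k hkK).1 (hK' k hkK).2.1
          (hK' k hkK).2.2).1) w).symm
    _ ≤ ∏ k ∈ K, ENNReal.ofReal (1 + interference M Γ α x i j k)⁻¹ :=
        Finset.prod_le_prod' fun k hkK => (hk k (hK' k hkK).1 (hK' k hkK).2.1 (hK' k hkK).2.2).2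
    _ = ∏ k ∈ Finset.range m, ENNReal.ofReal (1 + interference M Γ α x i j k)⁻¹ := by
        refine Finset.prod_subset (Finset.filter_subset _ _) fun k hkm hkK => ?_
        have : ¬ (x k ∈ sector M i ∧ k ≠ j) := fun h => hkK (Finset.mem_filter.2 ⟨hkm, h⟩)
        simp [interference, this]

/-- Only finitely many stations lie in the cells of T; discarding all other factors, each at most 1,
enlarges the product. -/
lemma iInf_prod_le_prod_pow_natCount (hΓ : 0 < Γ) {w : ℕ → ℝ≥0∞} {T : Finset ℕ}
    (hfin : ∀ q, count x (cell lam h M i q) ≠ ⊤)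
    (hk : ∀ k, x k ∈ sector M i → cellIndex lam h M (x k) ∈ T →
      ENNReal.ofReal (1 + interference M Γ α x i j k)⁻¹ ≤ w (cellIndex lam h M (x k))) :
    ⨅ m, ∏ k ∈ Finset.range m, ENNReal.ofReal (1 + interference M Γ α x i j k)⁻¹ ≤
      ∏ q ∈ T, w q ^ natCount x (cell lam h M i q) := by
  classical
  set K := T.biUnion fun q => (finite_of_count_ne_top (hfin q)).toFinset with hK
  have hmem : ∀ k, k ∈ K ↔ x k ∈ sector M i ∧ cellIndex lam h M (x k) ∈ T := fun k => by
    simp [hK, mem_cell_iff]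
    tauto
  have hcard : ∀ q ∈ T, (K.filter fun k => cellIndex lam h M (x k) = q).card =
      natCount x (cell lam h M i q) := fun q hq => by
    rw [natCount_eq_card (hfin q)]
    congr 1
    ext k
    simp only [Finset.mem_filter, hmem, Set.Finite.mem_toFinset, Set.mem_ofPred_eq, mem_cell_iff]
    constructor
    · rintro ⟨⟨h1, -⟩, h3⟩
      exact ⟨h1, h3⟩
    · rintro ⟨h1, h3⟩
      exact ⟨⟨h1, h3 ▸ hq⟩, h3⟩
  refine (iInf_le _ (K.sup id + 1)).trans ?_
  calc ∏ k ∈ Finset.range (K.sup id + 1), ENNReal.ofReal (1 + interference M Γ α x i j k)⁻¹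
      ≤ ∏ k ∈ K, ENNReal.ofReal (1 + interference M Γ α x i j k)⁻¹ := by
        refine Finset.prod_le_prod_of_subset_of_le_one' ?_
          fun k _ _ => ofReal_inv_one_add_interference_le_one hΓ k
        exact fun k hkK => Finset.mem_range.2 (Nat.lt_succ_of_le (Finset.le_sup (f := id) hkK))
    _ ≤ ∏ k ∈ K, w (cellIndex lam h M (x k)) :=
        Finset.prod_le_prod' fun k hkK => hk k ((hmem k).1 hkK).1 ((hmem k).1 hkK).2
    _ = ∏ q ∈ T, w q ^ (K.filter fun k => cellIndex lam h M (x k) = q).card :=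
        prod_comp_eq_prod_pow K T _ (fun k hkK => ((hmem k).1 hkK).2) w
    _ = ∏ q ∈ T, w q ^ natCount x (cell lam h M i q) :=
        Finset.prod_congr rfl fun q hq => by rw [hcard q hq]

/-- The contribution of cell `q`, occupied by `N` points, when `Q` is the first occupied cell. -/
noncomputable def slot (e : ℕ → ℝ≥0∞) (w : ℕ → ℝ≥0∞) (Q q N : ℕ) : ℝ≥0∞ :=
  if q < Q then (if N = 0 then 1 else 0) else if q = Q then e N else w q ^ N

lemma prod_slot_eq (e w : ℕ → ℝ≥0∞) {N : ℕ → ℕ} {Q n : ℕ} (hQn : Q < n) :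
    ∏ q ∈ Finset.range n, slot e w Q q (N q) =
      (∏ q ∈ Finset.range Q, if N q = 0 then 1 else 0) * e (N Q) *
        ∏ q ∈ Finset.Ico (Q + 1) n, w q ^ N q := by
  rw [← Finset.prod_range_mul_prod_Ico _ (Nat.succ_le_of_lt hQn), Finset.prod_range_succ]
  congr 1
  · congr 1
    · exact Finset.prod_congr rfl fun q hq => by simp [slot, Finset.mem_range.1 hq]
    · simp [slot]
  · refine Finset.prod_congr rfl fun q hq => ?_
    have := (Finset.mem_Ico.1 hq).1
    rw [slot, if_neg (by omega), if_neg (by omega)]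

/-- An occupied cell before Q, or an empty cell Q, kills the product. A quantity depending on the
first occupied cell thus becomes a sum over Q of products over cells, a form whose mean independence
can evaluate. -/
lemma prod_slot_eq_zero {e w : ℕ → ℝ≥0∞} (he : e 0 = 0) {N : ℕ → ℕ} {Q Q₀ n : ℕ}
    (h0 : ∀ q < Q₀, N q = 0) (hQ₀ : N Q₀ ≠ 0) (hn : Q₀ < n) (hQ : Q ≠ Q₀) :
    ∏ q ∈ Finset.range n, slot e w Q q (N q) = 0 := by
  rcases lt_or_gt_of_ne hQ with h | h
  · refine Finset.prod_eq_zero (Finset.mem_range.2 (h.trans hn)) ?_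
    simp [slot, h0 Q h, he]
  · refine Finset.prod_eq_zero (Finset.mem_range.2 hn) ?_
    simp [slot, h, hQ₀]

lemma sum_prod_slot_eq {e : ℕ → ℝ≥0∞} {w : ℕ → ℕ → ℝ≥0∞} (he : e 0 = 0) {N : ℕ → ℕ} {Q₀ n : ℕ}
    (h0 : ∀ q < Q₀, N q = 0) (hQ₀ : N Q₀ ≠ 0) (hn : Q₀ < n) (J : Finset ℕ) :
    ∑ Q ∈ J, ∏ q ∈ Finset.range n, slot e (w Q) Q q (N q) =
      if Q₀ ∈ J then e (N Q₀) * ∏ q ∈ Finset.Ico (Q₀ + 1) n, w Q₀ q ^ N q else 0 := by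
  rw [Finset.sum_congr rfl (g := fun Q => if Q = Q₀ then
    e (N Q₀) * ∏ q ∈ Finset.Ico (Q₀ + 1) n, w Q₀ q ^ N q else 0)]
  · exact Finset.sum_ite_eq' J Q₀ _
  · intro Q _
    split_ifs with hQ
    · subst hQ
      rw [prod_slot_eq _ _ hn, Finset.prod_eq_one fun q hq => if_pos (h0 q (Finset.mem_range.1 hq)),
        one_mul]
    · exact prod_slot_eq_zero he h0 hQ₀ hn hQ

lemma sum_prod_slot_eq_zero {e : ℕ → ℝ≥0∞} {w : ℕ → ℕ → ℝ≥0∞} (he : e 0 = 0) {N : ℕ → ℕ} {n : ℕ}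
    (h0 : ∀ q < n, N q = 0) {J : Finset ℕ} (hJ : ∀ Q ∈ J, Q < n) :
    ∑ Q ∈ J, ∏ q ∈ Finset.range n, slot e (w Q) Q q (N q) = 0 :=
  Finset.sum_eq_zero fun Q hQ => Finset.prod_eq_zero (Finset.mem_range.2 (hJ Q hQ))
    (by simp [slot, h0 Q (hJ Q hQ), he])

/-- The indicator of a cell occupied by exactly one point. -/
def singleOccupied (N : ℕ) : ℝ≥0∞ := if N = 1 then 1 else 0

/-- The indicator of an occupied cell. -/
def occupied (N : ℕ) : ℝ≥0∞ := if N = 0 then 0 else 1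

/-- A lower bound for the `κ`-th power of the detection probability in terms of the occupation
numbers `N` of the first `n` cells, vanishing unless the first occupied cell has index at least `c`
and contains a single point. -/
noncomputable def lowerFunctional (Γ β : ℝ) (c n κ : ℕ) (N : ℕ → ℕ) : ℝ≥0∞ :=
  ∑ Q ∈ Finset.Ico c n, ∏ q ∈ Finset.range n,
    slot singleOccupied (fun q => ENNReal.ofReal (lossFactor Γ β ((Q + 1 : ℝ) / q)) ^ κ) Q q (N q)

/-- An upper bound for the `κ`-th power of the detection probability in terms of the occupation
numbers `N` of the first `n` cells, provided that the first `c` cells are empty. -/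
noncomputable def upperFunctional (Γ β : ℝ) (c n κ : ℕ) (N : ℕ → ℕ) : ℝ≥0∞ :=
  ∑ Q ∈ Finset.Ico c (n + 1), ∏ q ∈ Finset.range n,
    slot occupied (fun q => ENNReal.ofReal (lossFactor Γ β ((Q : ℝ) / (q + 1))) ^ κ) Q q (N q)

lemma ofReal_lossFactor_le_one {β t : ℝ} (hΓ : 0 < Γ) (ht : 0 ≤ t) :
    ENNReal.ofReal (lossFactor Γ β t) ≤ 1 :=
  ENNReal.ofReal_le_one.2 (lossFactor_le_one hΓ ht)

lemma lowerFunctional_eq {β : ℝ} {c n κ : ℕ} {N : ℕ → ℕ} {Q₀ : ℕ}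
    (h0 : ∀ q < Q₀, N q = 0) (hQ₀ : N Q₀ ≠ 0) (hn : Q₀ < n) :
    lowerFunctional Γ β c n κ N = if c ≤ Q₀ ∧ N Q₀ = 1 then
      (∏ q ∈ Finset.Ico (Q₀ + 1) n,
        ENNReal.ofReal (lossFactor Γ β ((Q₀ + 1 : ℝ) / q)) ^ N q) ^ κ else 0 := by
  rw [lowerFunctional, sum_prod_slot_eq (by simp [singleOccupied]) h0 hQ₀ hn]
  by_cases hc : c ≤ Q₀ <;> by_cases h1 : N Q₀ = 1
  all_goals simp [hc, h1, hn, singleOccupied, ← Finset.prod_pow, pow_right_comm]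

lemma lowerFunctional_le_one (hΓ : 0 < Γ) (β : ℝ) (c n κ : ℕ) (N : ℕ → ℕ) :
    lowerFunctional Γ β c n κ N ≤ 1 := by
  by_cases h : ∃ q < n, N q ≠ 0
  · classical
    have hf := Nat.find_spec h
    rw [lowerFunctional_eq (Q₀ := Nat.find h) (fun q hq => by
      by_contra hne
      exact Nat.find_min h hq ⟨hq.trans hf.1, hne⟩) hf.2 hf.1]
    split_ifs
    · exact pow_le_one' (Finset.prod_le_one' fun q _ =>
        pow_le_one' (ofReal_lossFactor_le_one hΓ (by positivity)) _) _
    · exact zero_le_one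
  · push Not at h
    rw [lowerFunctional, sum_prod_slot_eq_zero (by simp [singleOccupied]) h
      fun Q hQ => (Finset.mem_Ico.1 hQ).2]
    exact zero_le_one

end Pointwise

/-! ### Sandwiching powers of the detection probability -/

section Sandwich

variable {M : ℕ} {lam h Γ α C P : ℝ} {x : ℕ → ℂ} {i : Fin M} {j : ℕ}

lemma le_cellIndex_of_empty (hfin : ∀ q, count x (cell lam h M i q) ≠ ⊤) {Q : ℕ}
    (h0 : ∀ q < Q, natCount x (cell lam h M i q) = 0) {k : ℕ} (hk : x k ∈ sector M i) :
    Q ≤ cellIndex lam h M (x k) := by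
  by_contra! hlt
  exact (natCount_ne_zero_iff (hfin _)).2 ⟨k, hk, rfl⟩ (h0 _ hlt)

lemma IsBest.cellIndex_eq (hh : 0 < h) (hlam : 0 < lam) (hC : 0 < C) (hα : 0 < α)
    (hj : IsBest M (fun r => C * r ^ α) x i j)
    (hfin : ∀ q, count x (cell lam h M i q) ≠ ⊤) {Q : ℕ}
    (h0 : ∀ q < Q, natCount x (cell lam h M i q) = 0)
    (hQ : natCount x (cell lam h M i Q) ≠ 0) : cellIndex lam h M (x j) = Q := by
  obtain ⟨k, hk, hkQ⟩ := (natCount_ne_zero_iff (hfin Q)).1 hQ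
  obtain ⟨hj1, hj2⟩ := (isBest_iff hlam hC hα).1 hj
  refine le_antisymm ?_ (le_cellIndex_of_empty hfin h0 hj1)
  exact (cellIndex_mono hh (hj2 k hk)).trans_eq hkQ

/-- A lone point in the first occupied cell excludes ties, since every other station of the sector
lies in a later cell. -/
lemma exists_unique_best_of_natCount_eq_one (hh : 0 < h) (hlam : 0 < lam) (hC : 0 < C) (hα : 0 < α)
    (hfin : ∀ q, count x (cell lam h M i q) ≠ ⊤) {Q : ℕ}
    (h0 : ∀ q < Q, natCount x (cell lam h M i q) = 0)
    (hQ : natCount x (cell lam h M i Q) = 1) :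
    ∃ j, IsBest M (fun r => C * r ^ α) x i j ∧
      ∀ j', IsBest M (fun r => C * r ^ α) x i j' → j' = j := by
  obtain ⟨j, hj, hjQ⟩ := (natCount_ne_zero_iff (hfin Q)).1 (by omega)
  have hbest : IsBest M (fun r => C * r ^ α) x i j := by
    refine (isBest_iff hlam hC hα).2 ⟨hj, fun k hk => ?_⟩
    by_contra! hlt
    have h1 : cellIndex lam h M (x k) = Q :=
      le_antisymm ((cellIndex_mono hh hlt.le).trans_eq hjQ) (le_cellIndex_of_empty hfin h0 hk)
    have h2 : k = j := eq_of_natCount_eq_one (hfin Q) hQ ⟨hk, h1⟩ ⟨hj, hjQ⟩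
    exact hlt.ne (by rw [h2])
  refine ⟨j, hbest, fun j' hj' => ?_⟩
  exact eq_of_natCount_eq_one (hfin Q) hQ
    ⟨hj'.1, hj'.cellIndex_eq hh hlam hC hα hfin h0 (by omega)⟩ ⟨hj, hjQ⟩

lemma cellIndex_le_level_div (hh : 0 < h) (hlam : 0 < lam) (z : ℂ) :
    (cellIndex lam h M z : ℝ) ≤ level lam M z / h :=
  Nat.floor_le (div_nonneg (level_nonneg hlam z) hh.le)

lemma level_div_lt_cellIndex_add_one (z : ℂ) :
    level lam M z / h < (cellIndex lam h M z : ℝ) + 1 := Nat.lt_floor_add_one _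

/-- The serving level is below (Q + 1) h and an interferer in cell q has level at least q h, so (Q +
1) / q overestimates the level ratio. It suffices that n exceeds Q and the cells of the first m
stations. -/
lemma eventually_lowerFunctional_le (hh : 0 < h) (hlam : 0 < lam) (hΓ : 0 < Γ) (hC : 0 < C)
    (hα : 0 < α) (hx : ∀ k, x k ≠ 0) (hj : IsBest M (fun r => C * r ^ α) x i j)
    (hfin : ∀ q, count x (cell lam h M i q) ≠ ⊤) {Q : ℕ}
    (h0 : ∀ q < Q, natCount x (cell lam h M i q) = 0)
    (hQ : natCount x (cell lam h M i Q) = 1) (c κ m : ℕ) :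
    ∀ᶠ n in atTop, lowerFunctional Γ (α / 2) c n κ (fun q => natCount x (cell lam h M i q)) ≤
      (∏ k ∈ Finset.range m, ENNReal.ofReal (1 + interference M Γ α x i j k)⁻¹) ^ κ := by
  filter_upwards [eventually_gt_atTop Q,
    eventually_gt_atTop ((Finset.range m).sup fun k => cellIndex lam h M (x k))] with n hnQ hn
  rw [lowerFunctional_eq h0 (by omega) hnQ]
  split_ifs
  swap
  · exact zero_le
  refine pow_le_pow_left' ?_ κ
  have hjQ := hj.cellIndex_eq hh hlam hC hα hfin h0 (by omega)
  refine prod_pow_natCount_le_prod hfin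
    (fun q _ => ofReal_lossFactor_le_one hΓ (by positivity)) fun k hkm hk hkj => ?_
  have hQk : Q < cellIndex lam h M (x k) := by
    refine lt_of_le_of_ne (le_cellIndex_of_empty hfin h0 hk) fun hEq => hkj ?_
    exact eq_of_natCount_eq_one (hfin Q) hQ ⟨hk, hEq.symm⟩ ⟨hj.1, hjQ⟩
  refine ⟨Finset.mem_Ico.2 ⟨hQk, lt_of_le_of_lt (Finset.le_sup
    (f := fun k => cellIndex lam h M (x k)) (Finset.mem_range.2 hkm)) hn⟩, ?_⟩
  rw [inv_one_add_interference hlam hx hk hkj]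
  refine ENNReal.ofReal_le_ofReal (lossFactor_anti hΓ (by linarith) ?_ ?_)
  · exact div_nonneg (level_nonneg hlam _) (level_nonneg hlam _)
  · have h1 := level_div_lt_cellIndex_add_one (lam := lam) (h := h) (M := M) (x j)
    have h2 := cellIndex_le_level_div (M := M) hh hlam (x k)
    have h3 : (0 : ℝ) < cellIndex lam h M (x k) := by exact_mod_cast (Nat.zero_le Q).trans_lt hQk
    rw [hjQ] at h1
    rw [← div_div_div_cancel_right₀ hh.ne']
    gcongr

/-- Here Q / (q + 1) underestimates the level ratio, and interferers in the serving cell or beyond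
the first n cells are ignored. -/
lemma detProb_pow_le_upperFunctional (hh : 0 < h) (hlam : 0 < lam) (hΓ : 0 < Γ) (hC : 0 < C)
    (hα : 0 < α) (hx : IsRegular M (fun r => C * r ^ α) x) (i : Fin M)
    (hfin : ∀ q, count x (cell lam h M i q) ≠ ⊤) {c : ℕ}
    (hc : ∀ k, c * h ≤ level lam M (x k)) {n : ℕ} (hcn : c ≤ n) (κ : ℕ) :
    detProb M Γ α C P x i ^ κ ≤
      upperFunctional Γ (α / 2) c n κ (fun q => natCount x (cell lam h M i q)) := by
  classical
  have hc' : ∀ k, c ≤ cellIndex lam h M (x k) := fun k =>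
    Nat.le_floor ((le_div_iff₀ hh).2 (hc k))
  obtain ⟨j, hj, hu⟩ := hx.2 i
  set N := fun q => natCount x (cell lam h M i q) with hN
  by_cases hex : ∃ q < n, N q ≠ 0
  · have hf := Nat.find_spec hex
    set Q := Nat.find hex with hQdef
    have h0 : ∀ q < Q, N q = 0 := fun q hq => by
      by_contra hne
      exact Nat.find_min hex hq ⟨hq.trans hf.1, hne⟩
    have hjQ : cellIndex lam h M (x j) = Q := hj.cellIndex_eq hh hlam hC hα hfin h0 hf.2
    have hcQ : c ≤ Q := hjQ ▸ hc' j
    rw [upperFunctional, sum_prod_slot_eq (by simp [occupied]) h0 hf.2 hf.1,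
      if_pos (Finset.mem_Ico.2 ⟨hcQ, by have := hf.1; omega⟩), occupied, if_neg hf.2, one_mul]
    simp_rw [pow_right_comm _ κ]
    rw [Finset.prod_pow]
    refine pow_le_pow_left' ?_ κ
    rw [detProb_eq hΓ hC hx.1 hj hu]
    refine iInf_prod_le_prod_pow_natCount hΓ hfin fun k hk hkT => ?_
    have hQk : Q < cellIndex lam h M (x k) := (Finset.mem_Ico.1 hkT).1
    have hkj : k ≠ j := by
      rintro rfl
      omega
    rw [inv_one_add_interference hlam hx.1 hk hkj]
    have hk0 := level_pos hlam i (hx.1 k)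
    refine ENNReal.ofReal_le_ofReal (lossFactor_anti hΓ (by linarith) (by positivity) ?_)
    have h1 := level_div_lt_cellIndex_add_one (lam := lam) (h := h) (M := M) (x k)
    have h2 := cellIndex_le_level_div (M := M) hh hlam (x j)
    rw [hjQ] at h2
    rw [← div_div_div_cancel_right₀ hh.ne' (level lam M (x j))]
    have h3 : 0 ≤ level lam M (x j) / h := div_nonneg (level_nonneg hlam _) hh.le
    gcongr
  -- With the first n cells empty, the extra index Q = n in `upperFunctional` supplies a term equal
  -- to 1.
  · push Not at hex
    refine (pow_le_one' (detProb_le_one x i) κ).trans ?_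
    refine le_trans ?_ (Finset.single_le_sum (fun _ _ => zero_le)
      (Finset.mem_Ico.2 ⟨hcn, n.lt_succ_self⟩))
    rw [Finset.prod_eq_one]
    intro q hq
    simp [slot, Finset.mem_range.1 hq, hex q (Finset.mem_range.1 hq)]

end Sandwich

/-! ### Means of the functionals under Poisson counts -/

section Expectation

variable {h Γ α : ℝ}

lemma lintegral_poissonMeasure (r : ℝ≥0) (f : ℕ → ℝ≥0∞) :
    ∫⁻ n, f n ∂(poissonMeasure r) =
      ∑' n : ℕ, f n * ENNReal.ofReal (Real.exp (-r) * r ^ n / n.factorial) := by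
  rw [lintegral_countable']
  simp_rw [poissonMeasure_singleton]

lemma lintegral_poissonMeasure_eq_zero (hh : 0 < h) :
    ∫⁻ n, (if n = 0 then 1 else 0) ∂(poissonMeasure h.toNNReal) = ENNReal.ofReal (Real.exp (-h)) := by
  rw [lintegral_poissonMeasure, tsum_eq_single 0 (fun n hn => by simp [hn])]
  simp [Real.coe_toNNReal h hh.le]

lemma lintegral_poissonMeasure_singleOccupied (hh : 0 < h) :
    ∫⁻ n, singleOccupied n ∂(poissonMeasure h.toNNReal) =
      ENNReal.ofReal (h * Real.exp (-h)) := by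
  rw [lintegral_poissonMeasure, tsum_eq_single 1 (fun n hn => by simp [singleOccupied, hn])]
  simp [singleOccupied, Real.coe_toNNReal h hh.le, mul_comm]

lemma lintegral_poissonMeasure_occupied_le (hh : 0 < h) :
    ∫⁻ n, occupied n ∂(poissonMeasure h.toNNReal) ≤ ENNReal.ofReal h := by
  have h1 : ∫⁻ n, occupied n ∂(poissonMeasure h.toNNReal) +
      ∫⁻ n, (if n = 0 then 1 else 0) ∂(poissonMeasure h.toNNReal) = 1 := by
    rw [← lintegral_add_left (measurable_of_countable _)]
    have : ∀ n : ℕ, occupied n + (if n = 0 then 1 else 0) = 1 := fun n => by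
      by_cases hn : n = 0 <;> simp [occupied, hn]
    simp [this]
  rw [lintegral_poissonMeasure_eq_zero hh] at h1
  have h2 : ∫⁻ n, occupied n ∂(poissonMeasure h.toNNReal) = 1 - ENNReal.ofReal (Real.exp (-h)) :=
    ENNReal.eq_sub_of_add_eq ENNReal.ofReal_ne_top h1
  rw [h2, ← ENNReal.ofReal_one, ← ENNReal.ofReal_sub _ (Real.exp_pos _).le]
  exact ENNReal.ofReal_le_ofReal (by linarith [Real.add_one_le_exp (-h)])

/-- The probability generating function of the Poisson law. -/
lemma lintegral_poissonMeasure_pow (hh : 0 < h) {y : ℝ} (hy : 0 ≤ y) :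
    ∫⁻ n, ENNReal.ofReal y ^ n ∂(poissonMeasure h.toNNReal) =
      ENNReal.ofReal (Real.exp (-(h * (1 - y)))) := by
  have hs := (NormedSpace.expSeries_div_hasSum_exp (h * y)).mul_left (Real.exp (-h))
  rw [← Real.exp_eq_exp_ℝ, ← Real.exp_add] at hs
  have e : -(h * (1 - y)) = -h + h * y := by ring
  rw [lintegral_poissonMeasure, e, ← hs.tsum_eq,
    ENNReal.ofReal_tsum_of_nonneg (fun n => by positivity) hs.summable]
  refine tsum_congr fun n => ?_
  rw [← ENNReal.ofReal_pow hy, ← ENNReal.ofReal_mul (by positivity), Real.coe_toNNReal h hh.le,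
    mul_pow]
  congr 1
  ring

lemma prod_lintegral_slot (hh : 0 < h) (e w : ℕ → ℝ≥0∞) {Q n : ℕ} (hQn : Q < n) :
    ∏ q ∈ Finset.range n, ∫⁻ N, slot e w Q q N ∂(poissonMeasure h.toNNReal) =
      ENNReal.ofReal (Real.exp (-h)) ^ Q * (∫⁻ N, e N ∂(poissonMeasure h.toNNReal)) *
        ∏ q ∈ Finset.Ico (Q + 1) n, ∫⁻ N, w q ^ N ∂(poissonMeasure h.toNNReal) := by
  rw [← Finset.prod_range_mul_prod_Ico _ (Nat.succ_le_of_lt hQn), Finset.prod_range_succ]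
  congr 1
  · congr 1
    · rw [← lintegral_poissonMeasure_eq_zero hh, Finset.prod_congr rfl, Finset.prod_const,
        Finset.card_range]
      exact fun q hq => by simp [slot, Finset.mem_range.1 hq]
    · simp [slot]
  · refine Finset.prod_congr rfl fun q hq => ?_
    have := (Finset.mem_Ico.1 hq).1
    simp only [slot, if_neg (show ¬ q < Q by omega), if_neg (show ¬ q = Q by omega)]

lemma prod_lintegral_slot_self (hh : 0 < h) (e w : ℕ → ℝ≥0∞) (n : ℕ) :
    ∏ q ∈ Finset.range n, ∫⁻ N, slot e w n q N ∂(poissonMeasure h.toNNReal) =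
      ENNReal.ofReal (Real.exp (-h)) ^ n := by
  rw [← lintegral_poissonMeasure_eq_zero hh, Finset.prod_congr rfl, Finset.prod_const,
    Finset.card_range]
  exact fun q hq => by simp [slot, Finset.mem_range.1 hq]

lemma prod_lintegral_pow (hh : 0 < h) {y : ℕ → ℝ} (hy : ∀ q, 0 ≤ y q) (T : Finset ℕ) (κ : ℕ) :
    ∏ q ∈ T, ∫⁻ N, (ENNReal.ofReal (y q) ^ κ) ^ N ∂(poissonMeasure h.toNNReal) =
      ENNReal.ofReal (Real.exp (-(h * ∑ q ∈ T, (1 - y q ^ κ)))) := by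
  have : ∀ q, ∫⁻ N, (ENNReal.ofReal (y q) ^ κ) ^ N ∂(poissonMeasure h.toNNReal) =
      ENNReal.ofReal (Real.exp (-(h * (1 - y q ^ κ)))) := fun q => by
    rw [← ENNReal.ofReal_pow (hy q), lintegral_poissonMeasure_pow hh (pow_nonneg (hy q) κ)]
  simp_rw [this]
  rw [← ENNReal.ofReal_prod_of_nonneg fun q _ => (Real.exp_pos _).le, ← Real.exp_sum,
    Finset.sum_neg_distrib, Finset.mul_sum]

/-- Empty cells give e^{-hQ}, the single point gives h e^{-h}, and the generating functions are
bounded through `sum_one_sub_lossFactor_le`. The exponent is then affine in Q, hence a geometric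
term. -/
lemma le_prod_lintegral_slot (hh : 0 < h) (hΓ : 0 < Γ) (hα : 2 < α) (κ : ℕ) {Q n : ℕ}
    (hQn : Q < n) :
    ENNReal.ofReal (h * Real.exp (-(2 * h + 2 * H κ α Γ * h)) *
        Real.exp (-((1 + 2 * H κ α Γ) * h)) ^ Q) ≤
      ∏ q ∈ Finset.range n, ∫⁻ N, slot singleOccupied
        (fun q => ENNReal.ofReal (lossFactor Γ (α / 2) ((Q + 1 : ℝ) / q)) ^ κ) Q q N
        ∂(poissonMeasure h.toNNReal) := by
  rw [prod_lintegral_slot hh _ _ hQn, lintegral_poissonMeasure_singleOccupied hh,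
    prod_lintegral_pow hh (fun q => (lossFactor_pos hΓ (by positivity)).le),
    ← ENNReal.ofReal_pow (Real.exp_pos _).le, ← ENNReal.ofReal_mul (by positivity),
    ← ENNReal.ofReal_mul (by positivity)]
  refine ENNReal.ofReal_le_ofReal ?_
  have h1 := sum_one_sub_lossFactor_le hΓ hα κ Q n
  have h2 : Real.exp (-(h * (1 + 2 * H κ α Γ * (Q + 1)))) ≤ Real.exp (-(h *
      ∑ q ∈ Finset.Ico (Q + 1) n, (1 - lossFactor Γ (α / 2) ((Q + 1 : ℝ) / q) ^ κ))) := by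
    gcongr
  refine le_trans (le_of_eq ?_) (mul_le_mul_of_nonneg_left h2 (by positivity))
  rw [← Real.exp_nat_mul, ← Real.exp_nat_mul]
  have : h * Real.exp (-(2 * h + 2 * H κ α Γ * h)) *
      Real.exp (Q * -((1 + 2 * H κ α Γ) * h)) = h * (Real.exp (-(2 * h + 2 * H κ α Γ * h)) *
      Real.exp (Q * -((1 + 2 * H κ α Γ) * h))) := by ring
  rw [this, ← Real.exp_add]
  have : Real.exp (Q * -h) * (h * Real.exp (-h)) * Real.exp (-(h * (1 + 2 * H κ α Γ * (Q + 1)))) =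
    h * (Real.exp (Q * -h) * Real.exp (-h) * Real.exp (-(h * (1 + 2 * H κ α Γ * (Q + 1))))) := by
    ring
  rw [this, ← Real.exp_add, ← Real.exp_add]
  ring_nf

/-- The integral approximating the exponent of the upper bound. -/
noncomputable def truncatedIntegral (Γ α : ℝ) (κ Q n : ℕ) : ℝ :=
  ∫ s in (Q : ℝ)..n, (1 - lossFactor Γ (α / 2) (Q / s) ^ κ)

lemma truncatedIntegral_zero (hα : 2 < α) (κ n : ℕ) : truncatedIntegral Γ α κ 0 n = 0 := by
  have : (0 : ℝ) ^ (α / 2) = 0 := Real.zero_rpow (by linarith)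
  simp [truncatedIntegral, lossFactor, this]

lemma truncatedIntegral_nonneg (hΓ : 0 < Γ) (κ : ℕ) {Q n : ℕ} (hQn : Q ≤ n) :
    0 ≤ truncatedIntegral Γ α κ Q n := by
  refine intervalIntegral.integral_nonneg (by exact_mod_cast hQn) fun s hs => ?_
  have : 0 ≤ s := (Nat.cast_nonneg Q).trans hs.1
  exact one_sub_lossFactor_pow_nonneg hΓ (by positivity) κ

lemma tendsto_truncatedIntegral (hΓ : 0 < Γ) (hα : 2 < α) (κ Q : ℕ) :
    Tendsto (truncatedIntegral Γ α κ Q) atTop (𝓝 (2 * H κ α Γ * Q)) := by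
  rcases Nat.eq_zero_or_pos Q with rfl | hQ
  · have : truncatedIntegral Γ α κ 0 = fun _ => 0 := funext (truncatedIntegral_zero hα κ)
    simp [this]
  · exact tendsto_intervalIntegral_one_sub_lossFactor hΓ hα κ hQ

/-- The error 2 in `le_sum_one_sub_lossFactor` becomes the factor e^{2h}, which tends to 1 with h.
-/
lemma prod_lintegral_slot_le (hh : 0 < h) (hΓ : 0 < Γ) (hα : 2 < α) (κ : ℕ) {Q n : ℕ}
    (hQn : Q < n) :
    ∏ q ∈ Finset.range n, ∫⁻ N, slot occupied
        (fun q => ENNReal.ofReal (lossFactor Γ (α / 2) ((Q : ℝ) / (q + 1))) ^ κ) Q q N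
        ∂(poissonMeasure h.toNNReal) ≤
      ENNReal.ofReal (h * Real.exp (2 * h) * Real.exp (-h) ^ Q *
        Real.exp (-(h * truncatedIntegral Γ α κ Q n))) := by
  have hsum : truncatedIntegral Γ α κ Q n - 2 ≤
      ∑ q ∈ Finset.Ico (Q + 1) n, (1 - lossFactor Γ (α / 2) ((Q : ℝ) / (q + 1)) ^ κ) := by
    rcases Nat.eq_zero_or_pos Q with rfl | hQ
    · rw [truncatedIntegral_zero hα]
      refine le_trans (by norm_num) (Finset.sum_nonneg fun q _ => ?_)
      exact one_sub_lossFactor_pow_nonneg hΓ (by positivity) κ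
    · exact le_sum_one_sub_lossFactor hΓ hα κ hQ hQn
  rw [prod_lintegral_slot hh _ _ hQn,
    prod_lintegral_pow hh (fun q => (lossFactor_pos hΓ (by positivity)).le),
    ← ENNReal.ofReal_pow (Real.exp_pos _).le]
  refine (mul_le_mul_left (mul_le_mul_right (lintegral_poissonMeasure_occupied_le hh) _) _).trans ?_
  rw [← ENNReal.ofReal_mul (by positivity), ← ENNReal.ofReal_mul (by positivity)]
  refine ENNReal.ofReal_le_ofReal ?_
  have h2 : Real.exp (-(h * ∑ q ∈ Finset.Ico (Q + 1) n,
      (1 - lossFactor Γ (α / 2) ((Q : ℝ) / (q + 1)) ^ κ))) ≤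
      Real.exp (-(h * (truncatedIntegral Γ α κ Q n - 2))) := by gcongr
  refine (mul_le_mul_of_nonneg_left h2 (by positivity)).trans_eq ?_
  have : -(h * (truncatedIntegral Γ α κ Q n - 2)) =
    2 * h + -(h * truncatedIntegral Γ α κ Q n) := by ring
  rw [this, Real.exp_add]
  ring

variable {M : ℕ} {lam : ℝ} {Ω : Type*} [MeasurableSpace Ω] {μ : Measure Ω} [IsProbabilityMeasure μ]
  {x : ℕ → Ω → ℂ}

/-- After the product of sums is expanded, each summand is a product of functions of distinct cell
counts, and its mean factors. -/
lemma IsPoissonProcess.lintegral_prod_sum_prod (hx : IsPoissonProcess μ x lam) (hlam : 0 < lam)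
    (hh : 0 < h) (n : ℕ) (J : Finset ℕ) (g : Fin M → ℕ → ℕ → ℕ → ℝ≥0∞) :
    ∫⁻ ω, ∏ i, ∑ Q ∈ J, ∏ q ∈ Finset.range n,
        g i Q q (natCount (fun k => x k ω) (cell lam h M i q)) ∂μ =
      ∏ i, ∑ Q ∈ J, ∏ q ∈ Finset.range n, ∫⁻ N, g i Q q N ∂(poissonMeasure h.toNNReal) := by
  have hN : ∀ (i : Fin M) (q : ℕ),
      Measurable fun ω => natCount (fun k => x k ω) (cell lam h M i q) := fun i q =>
    measurable_natCount hx.measurable (measurableSet_cell i q)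
  have hg : ∀ i Q q, Measurable fun ω =>
      g i Q q (natCount (fun k => x k ω) (cell lam h M i q)) := fun i Q q =>
    (measurable_of_countable (g i Q q)).comp (hN i q)
  simp_rw [Finset.prod_univ_sum]
  rw [lintegral_finsetSum _ fun p _ => Finset.measurable_fun_prod _ fun i _ =>
    Finset.measurable_fun_prod _ fun q _ => hg i (p i) q]
  refine Finset.sum_congr rfl fun p _ => ?_
  have key := lintegral_prod_eq_prod_lintegral_of_indepFun (Finset.univ : Finset (Fin M × Fin n))
    (fun a ω => g a.1 (p a.1) a.2 (natCount (fun k => x k ω) (cell lam h M a.1 a.2)))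
    ((hx.iIndepFun_natCount_cell hlam hh n).comp (fun a => g a.1 (p a.1) a.2)
      (fun a => measurable_of_countable _)) (fun a => hg _ _ _)
  simp_rw [Fintype.prod_prod_type] at key
  simp_rw [← Fin.prod_univ_eq_prod_range]
  rw [key]
  refine Finset.prod_congr rfl fun i _ => ?_
  refine Finset.prod_congr rfl fun q _ => ?_
  rw [← hx.map_natCount_cell hlam hh i q, lintegral_map (measurable_of_countable _) (hN i q)]

end Expectation

/-! ### Letting the number of cells tend to infinity -/

section Limits

variable {M : ℕ} {lam h Γ α C P : ℝ}

lemma tendsto_sum_Ico_geometric {A r : ℝ} (hr0 : 0 ≤ r) (hr1 : r < 1) (c : ℕ) :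
    Tendsto (fun n => ∑ Q ∈ Finset.Ico c n, A * r ^ Q) atTop (𝓝 (A * r ^ c / (1 - r))) := by
  have h1 := (((hasSum_geometric_of_lt_one hr0 hr1).mul_left (A * r ^ c)).tendsto_sum_nat).comp
    (tendsto_sub_atTop_nat c)
  rw [← div_eq_mul_inv] at h1
  refine h1.congr fun n => ?_
  rw [Function.comp, Finset.sum_Ico_eq_sum_range]
  exact Finset.sum_congr rfl fun k _ => by ring

/-- The ratio of consecutive terms of the geometric series bounding the `κ`-th moment. -/
noncomputable def geomRatio (Γ α h : ℝ) (κ : ℕ) : ℝ := Real.exp (-((1 + 2 * H κ α Γ) * h))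

lemma geomRatio_pos (κ : ℕ) : 0 < geomRatio Γ α h κ := Real.exp_pos _

lemma geomRatio_lt_one (hh : 0 < h) (hΓ : 0 < Γ) (κ : ℕ) : geomRatio Γ α h κ < 1 := by
  have := H_nonneg (α := α) hΓ κ
  rw [geomRatio, Real.exp_lt_one_iff]
  have : 0 < (1 + 2 * H κ α Γ) * h := by positivity
  linarith

lemma tendsto_sum_lower (hh : 0 < h) (hΓ : 0 < Γ) (κ c : ℕ) (A : ℝ) (hA : 0 ≤ A) :
    Tendsto (fun n => ∑ Q ∈ Finset.Ico c n, ENNReal.ofReal (A * geomRatio Γ α h κ ^ Q)) atTop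
      (𝓝 (ENNReal.ofReal (A * geomRatio Γ α h κ ^ c / (1 - geomRatio Γ α h κ)))) := by
  have h0 := geomRatio_pos (Γ := Γ) (α := α) (h := h) κ
  refine (ENNReal.tendsto_ofReal (tendsto_sum_Ico_geometric (A := A) h0.le
    (geomRatio_lt_one (α := α) hh hΓ κ) c)).congr fun n => ?_
  exact ENNReal.ofReal_sum_of_nonneg fun Q _ => by positivity

lemma tendsto_sum_upper (hh : 0 < h) (hΓ : 0 < Γ) (hα : 2 < α) (κ c : ℕ) {A : ℝ} (hA : 0 ≤ A) :
    Tendsto (fun n => ∑ Q ∈ Finset.Ico c n, ENNReal.ofReal (A * Real.exp (-h) ^ Q *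
        Real.exp (-(h * truncatedIntegral Γ α κ Q n))) + ENNReal.ofReal (Real.exp (-h)) ^ n) atTop
      (𝓝 (ENNReal.ofReal (A * geomRatio Γ α h κ ^ c / (1 - geomRatio Γ α h κ)))) := by
  have hlt : Real.exp (-h) < 1 := Real.exp_lt_one_iff.2 (by linarith)
  have h2 : Tendsto (fun n : ℕ => ENNReal.ofReal (Real.exp (-h)) ^ n) atTop (𝓝 0) :=
    ENNReal.tendsto_pow_atTop_nhds_zero_of_lt_one (ENNReal.ofReal_lt_one.2 hlt)
  rw [← add_zero (ENNReal.ofReal (A * _ / _))]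
  refine Tendsto.add ?_ h2
  set f : ℕ → ℕ → ℝ := fun n Q => if Q ∈ Finset.Ico c n then
    A * Real.exp (-h) ^ Q * Real.exp (-(h * truncatedIntegral Γ α κ Q n)) else 0 with hf
  set g : ℕ → ℝ := fun Q => if c ≤ Q then A * geomRatio Γ α h κ ^ Q else 0 with hg
  have hlim : Tendsto (fun n => ∑' Q, f n Q) atTop (𝓝 (∑' Q, g Q)) := by
    refine tendsto_tsum_of_dominated_convergence (bound := fun Q => A * Real.exp (-h) ^ Q)
      ((summable_geometric_of_lt_one (Real.exp_pos _).le hlt).mul_left A) ?_ ?_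
    · intro Q
      by_cases hc : c ≤ Q
      · have h3 : g Q = A * Real.exp (-h) ^ Q * Real.exp (-(h * (2 * H κ α Γ * Q))) := by
          rw [hg]
          simp only [if_pos hc, geomRatio]
          rw [mul_assoc, ← Real.exp_nat_mul, ← Real.exp_nat_mul, ← Real.exp_add]
          ring_nf
        rw [h3]
        refine Tendsto.congr' ?_ (((Real.continuous_exp.tendsto _).comp
          ((tendsto_truncatedIntegral hΓ hα κ Q).const_mul h).neg).const_mul _)
        filter_upwards [eventually_gt_atTop Q] with n hn
        simp [hf, hc, hn]
      · simp [hf, hg, hc]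
    · refine Eventually.of_forall fun n Q => ?_
      by_cases hQ : Q ∈ Finset.Ico c n
      · have h3 := truncatedIntegral_nonneg (α := α) hΓ κ (Finset.mem_Ico.1 hQ).2.le
        simp only [hf, if_pos hQ]
        rw [Real.norm_of_nonneg (by positivity)]
        refine mul_le_of_le_one_right (by positivity) (Real.exp_le_one_iff.2 ?_)
        have := mul_nonneg hh.le h3
        linarith
      · simp only [hf, if_neg hQ, norm_zero]
        positivity
  have e1 : ∀ n, ∑' Q, f n Q = ∑ Q ∈ Finset.Ico c n, A * Real.exp (-h) ^ Q *
      Real.exp (-(h * truncatedIntegral Γ α κ Q n)) := fun n => by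
    rw [tsum_eq_sum (s := Finset.Ico c n) fun Q hQ => by simp only [hf, if_neg hQ]]
    exact Finset.sum_congr rfl fun Q hQ => by simp only [hf, if_pos hQ]
  have e2 : ∑' Q, g Q = A * geomRatio Γ α h κ ^ c / (1 - geomRatio Γ α h κ) := by
    have hs : Summable g := by
      refine Summable.of_nonneg_of_le (fun Q => ?_) (fun Q => ?_)
        ((summable_geometric_of_lt_one (geomRatio_pos κ).le
          (geomRatio_lt_one (α := α) hh hΓ κ)).mul_left A)
      all_goals
        have := geomRatio_pos (Γ := Γ) (α := α) (h := h) κ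
        simp only [hg]
        split_ifs <;> first | positivity | exact le_rfl
    refine tendsto_nhds_unique (hs.hasSum.tendsto_sum_nat.congr fun n => ?_)
      (tendsto_sum_Ico_geometric (geomRatio_pos κ).le (geomRatio_lt_one (α := α) hh hΓ κ) c)
    rw [hg, ← Finset.sum_filter]
    refine Finset.sum_congr ?_ fun _ _ => rfl
    ext Q
    simp [and_comm]
  rw [e2] at hlim
  simp_rw [e1] at hlim
  refine (ENNReal.tendsto_ofReal hlim).congr fun n => ?_
  exact ENNReal.ofReal_sum_of_nonneg fun Q _ => by positivity

lemma antitone_prod_range {f : ℕ → ℝ≥0∞} (hf : ∀ k, f k ≤ 1) :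
    Antitone fun m => ∏ k ∈ Finset.range m, f k :=
  antitone_nat_of_succ_le fun m => by
    rw [Finset.prod_range_succ]
    exact mul_le_of_le_one_right' (hf m)

lemma lowerFunctional_dichotomy (Γ β : ℝ) (c κ : ℕ) (N : ℕ → ℕ) :
    (∀ᶠ n in atTop, lowerFunctional Γ β c n κ N = 0) ∨
      ∃ Q, c ≤ Q ∧ (∀ q < Q, N q = 0) ∧ N Q = 1 := by
  classical
  by_cases hex : ∃ q, N q ≠ 0
  · have h0 : ∀ q < Nat.find hex, N q = 0 := fun q hq => by
      by_contra hne
      exact Nat.find_min hex hq hne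
    by_cases hc : c ≤ Nat.find hex ∧ N (Nat.find hex) = 1
    · exact Or.inr ⟨_, hc.1, h0, hc.2⟩
    · left
      filter_upwards [eventually_gt_atTop (Nat.find hex)] with n hn
      rw [lowerFunctional_eq h0 (Nat.find_spec hex) hn, if_neg hc]
  · push Not at hex
    exact Or.inl (Eventually.of_forall fun n => sum_prod_slot_eq_zero (by simp [singleOccupied])
      (fun q _ => hex q) fun Q hQ => (Finset.mem_Ico.1 hQ).2)

lemma limsup_prod_lowerFunctional_le (hM : 1 ≤ M) (hh : 0 < h) (hlam : 0 < lam) (hΓ : 0 < Γ)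
    (hC : 0 < C) (hα : 0 < α) {x : ℕ → ℂ} (hx : ∀ k, x k ≠ 0)
    (hfin : ∀ (i : Fin M) q, count x (cell lam h M i q) ≠ ⊤) (c : ℕ) (κ : Fin M → ℕ) :
    limsup (fun n => ∏ i, lowerFunctional Γ (α / 2) c n (κ i)
        (fun q => natCount x (cell lam h M i q))) atTop ≤
      {x | IsRegular M (fun r => C * r ^ α) x ∧ ∀ k, c * h ≤ level lam M (x k)}.indicator
        (fun x => ∏ i, detProb M Γ α C P x i ^ κ i) x := by
  by_cases hall : ∀ i : Fin M, ∃ Q, c ≤ Q ∧ (∀ q < Q, natCount x (cell lam h M i q) = 0) ∧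
      natCount x (cell lam h M i Q) = 1
  · choose Q hcQ h0 hQ using hall
    choose j hj hu using fun i =>
      exists_unique_best_of_natCount_eq_one hh hlam hC hα (hfin i) (h0 i) (hQ i)
    have hmem : x ∈ {x | IsRegular M (fun r => C * r ^ α) x ∧ ∀ k, c * h ≤ level lam M (x k)} := by
      refine ⟨⟨hx, fun i => ⟨j i, hj i, hu i⟩⟩, fun k => ?_⟩
      obtain ⟨i, hi⟩ := exists_mem_sector hM (x k)
      have h1 : c ≤ cellIndex lam h M (x k) :=
        (hcQ i).trans (le_cellIndex_of_empty (hfin i) (h0 i) hi)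
      rw [← le_div_iff₀ hh]
      exact (Nat.cast_le.2 h1).trans (cellIndex_le_level_div hh hlam _)
    rw [Set.indicator_of_mem hmem]
    have hle : ∀ m, limsup (fun n => ∏ i, lowerFunctional Γ (α / 2) c n (κ i)
        (fun q => natCount x (cell lam h M i q))) atTop ≤
        ∏ i, (∏ k ∈ Finset.range m,
          ENNReal.ofReal (1 + interference M Γ α x i (j i) k)⁻¹) ^ κ i := by
      intro m
      refine limsup_le_of_le (h := ?_)
      have : ∀ᶠ n in atTop, ∀ i : Fin M, lowerFunctional Γ (α / 2) c n (κ i)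
          (fun q => natCount x (cell lam h M i q)) ≤ (∏ k ∈ Finset.range m,
          ENNReal.ofReal (1 + interference M Γ α x i (j i) k)⁻¹) ^ κ i :=
        eventually_all.2 fun i => eventually_lowerFunctional_le hh hlam hΓ hC hα hx (hj i) (hfin i)
          (h0 i) (hQ i) c (κ i) m
      exact this.mono fun n hn => Finset.prod_le_prod' fun i _ => hn i
    refine ge_of_tendsto' (x := atTop) (ENNReal.tendsto_finsetProd_of_ne_top _ (fun i _ => ?_) fun i _ => ?_) hle
    · refine ENNReal.Tendsto.pow ?_
      rw [detProb_eq hΓ hC hx (hj i) (hu i)]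
      exact tendsto_atTop_iInf (antitone_prod_range
        fun k => ofReal_inv_one_add_interference_le_one hΓ k)
    · exact ENNReal.pow_ne_top (ne_top_of_le_ne_top ENNReal.one_ne_top (detProb_le_one x i))
  · push Not at hall
    obtain ⟨i, hi⟩ := hall
    have h0 : ∀ᶠ n in atTop, ∏ i, lowerFunctional Γ (α / 2) c n (κ i)
        (fun q => natCount x (cell lam h M i q)) = 0 := by
      rcases lowerFunctional_dichotomy Γ (α / 2) c (κ i) (fun q => natCount x (cell lam h M i q))
        with h1 | ⟨Q, h1, h2, h3⟩
      · exact h1.mono fun n hn => Finset.prod_eq_zero (Finset.mem_univ i) hn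
      · exact absurd h3 (hi Q h1 h2)
    rw [limsup_congr h0, limsup_const]
    exact zero_le

end Limits

section Moments

variable {M : ℕ} {lam h Γ α C P : ℝ} {Ω : Type*} [MeasurableSpace Ω] {μ : Measure Ω}
  [IsProbabilityMeasure μ] {x : ℕ → Ω → ℂ}

/-- The regular configurations all of whose points have level at least `a`. -/
def regularAbove (M : ℕ) (lam α C a : ℝ) : Set (ℕ → ℂ) :=
  {x | IsRegular M (fun r => C * r ^ α) x ∧ ∀ k, a ≤ level lam M (x k)}

lemma measurable_slot_natCount (hx : ∀ k, Measurable (x k)) (e w : ℕ → ℝ≥0∞) (Q q : ℕ)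
    (i : Fin M) : Measurable fun ω => slot e w Q q (natCount (fun k => x k ω) (cell lam h M i q)) :=
  (measurable_of_countable (slot e w Q q)).comp (measurable_natCount hx (measurableSet_cell i q))

lemma IsPoissonProcess.lower_le_lintegral (hx : IsPoissonProcess μ x lam) (hM : 1 ≤ M)
    (hlam : 0 < lam) (hh : 0 < h) (hΓ : 0 < Γ) (hC : 0 < C) (hα : 2 < α) (c : ℕ)
    (κ : Fin M → ℕ) :
    ∏ i, ENNReal.ofReal (h * Real.exp (-(2 * h + 2 * H (κ i) α Γ * h)) *
        geomRatio Γ α h (κ i) ^ c / (1 - geomRatio Γ α h (κ i))) ≤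
      ∫⁻ ω, (regularAbove M lam α C (c * h)).indicator
        (fun x => ∏ i, detProb M Γ α C P x i ^ κ i) (fun k => x k ω) ∂μ := by
  set f : ℕ → Ω → ℝ≥0∞ := fun n ω => ∏ i, lowerFunctional Γ (α / 2) c n (κ i)
    (fun q => natCount (fun k => x k ω) (cell lam h M i q)) with hf
  have hfm : ∀ n, Measurable (f n) := fun n => by
    unfold f lowerFunctional
    exact Finset.measurable_fun_prod _ fun i _ => Finset.measurable_fun_sum _ fun Q _ =>
      Finset.measurable_fun_prod _ fun q _ => measurable_slot_natCount hx.measurable _ _ _ _ _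
  have h1 : limsup (fun n => ∫⁻ ω, f n ω ∂μ) atTop ≤ ∫⁻ ω, limsup (fun n => f n ω) atTop ∂μ :=
    limsup_lintegral_le (fun _ => 1) hfm
      (fun n => Eventually.of_forall fun ω => Finset.prod_le_one' fun i _ =>
        lowerFunctional_le_one hΓ _ _ _ _ _) (by simp)
  have h2 : ∫⁻ ω, limsup (fun n => f n ω) atTop ∂μ ≤
      ∫⁻ ω, (regularAbove M lam α C (c * h)).indicator
        (fun x => ∏ i, detProb M Γ α C P x i ^ κ i) (fun k => x k ω) ∂μ := by
    refine lintegral_mono_ae ?_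
    filter_upwards [hx.ae_ne_zero, hx.ae_count_cell_ne_top (M := M) hlam hh] with ω hω0 hωf
    exact limsup_prod_lowerFunctional_le hM hh hlam hΓ hC (by linarith) hω0 hωf c κ
  refine le_trans ?_ (h1.trans h2)
  have hlow : Tendsto (fun n => ∏ i, ∑ Q ∈ Finset.Ico c n,
      ENNReal.ofReal (h * Real.exp (-(2 * h + 2 * H (κ i) α Γ * h)) *
        geomRatio Γ α h (κ i) ^ Q)) atTop
      (𝓝 (∏ i, ENNReal.ofReal (h * Real.exp (-(2 * h + 2 * H (κ i) α Γ * h)) *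
        geomRatio Γ α h (κ i) ^ c / (1 - geomRatio Γ α h (κ i))))) :=
    ENNReal.tendsto_finsetProd_of_ne_top _
      (fun i _ => tendsto_sum_lower hh hΓ (κ i) c _ (by positivity)) fun i _ => ENNReal.ofReal_ne_top
  rw [← hlow.limsup_eq]
  refine limsup_le_limsup (Eventually.of_forall fun n => ?_)
  have e := hx.lintegral_prod_sum_prod (M := M) hlam hh n (Finset.Ico c n)
    (fun i Q q N => slot singleOccupied
      (fun q => ENNReal.ofReal (lossFactor Γ (α / 2) ((Q + 1 : ℝ) / q)) ^ κ i) Q q N)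
  change _ ≤ ∫⁻ ω, f n ω ∂μ
  unfold f lowerFunctional
  rw [e]
  exact Finset.prod_le_prod' fun i _ => Finset.sum_le_sum fun Q hQ =>
    le_prod_lintegral_slot hh hΓ hα (κ i) (Finset.mem_Ico.1 hQ).2

lemma IsPoissonProcess.lintegral_le_upper (hx : IsPoissonProcess μ x lam)
    (hlam : 0 < lam) (hh : 0 < h) (hΓ : 0 < Γ) (hC : 0 < C) (hα : 2 < α) (c : ℕ)
    (κ : Fin M → ℕ) :
    ∫⁻ ω, (regularAbove M lam α C (c * h)).indicator
        (fun x => ∏ i, detProb M Γ α C P x i ^ κ i) (fun k => x k ω) ∂μ ≤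
      ∏ i, ENNReal.ofReal (h * Real.exp (2 * h) *
        geomRatio Γ α h (κ i) ^ c / (1 - geomRatio Γ α h (κ i))) := by
  have hup : Tendsto (fun n => ∏ i, (∑ Q ∈ Finset.Ico c n,
      ENNReal.ofReal (h * Real.exp (2 * h) * Real.exp (-h) ^ Q *
        Real.exp (-(h * truncatedIntegral Γ α (κ i) Q n))) + ENNReal.ofReal (Real.exp (-h)) ^ n)) atTop
      (𝓝 (∏ i, ENNReal.ofReal (h * Real.exp (2 * h) *
        geomRatio Γ α h (κ i) ^ c / (1 - geomRatio Γ α h (κ i))))) :=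
    ENNReal.tendsto_finsetProd_of_ne_top _
      (fun i _ => tendsto_sum_upper hh hΓ hα (κ i) c (by positivity)) fun i _ => ENNReal.ofReal_ne_top
  refine ge_of_tendsto hup ?_
  filter_upwards [eventually_ge_atTop c] with n hcn
  have h1 : ∫⁻ ω, (regularAbove M lam α C (c * h)).indicator
        (fun x => ∏ i, detProb M Γ α C P x i ^ κ i) (fun k => x k ω) ∂μ ≤
      ∫⁻ ω, ∏ i, upperFunctional Γ (α / 2) c n (κ i)
        (fun q => natCount (fun k => x k ω) (cell lam h M i q)) ∂μ := by
    refine lintegral_mono_ae ?_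
    filter_upwards [hx.ae_count_cell_ne_top (M := M) hlam hh] with ω hωf
    by_cases hω : (fun k => x k ω) ∈ regularAbove M lam α C (c * h)
    · rw [Set.indicator_of_mem hω]
      exact Finset.prod_le_prod' fun i _ => detProb_pow_le_upperFunctional hh hlam hΓ hC
        (by linarith) hω.1 i (hωf i) hω.2 hcn (κ i)
    · rw [Set.indicator_of_notMem hω]
      exact zero_le
  refine h1.trans ?_
  have e := hx.lintegral_prod_sum_prod (M := M) hlam hh n (Finset.Ico c (n + 1))
    (fun i Q q N => slot occupied
      (fun q => ENNReal.ofReal (lossFactor Γ (α / 2) ((Q : ℝ) / (q + 1))) ^ κ i) Q q N)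
  unfold upperFunctional
  rw [e]
  refine Finset.prod_le_prod' fun i _ => ?_
  rw [Finset.sum_Ico_succ_top hcn]
  refine add_le_add (Finset.sum_le_sum fun Q hQ =>
    prod_lintegral_slot_le hh hΓ hα (κ i) (Finset.mem_Ico.1 hQ).2) ?_
  exact (prod_lintegral_slot_self hh _ _ n).le

lemma tendsto_div_one_sub_exp {D : ℝ} (hD : 0 < D) :
    Tendsto (fun h : ℝ => h / (1 - Real.exp (-(D * h)))) (𝓝[>] 0) (𝓝 (1 / D)) := by
  have h1 : HasDerivAt (fun h : ℝ => 1 - Real.exp (-(D * h))) D 0 := by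
    have := (((hasDerivAt_id (0 : ℝ)).const_mul D).neg.exp).const_sub 1
    simpa using this
  have h2 := (hasDerivAt_iff_tendsto_slope.1 h1).mono_left
    (nhdsWithin_mono 0 fun y (hy : 0 < y) => hy.ne')
  refine (one_div D ▸ h2.inv₀ hD.ne').congr fun h => ?_
  simp [slope_def_field]

lemma IsPoissonProcess.lintegral_regularAbove (hx : IsPoissonProcess μ x lam) (hM : 1 ≤ M)
    (hlam : 0 < lam) (hΓ : 0 < Γ) (hC : 0 < C) (hα : 2 < α) {a : ℝ} (ha : 0 ≤ a)
    (κ : Fin M → ℕ) :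
    ∫⁻ ω, (regularAbove M lam α C a).indicator
        (fun x => ∏ i, detProb M Γ α C P x i ^ κ i) (fun k => x k ω) ∂μ =
      ∏ i, ENNReal.ofReal (Real.exp (-((1 + 2 * H (κ i) α Γ) * a)) / (1 + 2 * H (κ i) α Γ)) := by
  obtain ⟨s, c, hs0, hs, hsc⟩ : ∃ (s : ℕ → ℝ) (c : ℕ → ℕ), (∀ n, 0 < s n) ∧
      Tendsto s atTop (𝓝[>] 0) ∧ ∀ n, c n * s n = a := by
    have hlim : ∀ b : ℝ, 0 < b → Tendsto (fun n : ℕ => b / (n + 1)) atTop (𝓝[>] 0) := fun b hb =>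
      tendsto_nhdsWithin_iff.2 ⟨by
        simpa [div_eq_mul_inv] using (tendsto_one_div_add_atTop_nhds_zero_nat (𝕜 := ℝ)).const_mul b,
        Eventually.of_forall fun n => Set.mem_Ioi.2 (by positivity)⟩
    rcases ha.eq_or_lt with rfl | ha
    · exact ⟨fun n => 1 / (n + 1), fun _ => 0, fun n => by positivity, hlim 1 one_pos, by simp⟩
    · exact ⟨fun n => a / (n + 1), fun n => n + 1, fun n => by positivity, hlim a ha,
        fun n => by push_cast; field_simp⟩
  have hD : ∀ i, 0 < 1 + 2 * H (κ i) α Γ := fun i => by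
    have := H_nonneg (α := α) hΓ (κ i)
    positivity
  have hs' : Tendsto s atTop (𝓝 0) := hs.mono_right nhdsWithin_le_nhds
  have hr : ∀ n i, geomRatio Γ α (s n) (κ i) ^ c n = Real.exp (-((1 + 2 * H (κ i) α Γ) * a)) := by
    intro n i
    rw [geomRatio, ← Real.exp_nat_mul, ← hsc n]
    ring_nf
  have hlim : ∀ (b : Fin M → ℝ → ℝ), (∀ i, Continuous (b i)) → (∀ i, b i 0 = 1) →
      Tendsto (fun n => ∏ i, ENNReal.ofReal (s n * b i (s n) *
        geomRatio Γ α (s n) (κ i) ^ c n / (1 - geomRatio Γ α (s n) (κ i)))) atTop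
      (𝓝 (∏ i, ENNReal.ofReal (Real.exp (-((1 + 2 * H (κ i) α Γ) * a)) /
        (1 + 2 * H (κ i) α Γ)))) := by
    intro b hb hb0
    refine ENNReal.tendsto_finsetProd_of_ne_top _ (fun i _ => ?_) fun i _ => ENNReal.ofReal_ne_top
    refine ENNReal.tendsto_ofReal ?_
    have h1 := (((hb i).tendsto 0).comp hs').mul
      (((tendsto_div_one_sub_exp (hD i)).comp hs).mul_const
        (Real.exp (-((1 + 2 * H (κ i) α Γ) * a))))
    rw [hb0, one_mul, one_div_mul_eq_div] at h1
    refine h1.congr fun n => ?_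
    simp only [Function.comp, hr]
    rw [geomRatio]
    ring
  refine le_antisymm ?_ ?_
  · refine ge_of_tendsto' (hlim (fun i h => Real.exp (2 * h)) (fun i => by fun_prop) (by simp))
      fun n => ?_
    rw [← hsc n]
    exact hx.lintegral_le_upper hlam (hs0 n) hΓ hC hα (c n) κ
  · refine le_of_tendsto' (hlim (fun i h => Real.exp (-(2 * h + 2 * H (κ i) α Γ * h)))
      (fun i => by fun_prop) (by simp)) fun n => ?_
    rw [← hsc n]
    exact hx.lower_le_lintegral hM hlam (hs0 n) hΓ hC hα (c n) κ

lemma measurableSet_isRegular :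
    MeasurableSet {x : ℕ → ℂ | IsRegular M (fun r => C * r ^ α) x} := by
  have hx : ∀ k, Measurable fun x : ℕ → ℂ => x k := fun k => measurable_pi_apply k
  have hb := fun (i : Fin M) (j : ℕ) => measurableSet_isBest (α := α) (C := C) hx i j
  have : {x : ℕ → ℂ | IsRegular M (fun r => C * r ^ α) x} =
      (⋂ k, (fun x : ℕ → ℂ => x k) ⁻¹' {0}ᶜ) ∩ ⋂ i, ⋃ j, ({x | IsBest M (fun r => C * r ^ α) x i j} ∩
        ⋂ j', ({x | IsBest M (fun r => C * r ^ α) x i j'}ᶜ ∪ {_x | j' = j})) := by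
    ext x
    simp only [IsRegular, ExistsUnique, Set.mem_inter_iff, Set.mem_iInter, Set.mem_iUnion,
      Set.mem_preimage, Set.mem_compl_iff, Set.mem_singleton_iff, Set.mem_union,
      Set.mem_ofPred_eq, imp_iff_not_or, ne_eq]
  rw [this]
  refine (MeasurableSet.iInter fun k => hx k (measurableSet_singleton _).compl).inter
    (MeasurableSet.iInter fun i => MeasurableSet.iUnion fun j => (hb i j).inter
      (MeasurableSet.iInter fun j' => (hb i j').compl.union (MeasurableSet.const _)))

lemma IsPoissonProcess.ae_isRegular (hx : IsPoissonProcess μ x lam) (hM : 1 ≤ M)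
    (hlam : 0 < lam) (hC : 0 < C) (hα : 2 < α) :
    ∀ᵐ ω ∂μ, IsRegular M (fun r => C * r ^ α) (fun k => x k ω) := by
  have h := hx.lintegral_regularAbove (P := 1) hM hlam one_pos hC hα le_rfl (fun _ => 0)
  have hset : regularAbove M lam α C 0 = {x | IsRegular M (fun r => C * r ^ α) x} := by
    ext y
    exact ⟨fun hy => hy.1, fun hy => ⟨hy, fun k => level_nonneg hlam _⟩⟩
  have hX : Measurable fun ω k => x k ω := measurable_pi_lambda _ hx.measurable
  have hm := hX (measurableSet_isRegular (M := M) (α := α) (C := C))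
  have h1 : μ {ω | IsRegular M (fun r => C * r ^ α) (fun k => x k ω)} = 1 := by
    rw [hset] at h
    simp only [pow_zero, Finset.prod_const_one, H_zero, mul_zero, add_zero, neg_zero,
      Real.exp_zero, div_one, ENNReal.ofReal_one] at h
    rw [← h]
    exact (lintegral_indicator_one hm).symm
  exact (prob_compl_eq_zero_iff hm).2 h1

end Moments

section Cycles

lemma iInf_eq_tsum_not_before (S : ℕ → Prop) :
    ⨅ (n : ℕ) (_ : 1 ≤ n ∧ S n), (n : ℝ≥0∞) =
      ∑' j : ℕ, {j | ∀ n ∈ Finset.Icc 1 j, ¬ S n}.indicator 1 j := by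
  classical
  by_cases hex : ∃ n, 1 ≤ n ∧ S n
  · have hf := Nat.find_spec hex
    have hmem : ∀ j, j ∈ {j | ∀ n ∈ Finset.Icc 1 j, ¬ S n} ↔ j ∈ Finset.range (Nat.find hex) := by
      intro j
      rw [Finset.mem_range]
      constructor
      · intro h
        by_contra! hle
        exact h _ (Finset.mem_Icc.2 ⟨hf.1, hle⟩) hf.2
      · intro h n hn hS
        have hn := Finset.mem_Icc.1 hn
        exact Nat.find_min hex (hn.2.trans_lt h) ⟨hn.1, hS⟩
    rw [tsum_eq_sum (s := Finset.range (Nat.find hex)) fun j hj =>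
      Set.indicator_of_notMem (fun h => hj ((hmem j).1 h)) _,
      Finset.sum_congr rfl fun j hj => Set.indicator_of_mem ((hmem j).2 hj) _]
    simp only [Pi.one_apply, Finset.sum_const, Finset.card_range, nsmul_eq_mul, mul_one]
    refine le_antisymm (iInf_le_of_le (Nat.find hex) (iInf_le _ hf)) (le_iInf₂ fun n hn => ?_)
    exact_mod_cast Nat.find_min' hex hn
  · push Not at hex
    have h1 : ∀ j, {j | ∀ n ∈ Finset.Icc 1 j, ¬ S n}.indicator (1 : ℕ → ℝ≥0∞) j = 1 := fun j =>
      Set.indicator_of_mem (by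
      intro n hn
      exact hex n (Finset.mem_Icc.1 hn).1) _
    simp_rw [h1, ENNReal.tsum_const_eq_top_of_ne_zero one_ne_zero]
    simp only [iInf_eq_top]
    exact fun n hn => absurd hn.2 (hex n hn.1)

variable {M : ℕ} {lam Γ α C P : ℝ}

/-- A bound on the path gain, relative to a station of level less than `b`, of a station in the
`q`-th cell of unit width. -/
noncomputable def gainBound (Γ α b : ℝ) (q : ℕ) : ℝ := Γ * ((b + 1) / (q + 1)) ^ (α / 2)

lemma gainBound_nonneg (hΓ : 0 < Γ) {b : ℝ} (hb : 0 ≤ b) (q : ℕ) : 0 ≤ gainBound Γ α b q := by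
  unfold gainBound; positivity

lemma summable_gainBound (hα : 2 < α) {b : ℝ} (hb : 0 ≤ b) : Summable (gainBound Γ α b) := by
  have h1 : Summable fun n : ℕ => ((n : ℝ) ^ (α / 2))⁻¹ := Real.summable_nat_rpow_inv.2 (by linarith)
  have h2 := ((summable_nat_add_iff 1).2 h1).mul_left (Γ * (b + 1) ^ (α / 2))
  refine h2.congr fun q => ?_
  rw [gainBound, Real.div_rpow (by positivity) (by positivity)]
  push_cast
  ring

/-- An upper bound, for cells of unit width, on the mean number of cycles given the locations. -/
noncomputable def cycleBound (M : ℕ) (lam Γ α b : ℝ) (x : ℕ → ℂ) (n : ℕ) : ℝ≥0∞ :=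
  ∏ i : Fin M, ∏ q ∈ Finset.range n,
    ENNReal.ofReal (1 + gainBound Γ α b q) ^ natCount x (cell lam 1 M i q)

lemma one_le_ofReal_one_add_gainBound (hΓ : 0 < Γ) {b : ℝ} (hb : 0 ≤ b) (q : ℕ) :
    1 ≤ ENNReal.ofReal (1 + gainBound Γ α b q) := by
  rw [ENNReal.one_le_ofReal]
  linarith [gainBound_nonneg (α := α) hΓ hb q]

lemma monotone_cycleBound (hΓ : 0 < Γ) {b : ℝ} (hb : 0 ≤ b) (x : ℕ → ℂ) :
    Monotone (cycleBound M lam Γ α b x) := fun _ _ hnm =>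
  Finset.prod_le_prod' fun _ _ => Finset.prod_le_prod_of_subset_of_one_le'
    (Finset.range_mono hnm) fun q _ _ =>
      one_le_pow₀ (one_le_ofReal_one_add_gainBound hΓ hb q)

lemma inv_iSup_cycleBound_le_detProb (hlam : 0 < lam) (hΓ : 0 < Γ) (hC : 0 < C) (hα : 2 < α)
    {x : ℕ → ℂ} (hx : IsRegular M (fun r => C * r ^ α) x)
    (hfin : ∀ (i : Fin M) q, count x (cell lam 1 M i q) ≠ ⊤) {b : ℝ} (hb : 0 ≤ b) {i : Fin M} {k₀ : ℕ}
    (hk₀ : x k₀ ∈ sector M i) (hkb : level lam M (x k₀) < b) :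
    (⨆ n, cycleBound M lam Γ α b x n)⁻¹ ≤ detProb M Γ α C P x i := by
  obtain ⟨j, hj, hu⟩ := hx.2 i
  have hj' := (isBest_iff hlam hC (by linarith)).1 hj
  have hjb : level lam M (x j) < b := (hj'.2 k₀ hk₀).trans_lt hkb
  rw [detProb_eq hΓ hC hx.1 hj hu]
  refine le_iInf fun m => ?_
  set n := (Finset.range m).sup (fun k => cellIndex lam 1 M (x k)) + 1
  have h1 : ∏ q ∈ Finset.range n, (ENNReal.ofReal (1 + gainBound Γ α b q))⁻¹ ^
      natCount x (cell lam 1 M i q) ≤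
      ∏ k ∈ Finset.range m, ENNReal.ofReal (1 + interference M Γ α x i j k)⁻¹ := by
    refine prod_pow_natCount_le_prod (hfin i) (fun q _ =>
      ENNReal.inv_le_one.2 (one_le_ofReal_one_add_gainBound hΓ hb q)) fun k hkm hk hkj => ⟨?_, ?_⟩
    · exact Finset.mem_range.2 (Nat.lt_succ_of_le (Finset.le_sup
        (f := fun k => cellIndex lam 1 M (x k)) (Finset.mem_range.2 hkm)))
    · have hg := gainBound_nonneg (α := α) hΓ hb (cellIndex lam 1 M (x k))
      rw [inv_one_add_interference hlam hx.1 hk hkj, ← ENNReal.ofReal_inv_of_pos (by positivity)]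
      have hk0 := level_pos hlam i (hx.1 k)
      refine ENNReal.ofReal_le_ofReal (lossFactor_anti (β := α / 2) hΓ (by linarith)
        (div_nonneg (level_nonneg hlam _) hk0.le) ?_)
      have h2 := cellIndex_le_level_div (M := M) one_pos hlam (x k)
      rw [div_one] at h2
      have h3 := hj'.2 k hk
      have h4 := level_nonneg (M := M) hlam (x j)
      rw [div_le_div_iff₀ hk0 (by positivity)]
      nlinarith
  refine le_trans ?_ h1
  have hle : ∏ q ∈ Finset.range n, ENNReal.ofReal (1 + gainBound Γ α b q) ^
      natCount x (cell lam 1 M i q) ≤ ⨆ n, cycleBound M lam Γ α b x n := by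
    refine le_trans ?_ (le_iSup _ n)
    exact Finset.single_le_prod' (f := fun i => ∏ q ∈ Finset.range n,
      ENNReal.ofReal (1 + gainBound Γ α b q) ^ natCount x (cell lam 1 M i q))
      (fun i _ => Finset.one_le_prod' fun q _ =>
        one_le_pow₀ (one_le_ofReal_one_add_gainBound hΓ hb q)) (Finset.mem_univ i)
  refine (ENNReal.inv_le_inv.2 hle).trans_eq ?_
  rw [ENNReal.prod_inv_distrib]
  · exact Finset.prod_congr rfl fun q _ => ENNReal.inv_pow
  · intro q _ q' _ _
    exact Or.inr (ENNReal.pow_ne_top ENNReal.ofReal_ne_top)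

lemma tsum_prod_one_sub_detProb_le (hM : 1 ≤ M) (hlam : 0 < lam) (hΓ : 0 < Γ) (hC : 0 < C)
    (hα : 2 < α) {x : ℕ → ℂ} (hx : IsRegular M (fun r => C * r ^ α) x)
    (hfin : ∀ (i : Fin M) q, count x (cell lam 1 M i q) ≠ ⊤) {b : ℝ} (hb : 0 ≤ b)
    (hxb : ¬ ∀ k, b ≤ level lam M (x k)) :
    ∑' N : ℕ, ∏ i, (1 - detProb M Γ α C P x i) ^ N ≤ ⨆ n, cycleBound M lam Γ α b x n := by
  push Not at hxb
  obtain ⟨k, hk⟩ := hxb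
  obtain ⟨i, hi⟩ := exists_mem_sector hM (x k)
  have h1 := inv_iSup_cycleBound_le_detProb (P := P) hlam hΓ hC hα hx hfin hb hi hk
  simp_rw [Finset.prod_pow]
  rw [ENNReal.tsum_geometric, ENNReal.inv_le_iff_inv_le]
  refine h1.trans ?_
  have h2 : ∏ i, (1 - detProb M Γ α C P x i) ≤ 1 - detProb M Γ α C P x i := by
    rw [← Finset.mul_prod_erase _ _ (Finset.mem_univ i)]
    exact mul_le_of_le_one_right' (Finset.prod_le_one' fun _ _ => tsub_le_self)
  calc detProb M Γ α C P x i = 1 - (1 - detProb M Γ α C P x i) :=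
        (ENNReal.sub_sub_cancel ENNReal.one_ne_top (detProb_le_one x i)).symm
    _ ≤ _ := tsub_le_tsub_left h2 1

variable {Ω : Type*} [MeasurableSpace Ω] {μ : Measure Ω} [IsProbabilityMeasure μ] {x : ℕ → Ω → ℂ}

lemma IsPoissonProcess.lintegral_iSup_cycleBound_lt_top (hx : IsPoissonProcess μ x lam)
    (hlam : 0 < lam) (hΓ : 0 < Γ) (hα : 2 < α) {b : ℝ} (hb : 0 ≤ b) :
    ∫⁻ ω, ⨆ n, cycleBound M lam Γ α b (fun k => x k ω) n ∂μ < ∞ := by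
  have hm : ∀ n, Measurable fun ω => cycleBound M lam Γ α b (fun k => x k ω) n := fun n => by
    unfold cycleBound
    exact Finset.measurable_fun_prod _ fun i _ => Finset.measurable_fun_prod _ fun q _ =>
      (measurable_of_countable (fun N : ℕ => ENNReal.ofReal (1 + gainBound Γ α b q) ^ N)).comp
        (measurable_natCount hx.measurable (measurableSet_cell i q))
  rw [lintegral_iSup hm fun n m hnm ω => monotone_cycleBound hΓ hb _ hnm]
  refine lt_of_le_of_lt (iSup_le fun n => ?_)
    (ENNReal.ofReal_lt_top (r := Real.exp (M * ∑' q, gainBound Γ α b q)))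
  have e := hx.lintegral_prod_sum_prod (M := M) hlam one_pos n {0}
    (fun _ _ q N => ENNReal.ofReal (1 + gainBound Γ α b q) ^ N)
  simp only [Finset.sum_singleton] at e
  unfold cycleBound
  rw [e]
  have h1 : ∀ q, ∫⁻ N, ENNReal.ofReal (1 + gainBound Γ α b q) ^ N
      ∂(poissonMeasure (1 : ℝ).toNNReal) = ENNReal.ofReal (Real.exp (gainBound Γ α b q)) := fun q => by
    have := gainBound_nonneg (α := α) hΓ hb q
    rw [lintegral_poissonMeasure_pow one_pos (by positivity)]
    ring_nf
  simp_rw [h1]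
  rw [← ENNReal.ofReal_prod_of_nonneg fun q _ => (Real.exp_pos _).le, ← Real.exp_sum,
    Finset.prod_const, Finset.card_univ, Fintype.card_fin, ← ENNReal.ofReal_pow (Real.exp_pos _).le,
    ← Real.exp_nat_mul]
  refine ENNReal.ofReal_le_ofReal (Real.exp_le_exp.2 ?_)
  exact mul_le_mul_of_nonneg_left ((summable_gainBound hα hb).sum_le_tsum _
    fun q _ => gainBound_nonneg hΓ hb q) (Nat.cast_nonneg M)

end Cycles

section Series

/-- The mean of `(1 - q) ^ j` for a single sector with detection probability `q`, on the event that
all its stations have level at least `a`. -/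
noncomputable def missTail (α Γ : ℝ) (j : ℕ) (a : ℝ) : ℝ :=
  ∑ k ∈ Finset.range (j + 1), (-1 : ℝ) ^ k * (j.choose k : ℝ) *
    (Real.exp (-((1 + 2 * H k α Γ) * a)) / (1 + 2 * H k α Γ))

/-- The `j`-th term of the series, as a function of the level of the nearest station. -/
noncomputable def missTerm (M : ℕ) (α Γ : ℝ) (j : ℕ) (v : ℝ) : ℝ :=
  (∑ k ∈ Finset.range (j + 1), (-1 : ℝ) ^ k * (j.choose k : ℝ) * Real.exp (-(2 * H k α Γ * v))) *
  (∑ k ∈ Finset.range (j + 1), (-1 : ℝ) ^ k * (j.choose k : ℝ) *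
    Real.exp (-(2 * H k α Γ * v)) / (1 + 2 * H k α Γ)) ^ (M - 1)

variable {M : ℕ} {α Γ : ℝ}

lemma measurable_missTerm (j : ℕ) : Measurable (missTerm M α Γ j) := by
  unfold missTerm; fun_prop

lemma missTerm_zero (v : ℝ) : missTerm M α Γ 0 v = 1 := by
  simp [missTerm, H_zero]

lemma hasDerivAt_missTail (hΓ : 0 < Γ) (j : ℕ) (v : ℝ) :
    HasDerivAt (missTail α Γ j) (-∑ k ∈ Finset.range (j + 1), (-1 : ℝ) ^ k * (j.choose k : ℝ) *
      Real.exp (-((1 + 2 * H k α Γ) * v))) v := by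
  rw [← Finset.sum_neg_distrib]
  refine HasDerivAt.fun_sum fun k _ => ?_
  have hk : 1 + 2 * H k α Γ ≠ 0 := by have := H_nonneg (α := α) hΓ k; positivity
  have h1 : HasDerivAt (fun v => -((1 + 2 * H k α Γ) * v)) (-(1 + 2 * H k α Γ)) v := by
    simpa using ((hasDerivAt_id v).const_mul (1 + 2 * H k α Γ)).fun_neg
  refine ((h1.exp.div_const (1 + 2 * H k α Γ)).const_mul
    ((-1 : ℝ) ^ k * (j.choose k : ℝ))).congr_deriv ?_
  field_simp

lemma hasDerivAt_missTail_pow (hM : 1 ≤ M) (hΓ : 0 < Γ) (j : ℕ) (v : ℝ) :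
    HasDerivAt (fun v => missTail α Γ j v ^ M)
      (-(M * Real.exp (-(M * v)) * missTerm M α Γ j v)) v := by
  have e1 : ∀ k, Real.exp (-((1 + 2 * H k α Γ) * v)) =
      Real.exp (-v) * Real.exp (-(2 * H k α Γ * v)) := fun k => by
    rw [← Real.exp_add]; ring_nf
  have e2 : Real.exp (-(M * v)) = Real.exp (-v) * Real.exp (-v) ^ (M - 1) := by
    rw [← pow_succ', Nat.sub_add_cancel hM, ← Real.exp_nat_mul]; ring_nf
  have e3 : missTail α Γ j v = Real.exp (-v) * ∑ k ∈ Finset.range (j + 1),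
      (-1 : ℝ) ^ k * (j.choose k : ℝ) * Real.exp (-(2 * H k α Γ * v)) / (1 + 2 * H k α Γ) := by
    rw [missTail, Finset.mul_sum]
    refine Finset.sum_congr rfl fun k _ => ?_
    rw [e1]; ring
  refine ((hasDerivAt_missTail hΓ j v).fun_pow M).congr_deriv ?_
  rw [e3, missTerm, e2, mul_pow]
  have e4 : ∑ k ∈ Finset.range (j + 1), (-1 : ℝ) ^ k * (j.choose k : ℝ) *
      Real.exp (-((1 + 2 * H k α Γ) * v)) = Real.exp (-v) * ∑ k ∈ Finset.range (j + 1),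
        (-1 : ℝ) ^ k * (j.choose k : ℝ) * Real.exp (-(2 * H k α Γ * v)) := by
    rw [Finset.mul_sum]
    refine Finset.sum_congr rfl fun k _ => ?_
    rw [e1]; ring
  rw [e4]
  ring

lemma tendsto_missTail_pow (hM : 1 ≤ M) (hΓ : 0 < Γ) (j : ℕ) :
    Tendsto (fun v => missTail α Γ j v ^ M) atTop (𝓝 0) := by
  have h : Tendsto (missTail α Γ j) atTop (𝓝 0) := by
    unfold missTail
    rw [← Finset.sum_const_zero (s := Finset.range (j + 1))]
    refine tendsto_finsetSum _ fun k _ => ?_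
    have hk : 0 < 1 + 2 * H k α Γ := by have := H_nonneg (α := α) hΓ k; positivity
    have h1 := ((Real.tendsto_exp_neg_atTop_nhds_zero.comp
      (tendsto_id.const_mul_atTop hk)).div_const (1 + 2 * H k α Γ)).const_mul
        ((-1 : ℝ) ^ k * (j.choose k : ℝ))
    simpa [Function.comp_def] using h1
  simpa [zero_pow (Nat.one_le_iff_ne_zero.1 hM)] using h.pow M

end Series

section Nearest

variable {M : ℕ} {lam : ℝ}

/-- The level of the nearest station. -/
noncomputable def nearestLevel (lam : ℝ) (M : ℕ) (x : ℕ → ℂ) : ℝ :=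
  Real.pi * lam * nearestDist x ^ 2 / M

lemma nearestDist_nonneg (x : ℕ → ℂ) : 0 ≤ nearestDist x := Real.iInf_nonneg fun _ => norm_nonneg _

lemma nearestLevel_nonneg (hlam : 0 < lam) (x : ℕ → ℂ) : 0 ≤ nearestLevel lam M x := by
  have := Real.pi_pos
  unfold nearestLevel; positivity

lemma measurable_nearestDist : Measurable nearestDist :=
  Measurable.iInf fun k => (measurable_pi_apply k).norm

lemma measurable_nearestLevel : Measurable (nearestLevel lam M) :=
  ((measurable_nearestDist.pow_const 2).const_mul _).div_const _

lemma sqrt_nearestLevel (hM : 1 ≤ M) (hlam : 0 < lam) (x : ℕ → ℂ) :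
    √(nearestLevel lam M x * M / (Real.pi * lam)) = nearestDist x := by
  have := Real.pi_pos
  have hM' : (0 : ℝ) < M := by exact_mod_cast hM
  have : nearestLevel lam M x * M / (Real.pi * lam) = nearestDist x ^ 2 := by
    unfold nearestLevel; field_simp
  rw [this, Real.sqrt_sq (nearestDist_nonneg x)]

lemma le_nearestLevel_iff (hM : 1 ≤ M) (hlam : 0 < lam) {a : ℝ} (ha : 0 ≤ a) (x : ℕ → ℂ) :
    a ≤ nearestLevel lam M x ↔ ∀ k, a ≤ level lam M (x k) := by
  have hpi := Real.pi_pos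
  have hM' : (0 : ℝ) < M := by exact_mod_cast hM
  constructor
  · intro h k
    have h1 : nearestDist x ≤ ‖x k‖ :=
      ciInf_le ⟨0, Set.forall_mem_range.2 fun _ => norm_nonneg _⟩ k
    refine h.trans ?_
    have h0 := nearestDist_nonneg x
    unfold nearestLevel level
    gcongr
  · intro h
    have h1 : √(a * M / (Real.pi * lam)) ≤ nearestDist x := le_ciInf fun k => by
      refine Real.sqrt_le_iff.2 ⟨norm_nonneg _, ?_⟩
      have := h k
      rw [level, le_div_iff₀ hM'] at this
      rw [div_le_iff₀ (by positivity)]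
      linarith
    have h2 := pow_le_pow_left₀ (Real.sqrt_nonneg _) h1 2
    rw [Real.sq_sqrt (by positivity), div_le_iff₀ (by positivity)] at h2
    rw [nearestLevel, le_div_iff₀ hM']
    linarith

end Nearest

section Law

variable {Ω : Type*} [MeasurableSpace Ω] {μ : Measure Ω} [IsProbabilityMeasure μ] {x : ℕ → Ω → ℂ}
variable {M : ℕ} {lam Γ α C P : ℝ}

/-- The conditional probability, given the locations, of `j` unsuccessful cycles. -/
noncomputable def missProb (M : ℕ) (Γ α C P : ℝ) (x : ℕ → ℂ) (j : ℕ) : ℝ≥0∞ :=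
  ∏ i : Fin M, (1 - detProb M Γ α C P x i) ^ j

lemma measurable_missProb (j : ℕ) : Measurable fun x => missProb M Γ α C P x j := by
  unfold missProb
  exact Finset.measurable_fun_prod _ fun i _ => (measurable_const.sub (measurable_detProb i)).pow_const j

lemma missProb_le_one (x : ℕ → ℂ) (j : ℕ) : missProb M Γ α C P x j ≤ 1 :=
  Finset.prod_le_one' fun _ _ => pow_le_one₀ zero_le tsub_le_self

lemma toReal_missProb (x : ℕ → ℂ) (j : ℕ) : (missProb M Γ α C P x j).toReal =
    ∑ κ ∈ Fintype.piFinset fun _ : Fin M => Finset.range (j + 1),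
      (∏ i, (-1 : ℝ) ^ κ i * (j.choose (κ i) : ℝ)) * ∏ i, (detProb M Γ α C P x i).toReal ^ κ i := by
  have h1 : ∀ i, ((1 - detProb M Γ α C P x i) ^ j).toReal = ∑ k ∈ Finset.range (j + 1),
      (-1 : ℝ) ^ k * (j.choose k : ℝ) * (detProb M Γ α C P x i).toReal ^ k := fun i => by
    rw [ENNReal.toReal_pow, ENNReal.toReal_sub_of_le (detProb_le_one x i) ENNReal.one_ne_top,
      ENNReal.toReal_one, sub_eq_neg_add, add_pow]
    refine Finset.sum_congr rfl fun k _ => ?_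
    rw [neg_pow]
    ring
  rw [missProb, ENNReal.toReal_prod, Finset.prod_congr rfl fun i _ => h1 i, Finset.prod_univ_sum]
  exact Finset.sum_congr rfl fun κ _ => Finset.prod_mul_distrib

lemma IsPoissonProcess.setIntegral_prod_toReal_detProb (hx : IsPoissonProcess μ x lam) (hM : 1 ≤ M)
    (hlam : 0 < lam) (hΓ : 0 < Γ) (hC : 0 < C) (hα : 2 < α) {a : ℝ} (ha : 0 ≤ a) (κ : Fin M → ℕ) :
    ∫ ω in {ω | a ≤ nearestLevel lam M (fun k => x k ω)},
      ∏ i, (detProb M Γ α C P (fun k => x k ω) i).toReal ^ κ i ∂μ =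
    ∏ i, (Real.exp (-((1 + 2 * H (κ i) α Γ) * a)) / (1 + 2 * H (κ i) α Γ)) := by
  have hX : Measurable fun ω k => x k ω := measurable_pi_lambda _ hx.measurable
  have hms : MeasurableSet {ω | a ≤ nearestLevel lam M (fun k => x k ω)} :=
    measurableSet_le measurable_const (measurable_nearestLevel.comp hX)
  have hmq : Measurable fun x => ∏ i : Fin M, detProb M Γ α C P x i ^ κ i :=
    Finset.measurable_fun_prod _ fun i _ => (measurable_detProb i).pow_const _
  have h1 : ∀ ω, ∏ i, (detProb M Γ α C P (fun k => x k ω) i).toReal ^ κ i =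
      (∏ i, detProb M Γ α C P (fun k => x k ω) i ^ κ i).toReal := fun ω => by
    simp_rw [ENNReal.toReal_prod, ENNReal.toReal_pow]
  have hle : ∀ x, ∏ i : Fin M, detProb M Γ α C P x i ^ κ i ≤ 1 := fun x =>
    Finset.prod_le_one' fun i _ => pow_le_one₀ zero_le (detProb_le_one x i)
  simp_rw [h1]
  have hmq' := hmq.comp hX
  simp only [Function.comp_def] at hmq'
  rw [integral_toReal hmq'.aemeasurable
    (ae_of_all _ fun ω => (hle _).trans_lt ENNReal.one_lt_top), ← lintegral_indicator hms]
  have h2 := hx.lintegral_regularAbove (P := P) hM hlam hΓ hC hα ha κ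
  have h3 : ∀ᵐ ω ∂μ, {ω | a ≤ nearestLevel lam M (fun k => x k ω)}.indicator
      (fun ω => ∏ i, detProb M Γ α C P (fun k => x k ω) i ^ κ i) ω =
      (regularAbove M lam α C a).indicator (fun x => ∏ i, detProb M Γ α C P x i ^ κ i)
        (fun k => x k ω) := by
    filter_upwards [hx.ae_isRegular hM hlam hC hα] with ω hω
    by_cases h : a ≤ nearestLevel lam M (fun k => x k ω)
    · rw [Set.indicator_of_mem (show ω ∈ {ω | a ≤ nearestLevel lam M (fun k => x k ω)} from h),
        Set.indicator_of_mem]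
      exact ⟨hω, (le_nearestLevel_iff hM hlam ha _).1 h⟩
    · rw [Set.indicator_of_notMem (show ω ∉ {ω | a ≤ nearestLevel lam M (fun k => x k ω)} from h),
        Set.indicator_of_notMem]
      exact fun h' => h ((le_nearestLevel_iff hM hlam ha _).2 h'.2)
  rw [lintegral_congr_ae h3, h2, ENNReal.toReal_prod]
  refine Finset.prod_congr rfl fun i _ => ENNReal.toReal_ofReal ?_
  have := H_nonneg (α := α) hΓ (κ i)
  positivity

lemma IsPoissonProcess.setIntegral_toReal_missProb (hx : IsPoissonProcess μ x lam) (hM : 1 ≤ M)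
    (hlam : 0 < lam) (hΓ : 0 < Γ) (hC : 0 < C) (hα : 2 < α) {a : ℝ} (ha : 0 ≤ a) (j : ℕ) :
    ∫ ω in {ω | a ≤ nearestLevel lam M (fun k => x k ω)},
      (missProb M Γ α C P (fun k => x k ω) j).toReal ∂μ = missTail α Γ j a ^ M := by
  have hX : Measurable fun ω k => x k ω := measurable_pi_lambda _ hx.measurable
  simp_rw [toReal_missProb]
  rw [integral_finsetSum]
  · simp_rw [integral_const_mul, hx.setIntegral_prod_toReal_detProb hM hlam hΓ hC hα ha,
      ← Finset.prod_mul_distrib]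
    rw [← Finset.prod_univ_sum (fun _ : Fin M => Finset.range (j + 1)) fun _ k =>
      (-1 : ℝ) ^ k * (j.choose k : ℝ) * (Real.exp (-((1 + 2 * H k α Γ) * a)) / (1 + 2 * H k α Γ)),
      Finset.prod_const, Finset.card_univ, Fintype.card_fin, missTail]
  · intro κ _
    refine Integrable.const_mul ?_ _
    refine Integrable.of_bound (C := 1) ?_ (ae_of_all _ fun ω => ?_)
    · have : Measurable fun x => ∏ i : Fin M, (detProb M Γ α C P x i).toReal ^ κ i :=
        Finset.measurable_fun_prod _ fun i _ => (measurable_detProb i).ennreal_toReal.pow_const _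
      exact (this.comp hX).aestronglyMeasurable
    · have h0 : ∀ i, 0 ≤ (detProb M Γ α C P (fun k => x k ω) i).toReal ^ κ i := fun i => by positivity
      rw [Real.norm_of_nonneg (Finset.prod_nonneg fun i _ => h0 i)]
      refine Finset.prod_le_one (fun i _ => h0 i) fun i _ => pow_le_one₀ ENNReal.toReal_nonneg ?_
      exact ENNReal.toReal_mono ENNReal.one_ne_top (detProb_le_one _ i)

lemma IsPoissonProcess.setLIntegral_missProb (hx : IsPoissonProcess μ x lam) (hM : 1 ≤ M)
    (hlam : 0 < lam) (hΓ : 0 < Γ) (hC : 0 < C) (hα : 2 < α) {a : ℝ} (ha : 0 ≤ a) (j : ℕ) :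
    ∫⁻ ω in {ω | a ≤ nearestLevel lam M (fun k => x k ω)}, missProb M Γ α C P (fun k => x k ω) j ∂μ =
    ENNReal.ofReal (missTail α Γ j a ^ M) := by
  have hX : Measurable fun ω k => x k ω := measurable_pi_lambda _ hx.measurable
  have h1 := fun ω => missProb_le_one (M := M) (Γ := Γ) (α := α) (C := C) (P := P) (fun k => x k ω) j
  have hfin : ∫⁻ ω in {ω | a ≤ nearestLevel lam M (fun k => x k ω)},
      missProb M Γ α C P (fun k => x k ω) j ∂μ ≠ ∞ := by
    refine ((lintegral_mono h1).trans_lt ?_).ne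
    rw [lintegral_one]
    exact measure_lt_top _ _
  have hm := (measurable_missProb (M := M) (Γ := Γ) (α := α) (C := C) (P := P) j).comp hX
  simp only [Function.comp_def] at hm
  rw [← ENNReal.ofReal_toReal hfin, ← integral_toReal hm.aemeasurable
    (ae_of_all _ fun ω => (h1 ω).trans_lt ENNReal.one_lt_top)]
  rw [hx.setIntegral_toReal_missProb hM hlam hΓ hC hα ha]

end Law

section ConditionalLaw

variable {Ω : Type*} [MeasurableSpace Ω] {μ : Measure Ω} [IsProbabilityMeasure μ] {x : ℕ → Ω → ℂ}
variable {M : ℕ} {lam Γ α C P : ℝ}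

lemma IsPoissonProcess.missTerm_nonneg (hx : IsPoissonProcess μ x lam) (hM : 1 ≤ M)
    (hlam : 0 < lam) (hΓ : 0 < Γ) (hα : 2 < α) (j : ℕ) {v : ℝ} (hv : 0 ≤ v) :
    0 ≤ missTerm M α Γ j v := by
  have h0 := fun a (ha : 0 ≤ a) =>
    hx.setIntegral_toReal_missProb (P := 1) hM hlam hΓ one_pos hα ha j
  have hanti : AntitoneOn (fun v => missTail α Γ j v ^ M) (Set.Ici 0) := fun a ha b hb hab => by
    simp only
    rw [← h0 a ha, ← h0 b hb]
    refine setIntegral_mono_set ?_ (ae_of_all _ fun _ => ENNReal.toReal_nonneg)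
      (ae_of_all _ fun ω hω => le_trans hab hω)
    refine Integrable.of_bound (C := 1) ?_ (ae_of_all _ fun ω => ?_)
    · exact ((measurable_missProb j).comp
        (measurable_pi_lambda _ hx.measurable)).ennreal_toReal.aestronglyMeasurable
    · rw [Real.norm_of_nonneg ENNReal.toReal_nonneg]
      exact ENNReal.toReal_mono ENNReal.one_ne_top (missProb_le_one _ _)
  have h1 := hanti.derivWithin_nonpos (x := v)
  rw [(hasDerivAt_missTail_pow hM hΓ j v).hasDerivWithinAt.derivWithin
    (uniqueDiffOn_Ici (0 : ℝ) v hv), neg_nonpos] at h1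
  have hM' : (0 : ℝ) < M := by exact_mod_cast hM
  exact nonneg_of_mul_nonneg_right h1 (by positivity)

lemma IsPoissonProcess.map_withDensity_missProb (hx : IsPoissonProcess μ x lam) (hM : 1 ≤ M)
    (hlam : 0 < lam) (hΓ : 0 < Γ) (hC : 0 < C) (hα : 2 < α) (j : ℕ) :
    (μ.withDensity fun ω => missProb M Γ α C P (fun k => x k ω) j).map
      (fun ω => nearestLevel lam M (fun k => x k ω)) =
    (volume.restrict (Set.Ioi 0)).withDensity
      fun v => ENNReal.ofReal (M * Real.exp (-(M * v)) * missTerm M α Γ j v) := by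
  have hX : Measurable fun ω k => x k ω := measurable_pi_lambda _ hx.measurable
  have hV : Measurable fun ω => nearestLevel lam M (fun k => x k ω) :=
    measurable_nearestLevel.comp hX
  have : IsFiniteMeasure (μ.withDensity fun ω => missProb M Γ α C P (fun k => x k ω) j) := by
    refine isFiniteMeasure_withDensity ((lintegral_mono fun ω => missProb_le_one _ j).trans_lt ?_).ne
    rw [lintegral_one]
    exact measure_lt_top _ _
  have key : ∀ a : ℝ, 0 ≤ a → ∫⁻ v in Set.Ioi a,
      ENNReal.ofReal (M * Real.exp (-(M * v)) * missTerm M α Γ j v) =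
      ENNReal.ofReal (missTail α Γ j a ^ M) := by
    intro a ha
    have hd : ∀ v ∈ Set.Ici a, HasDerivAt (fun v => missTail α Γ j v ^ M) _ v :=
      fun v _ => hasDerivAt_missTail_pow hM hΓ j v
    have hn : ∀ v ∈ Set.Ioi a, 0 ≤ M * Real.exp (-(M * v)) * missTerm M α Γ j v := fun v hv =>
      mul_nonneg (by positivity) (hx.missTerm_nonneg hM hlam hΓ hα j (ha.trans (le_of_lt hv)))
    have hn' : ∀ v ∈ Set.Ioi a, -(M * Real.exp (-(M * v)) * missTerm M α Γ j v) ≤ 0 := fun v hv =>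
      neg_nonpos.2 (hn v hv)
    have h1 := integral_Ioi_of_hasDerivAt_of_nonpos' hd hn' (tendsto_missTail_pow hM hΓ j)
    have h2 := integrableOn_Ioi_deriv_of_nonpos' hd hn' (tendsto_missTail_pow hM hΓ j)
    rw [integral_neg, zero_sub, neg_inj] at h1
    rw [← h1, ofReal_integral_eq_lintegral_ofReal]
    · simpa [IntegrableOn] using IntegrableOn.neg h2
    · exact (ae_restrict_iff' measurableSet_Ioi).2 (ae_of_all _ hn)
  refine Measure.ext_of_Ici _ _ fun a => ?_
  rw [Measure.map_apply hV measurableSet_Ici, withDensity_apply _ (hV measurableSet_Ici),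
    withDensity_apply _ measurableSet_Ici, Measure.restrict_restrict measurableSet_Ici]
  rcases le_total 0 a with ha | ha
  · rw [show (fun ω => nearestLevel lam M (fun k => x k ω)) ⁻¹' Set.Ici a =
      {ω | a ≤ nearestLevel lam M (fun k => x k ω)} from rfl,
      hx.setLIntegral_missProb hM hlam hΓ hC hα ha, ← key a ha]
    refine setLIntegral_congr ?_
    have h3 := (Ioi_ae_eq_Ici (μ := volume) (a := a)).inter (ae_eq_refl (Set.Ioi (0 : ℝ)))
    rwa [Set.inter_eq_left.2 (Set.Ioi_subset_Ioi ha)] at h3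
  · have h3 : Set.Ioi 0 ⊆ Set.Ici a := fun v hv => ha.trans (le_of_lt hv)
    rw [Set.inter_eq_right.2 h3, key 0 le_rfl,
      ← hx.setLIntegral_missProb (P := P) hM hlam hΓ hC hα le_rfl]
    congr 2
    ext ω
    have := nearestLevel_nonneg (M := M) hlam fun k => x k ω
    exact ⟨fun _ => this, fun _ => ha.trans this⟩

lemma IsPoissonProcess.setLIntegral_missTerm (hx : IsPoissonProcess μ x lam) (hM : 1 ≤ M)
    (hlam : 0 < lam) (hΓ : 0 < Γ) (hC : 0 < C) (hα : 2 < α) (j : ℕ) {A : Set ℝ}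
    (hA : MeasurableSet A) :
    ∫⁻ ω in {ω | nearestLevel lam M (fun k => x k ω) ∈ A},
      ENNReal.ofReal (missTerm M α Γ j (nearestLevel lam M (fun k => x k ω))) ∂μ =
    ∫⁻ ω in {ω | nearestLevel lam M (fun k => x k ω) ∈ A},
      missProb M Γ α C P (fun k => x k ω) j ∂μ := by
  have hV : Measurable fun ω => nearestLevel lam M (fun k => x k ω) :=
    measurable_nearestLevel.comp (measurable_pi_lambda _ hx.measurable)
  have h0 := hx.map_withDensity_missProb (P := P) hM hlam hΓ hC hα 0
  simp only [missProb, pow_zero, Finset.prod_const_one, missTerm_zero, mul_one] at h0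
  rw [withDensity_const, one_smul] at h0
  have hg : Measurable fun v => ENNReal.ofReal (missTerm M α Γ j v) :=
    (measurable_missTerm j).ennreal_ofReal
  have hd : Measurable fun v : ℝ => ENNReal.ofReal (M * Real.exp (-(M * v))) := by fun_prop
  have h1 := hx.map_withDensity_missProb (P := P) hM hlam hΓ hC hα j
  have h2 : (fun v => ENNReal.ofReal (M * Real.exp (-(M * v)) * missTerm M α Γ j v)) =
      (fun v => ENNReal.ofReal (M * Real.exp (-(M * v)))) *
        fun v => ENNReal.ofReal (missTerm M α Γ j v) := by
    ext v
    exact ENNReal.ofReal_mul (by positivity)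
  rw [h2, withDensity_mul _ hd hg, ← h0] at h1
  have h3 := congrArg (fun ν => ν A) h1
  rw [Measure.map_apply hV hA, withDensity_apply _ (hV hA), withDensity_apply _ hA,
    setLIntegral_map hA hg hV] at h3
  exact h3.symm

end ConditionalLaw

section CellSearchTime

lemma measurableSet_forall_not_success {X : Type*} [MeasurableSpace X] {x : ℕ → X → ℂ}
    {F : ℕ → ℕ → X → ℝ} {M : ℕ} {Γ α C P : ℝ} (hx : ∀ k, Measurable (x k))
    (hF : ∀ n k, Measurable (F n k)) (j : ℕ) :
    MeasurableSet {ω | ∀ n ∈ Finset.Icc 1 j,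
      ¬ Success M Γ (fun r => C * r ^ α) 0 P (fun k => x k ω) (fun k => F n k ω)} := by
  have : {ω | ∀ n ∈ Finset.Icc 1 j,
      ¬ Success M Γ (fun r => C * r ^ α) 0 P (fun k => x k ω) (fun k => F n k ω)} =
      ⋂ n ∈ Finset.Icc 1 j,
        {ω | Success M Γ (fun r => C * r ^ α) 0 P (fun k => x k ω) (fun k => F n k ω)}ᶜ := by
    ext ω
    simp only [Set.mem_iInter, Set.mem_compl_iff, Set.mem_ofPred_eq]
  rw [this]
  exact Finset.measurableSet_biInter _ fun n _ => (measurableSet_success hx (hF n)).compl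

variable {Ω : Type*} [MeasurableSpace Ω] {μ : Measure Ω} [IsProbabilityMeasure μ] {x : ℕ → Ω → ℂ}
variable {M : ℕ} {lam Γ α C P : ℝ} {F : ℕ → ℕ → Ω → ℝ}

lemma ae_eq_condLExp_not_success (hx : IsPoissonProcess μ x lam) (hF : IsRayleighFading μ x F)
    (hM : 1 ≤ M) (hlam : 0 < lam) (hΓ : 0 < Γ) (hC : 0 < C) (hα : 2 < α) (j : ℕ) :
    (fun ω => ENNReal.ofReal (missTerm M α Γ j (nearestLevel lam M (fun k => x k ω)))) =ᵐ[μ]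
    condLExp (MeasurableSpace.comap (fun ω => nearestDist (fun k => x k ω)) inferInstance) μ
      ({ω | ∀ n ∈ Finset.Icc 1 j,
        ¬ Success M Γ (fun r => C * r ^ α) 0 P (fun k => x k ω) (fun k => F n k ω)}.indicator 1) := by
  have hX : Measurable fun ω k => x k ω := measurable_pi_lambda _ hx.measurable
  have hm : MeasurableSpace.comap (fun ω => nearestDist (fun k => x k ω)) inferInstance ≤
      (inferInstance : MeasurableSpace Ω) := (measurable_nearestDist.comp hX).comap_le
  refine ae_eq_condLExp (hm := hm) μ _ ?_ fun s hs => ?_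
  · have hR : Measurable[MeasurableSpace.comap (fun ω => nearestDist (fun k => x k ω)) inferInstance]
        fun ω => nearestDist (fun k => x k ω) := comap_measurable _
    have hg : Measurable fun r : ℝ =>
        ENNReal.ofReal (missTerm M α Γ j (Real.pi * lam * r ^ 2 / M)) :=
      ((measurable_missTerm j).comp (by fun_prop)).ennreal_ofReal
    exact hg.comp hR
  · obtain ⟨A, hA, rfl⟩ := hs
    have hq : Measurable fun v : ℝ => √(v * M / (Real.pi * lam)) := by fun_prop
    have hset : (fun ω => nearestDist (fun k => x k ω)) ⁻¹' A =
        {ω | nearestLevel lam M (fun k => x k ω) ∈ (fun v => √(v * M / (Real.pi * lam))) ⁻¹' A} := by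
      ext ω
      simp only [Set.mem_preimage, Set.mem_ofPred_eq, sqrt_nearestLevel hM hlam]
    have h1 := measure_locations_inter_forall_not_success (P := P) hΓ hC hx.measurable hF
      (hx.ae_isRegular hM hlam hC hα) (measurable_nearestDist hA) j
    have hS := measurableSet_forall_not_success (M := M) (Γ := Γ) (α := α) (C := C) (P := P)
      hx.measurable hF.measurable j
    rw [hset, hx.setLIntegral_missTerm (P := P) hM hlam hΓ hC hα j (hq hA), ← hset,
      lintegral_indicator_one hS, Measure.restrict_apply hS]
    refine h1.symm.trans ?_
    congr 1
    ext ω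
    exact and_comm

lemma condMeanCycles_ae_eq (hx : IsPoissonProcess μ x lam) (hF : IsRayleighFading μ x F)
    (hM : 1 ≤ M) (hlam : 0 < lam) (hΓ : 0 < Γ) (hC : 0 < C) (hα : 2 < α) :
    condMeanCycles μ M Γ (fun r => C * r ^ α) 0 P x F =ᵐ[μ]
      fun ω => ∑' j, ENNReal.ofReal (missTerm M α Γ j (nearestLevel lam M (fun k => x k ω))) := by
  have h1 : (fun ω => numCycles M Γ (fun r => C * r ^ α) 0 P (fun k => x k ω) fun n k => F n k ω) =
      ∑' j : ℕ, {ω | ∀ n ∈ Finset.Icc 1 j,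
        ¬ Success M Γ (fun r => C * r ^ α) 0 P (fun k => x k ω) (fun k => F n k ω)}.indicator 1 := by
    ext ω
    rw [numCycles, iInf_eq_tsum_not_before, ENNReal.tsum_apply]
    rfl
  have h2 : ∀ j, AEMeasurable ({ω | ∀ n ∈ Finset.Icc 1 j, ¬ Success M Γ (fun r => C * r ^ α) 0 P
      (fun k => x k ω) (fun k => F n k ω)}.indicator (1 : Ω → ℝ≥0∞)) μ := fun j =>
    (measurable_one.indicator
      (measurableSet_forall_not_success hx.measurable hF.measurable j)).aemeasurable
  rw [condMeanCycles, h1]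
  refine (condLExp_tsum _ h2).trans ?_
  filter_upwards [ae_all_iff.2 fun j =>
    ae_eq_condLExp_not_success (P := P) hx hF hM hlam hΓ hC hα j] with ω hω
  rw [ENNReal.tsum_apply]
  exact tsum_congr fun j => (hω j).symm

lemma IsPoissonProcess.ae_tsum_missTerm_ne_top (hx : IsPoissonProcess μ x lam)
    (hM : 1 ≤ M) (hlam : 0 < lam) (hΓ : 0 < Γ) (hα : 2 < α) :
    ∀ᵐ ω ∂μ, ∑' j, ENNReal.ofReal (missTerm M α Γ j (nearestLevel lam M (fun k => x k ω))) ≠ ∞ := by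
  have hX : Measurable fun ω k => x k ω := measurable_pi_lambda _ hx.measurable
  have hV : Measurable fun ω => nearestLevel lam M (fun k => x k ω) :=
    measurable_nearestLevel.comp hX
  have hg : ∀ j, Measurable fun ω =>
      ENNReal.ofReal (missTerm M α Γ j (nearestLevel lam M (fun k => x k ω))) := fun j =>
    ((measurable_missTerm j).comp hV).ennreal_ofReal
  have h1 : ∀ b : ℕ, ∀ᵐ ω ∂μ, nearestLevel lam M (fun k => x k ω) ∈ Set.Iio (b : ℝ) →
      ∑' j, ENNReal.ofReal (missTerm M α Γ j (nearestLevel lam M (fun k => x k ω))) ≠ ∞ := by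
    intro b
    refine (ae_restrict_iff' (hV measurableSet_Iio)).1 ?_
    suffices h : ∫⁻ ω in (fun ω => nearestLevel lam M (fun k => x k ω)) ⁻¹' Set.Iio (b : ℝ),
        ∑' j, ENNReal.ofReal (missTerm M α Γ j (nearestLevel lam M (fun k => x k ω))) ∂μ ≠ ∞ by
      filter_upwards [ae_lt_top (measurable_tsum_ennreal hg) h] with ω hω using hω.ne
    rw [lintegral_tsum fun j => (hg j).aemeasurable]
    have h2 := fun j => hx.setLIntegral_missTerm (P := 1) hM hlam hΓ one_pos hα j
      (measurableSet_Iio (a := (b : ℝ)))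
    refine (tsum_congr h2).trans_ne ?_
    have hm : ∀ j, AEMeasurable (fun ω => missProb M Γ α 1 1 (fun k => x k ω) j)
        (μ.restrict ((fun ω => nearestLevel lam M (fun k => x k ω)) ⁻¹' Set.Iio (b : ℝ))) :=
      fun j => ((measurable_missProb j).comp hX).aemeasurable
    refine (lintegral_tsum hm).symm.trans_ne ?_
    refine (lt_of_le_of_lt ?_ (hx.lintegral_iSup_cycleBound_lt_top (M := M) hlam hΓ hα
      (Nat.cast_nonneg b))).ne
    refine le_trans ?_ (setLIntegral_le_lintegral
      ((fun ω => nearestLevel lam M (fun k => x k ω)) ⁻¹' Set.Iio (b : ℝ)) _)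
    refine lintegral_mono_ae ((ae_restrict_iff' (hV measurableSet_Iio)).2 ?_)
    filter_upwards [hx.ae_isRegular (C := 1) hM hlam one_pos hα,
      hx.ae_count_cell_ne_top hlam one_pos] with ω hω hc hb
    exact tsum_prod_one_sub_detProb_le hM hlam hΓ one_pos hα hω hc (Nat.cast_nonneg b)
      fun h => not_le.2 hb ((le_nearestLevel_iff hM hlam (Nat.cast_nonneg b) _).2 h)
  filter_upwards [ae_all_iff.2 h1] with ω hω
  obtain ⟨b, hb⟩ := exists_nat_gt (nearestLevel lam M fun k => x k ω)
  exact hω b hb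

end CellSearchTime

end CellSearch

open CellSearch in
theorem mainTheorem11 {Ω : Type*} [MeasurableSpace Ω] (μ : Measure Ω) [IsProbabilityMeasure μ]
    (M : ℕ) (hM : 1 ≤ M) (lam Γ α C P : ℝ)
    (hlam : 0 < lam) (hΓ : 0 < Γ) (hα : 2 < α) (hC : 0 < C) (hP : 0 < P)
    (x : ℕ → Ω → ℂ) (hx : IsPoissonProcess μ x lam)
    (F : ℕ → ℕ → Ω → ℝ) (hF : IsRayleighFading μ x F) :
    (∀ k : ℕ, IntegrableOn (hIntegrand k α Γ) (Set.Ioi (1 : ℝ))) ∧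
    ∀ᵐ ω ∂μ,
      condMeanCycles μ M Γ (fun r => C * r ^ α) 0 P x F ω ≠ ∞ ∧
      HasSum
        (fun j : ℕ =>
          (∑ k ∈ Finset.range (j + 1), (-1 : ℝ) ^ k * (j.choose k : ℝ) *
            Real.exp (-(2 * Real.pi * lam * nearestDist (fun m => x m ω) ^ 2 * H k α Γ / M))) *
          (∑ k ∈ Finset.range (j + 1), (-1 : ℝ) ^ k * (j.choose k : ℝ) *
            Real.exp (-(2 * Real.pi * lam * nearestDist (fun m => x m ω) ^ 2 * H k α Γ / M)) /
              (1 + 2 * H k α Γ)) ^ (M - 1))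
        (condMeanCycles μ M Γ (fun r => C * r ^ α) 0 P x F ω).toReal := by
  refine ⟨fun k => integrableOn_hIntegrand hΓ hα k, ?_⟩
  filter_upwards [condMeanCycles_ae_eq (P := P) hx hF hM hlam hΓ hC hα,
    hx.ae_tsum_missTerm_ne_top hM hlam hΓ hα] with ω h1 h2
  rw [h1]
  refine ⟨h2, ?_⟩
  have h3 := ENNReal.hasSum_toReal h2
  rw [ENNReal.tsum_toReal_eq fun j => ENNReal.ofReal_ne_top]
  refine h3.congr_fun fun j => ?_
  rw [ENNReal.toReal_ofReal (hx.missTerm_nonneg hM hlam hΓ hα j (nearestLevel_nonneg hlam _)),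
    missTerm]
  have h4 : ∀ k, 2 * H k α Γ * nearestLevel lam M (fun m => x m ω) =
      2 * Real.pi * lam * nearestDist (fun m => x m ω) ^ 2 * H k α Γ / M := fun k => by
    rw [nearestLevel]; ring
  simp_rw [h4]
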